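/- Let $\Delta=-\partial_x^2$ on $L^2(0,\pi)$ with domain $H^2(0,\pi)\cap H^1_0(0,\pi)$, let $\Delta^s$ be its powers given by the spectral theorem, and put $X^p=\mathrm{Dom}(\Delta^{p/2})$, so that $X^0=L^2(0,\pi)$ and $X^2=H^2(0,\pi)\cap H^1_0(0,\pi)$. Let $\alpha\in[0,3/2)$, let $\rho>0$, and let $\Omega\subset(0,\pi)$ be open and non-empty. For $T>0$ and $f\in L^2(\Omega\times(0,T))$ consider the structurally damped beam $$u_{tt}+\Delta^2u+\rho\,\Delta^{\alpha}u_t=\chi_\Omega f\quad\text{in }(0,\pi)\times(0,T),$$ $$u(0,t)=u(\pi,t)=u_{xx}(0,t)=u_{xx}(\pi,t)=0,\qquad u(\cdot,0)=u^0,\quad u_t(\cdot,0)=u^1,$$ where $\chi_\Omega$ is the characteristic function of $\Omega$; solutions are weak solutions with $u\in C([0,T];X^2)\cap C^1([0,T];X^0)$. There are a constant $C'>0$ depending only on $\alpha$ and $\rho$ and a constant $C>0$ depending only on $\alpha$, $\rho$ and $\Omega$ such that for every $T>0$ and every $(u^0,u^1)\in X^2\times X^0$ there is a control $f\in L^2(\Omega\times(0,T))$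 for which the system has a solution $u$, the solution satisfies $$u(\cdot,T)=u_t(\cdot,T)=0,$$ and $$\|f\|_{L^2(\Omega\times(0,T))}\le C\,e^{Q(T)}\bigl(\|u^0_{xx}\|_{L^2(0,\pi)}+\|u^1\|_{L^2(0,\pi)}\bigr),\qquad Q(T)=\begin{cases}C'/T,&\alpha\le 1,\\ C'/T^{1/(3-2\alpha)},&\alpha\in(1,3/2).\end{cases}$$ -/

import Mathlib

open MeasureTheory Set

noncomputable section

/-- `X⁰ = L²(0, π)`, with real (`𝕜 = ℝ`) or complex (`𝕜 = ℂ`) values. -/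
abbrev BeamL2 (𝕜 : Type*) [RCLike 𝕜] : Type _ :=
  Lp 𝕜 2 (volume.restrict (Ioo (0 : ℝ) Real.pi))

/-- `L²(Ω × (0, T))`, the space of controls; the first variable is `x`, the second one is `t`. -/
abbrev ControlL2 (𝕜 : Type*) [RCLike 𝕜] (Ω : Set ℝ) (T : ℝ) : Type _ :=
  Lp 𝕜 2 ((volume : Measure (ℝ × ℝ)).restrict (Ω ×ˢ Ioo (0 : ℝ) T))

/-- `w ∈ H²(0, π) ∩ H¹₀(0, π)` and `Δ w = -w_xx = g`: the class `w` has a `C¹` representative `y`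
on `[0, π]` that vanishes at both end points and whose derivative `p` is absolutely continuous
with `p' = -g ∈ L²(0, π)`. -/
def IsDirichletLaplacian {𝕜 : Type*} [RCLike 𝕜] (w g : BeamL2 𝕜) : Prop :=
  ∃ y p : ℝ → 𝕜,
    (∀ᵐ x ∂(volume.restrict (Ioo (0 : ℝ) Real.pi)), w x = y x) ∧
    (∀ x ∈ Icc (0 : ℝ) Real.pi, HasDerivWithinAt y (p x) (Icc (0 : ℝ) Real.pi) x) ∧
    (∀ x ∈ Icc (0 : ℝ) Real.pi, p x = p 0 - ∫ z in (0 : ℝ)..x, g z) ∧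
    y 0 = 0 ∧ y Real.pi = 0

/-- The coefficient of `w` along the eigenfunction `φ_n(x) = √(2/π) sin (n x)` of `Δ`, whose
eigenvalue is `n²`; `(φ_n)`, `n ≥ 1`, is an orthonormal basis of `L²(0, π)`. -/
def sineCoeff {𝕜 : Type*} [RCLike 𝕜] (n : ℕ) (w : BeamL2 𝕜) : 𝕜 :=
  ∫ x in Ioo (0 : ℝ) Real.pi, ((Real.sqrt (2 / Real.pi) * Real.sin (n * x) : ℝ) : 𝕜) * w x

/-- `w ∈ Dom(Δ^s)` and `Δ^s w = g`, where `Δ^s` is given by the spectral theorem: it multiplies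
the coefficient along `φ_n` by `n^(2s)`, and its domain consists of those `w` for which the
resulting sequence is the coefficient sequence of an element `g` of `L²(0, π)`. -/
def IsLaplacianPower {𝕜 : Type*} [RCLike 𝕜] (s : ℝ) (w g : BeamL2 𝕜) : Prop :=
  ∀ n : ℕ, 1 ≤ n → sineCoeff n g = (((n : ℝ) ^ (2 * s) : ℝ) : 𝕜) * sineCoeff n w

/-- On the time interval `[0, T]`, `u` is the (weak) solution, with velocity `v = u_t`, of
`u_tt + Δ² u + ρ Δ^α u_t = χ_Ω f`, `u(0,t) = u(π,t) = u_xx(0,t) = u_xx(π,t) = 0`,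
`u(·,0) = u⁰`, `u_t(·,0) = u¹`, in the class `u ∈ C([0,T]; X²) ∩ C¹([0,T]; X⁰)`.
The equation is tested with all `ψ ∈ Dom(Δ) ∩ Dom(Δ^α)` and integrated from `0` to `t`. -/
structure IsBeamSolution {𝕜 : Type*} [RCLike 𝕜] (α ρ : ℝ) (Ω : Set ℝ) (T : ℝ)
    (f : ControlL2 𝕜 Ω T) (u₀ u₁ : BeamL2 𝕜) (u v : ℝ → BeamL2 𝕜) : Prop where
  /-- `u(·,0) = u⁰` -/
  init_pos : u 0 = u₀
  /-- `u_t(·,0) = u¹` -/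
  init_vel : v 0 = u₁
  /-- `u_t = v` in `X⁰` -/
  hasDeriv : ∀ t ∈ Icc (0 : ℝ) T, HasDerivWithinAt u (v t) (Icc (0 : ℝ) T) t
  /-- `u_t` is continuous with values in `X⁰` -/
  cont_vel : ContinuousOn v (Icc (0 : ℝ) T)
  /-- `u` is continuous with values in `X² = Dom(Δ)`, and the equation holds -/
  weak_form : ∃ w : ℝ → BeamL2 𝕜,
    ContinuousOn w (Icc (0 : ℝ) T) ∧
    (∀ t ∈ Icc (0 : ℝ) T, IsDirichletLaplacian (u t) (w t)) ∧
    ∀ ψ ψΔ ψα : BeamL2 𝕜, IsDirichletLaplacian ψ ψΔ → IsLaplacianPower α ψ ψα →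
      ∀ t ∈ Icc (0 : ℝ) T,
        inner 𝕜 ψ (v t) - inner 𝕜 ψ u₁
          + ∫ s in (0 : ℝ)..t, (inner 𝕜 ψΔ (w s) + (ρ : 𝕜) * inner 𝕜 ψα (v s))
        = ∫ z in Ω ×ˢ Ioo (0 : ℝ) t, (starRingEnd 𝕜) (ψ z.1) * f z

/-- The exponent in the bound for the cost of control: `K / T` for `α ≤ 1` and
`K / T^(1/(3 - 2α))` for `α > 1`. -/
def costExponent (α K T : ℝ) : ℝ :=
  if α ≤ 1 then K / T else K / T ^ (1 / (3 - 2 * α))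

end

/-!
In the sine basis the beam is a family of damped oscillators `y'' + ρ n^(2α) y' + n⁴ y = g`, one for
each mode `n`, and the roots of their characteristic polynomials form two branches. Along each
branch the roots are separated like the `γ`-th powers of the integers, `γ = rootExponent α` being
`2` for `α ≤ 1` and `4 - 2α` for `α > 1` (`exists_rootBounds`). As `α < 3/2` means `γ > 1`, the
infinite products of the factors `1 + x / (z - r)`, over the roots `r` that keep a distance from
`z`, are entire functions of `x` whose `j`-th coefficient is at most of size `B ^ j / (j!) ^ γ`
(`exists_productBound`, `norm_infProdCoeff_le`).

Such a product acts as a differential operator of infinite order (`seriesOp`) on a cut-off function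
of Gevrey order `γ`. A cut-off that changes within time `T` and has any prescribed radius of
regularity exists at the cost `exp (κ / T ^ (1 / (γ - 1)))` (`exists_gevrey_cutoff`); this is where
the exponent `1 / (3 - 2α)` comes from. On functions `e^(zt) H` the factor `1 + ∂ / (z - r)` is
`(∂ - r) / (z - r)`, up to the exponential. Let `z` be a root of mode `n` and `r` range over the roots
of the other modes. A mode both of whose factors occur in the product responds to the resulting
forcing by the same expression without these two factors, which is flat at both ends. So there is a
scalar control that brings mode `n` to rest and leaves every other mode at rest, apart from
boundedly many modes having a root near one of those of `n` (`exists_mode_controls`).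

Those near modes are taken care of in space. By a Turán inequality for sine polynomials with a
bounded number of terms (`exists_turan`), there is a function on the region, bounded independently
of `n` in `L²`, whose product with the sine of mode `n` has integral one and which is orthogonal to
the sines of the modes near `n` (`exists_dual_sines`). Multiplying it by the scalar control of mode
`n` and summing over `n` gives the control of the beam. The sum is estimated by comparing its
spatial coefficients with an `ℓ²` sequence of amplitudes (`summable_sq_sum_neighbours`), and for
`T > 1` the control acts only up to time one.

A weak solution is the same thing as its sequence of sine coefficients: the Dirichlet Laplacian acts
on these by `n²` (`IsDirichletLaplacian.coeff_eq`, `isDirichletLaplacian_of_sineCoeff`), the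
evolution exists by summing the oscillators (`exists_evolution`), and every coefficient of a solution
solves its oscillator (`IsBeamSolution.mode`). A mode receives, besides its own control, the
controls meant for modes far from it, and these leave it at rest (`eq_zero_of_steers`), so the
whole beam is at rest at time `T`.
-/
noncomputable section


/-! ### A cut-off function with prescribed growth of its derivatives -/

/-- The average of `f` over `[t - a, t]`, that is, the convolution of `f` with the normalized
indicator of `[0, a]`. -/
def boxAverage (a : ℝ) (f : ℝ → ℝ) (t : ℝ) : ℝ := ∫ u in (0 : ℝ)..1, f (t - a * u)

/-- `m` successive averages of `S`, over boxes of widths `a K, …, a (K + m - 1)`. -/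
def iteratedBoxAverage (a : ℕ → ℝ) (S : ℝ → ℝ) : ℕ → ℕ → ℝ → ℝ
  | 0, _ => S
  | m + 1, K => boxAverage (a K) (iteratedBoxAverage a S m (K + 1))

lemma boxAverage_integrable {f : ℝ → ℝ} (hf : Continuous f) (a t : ℝ) :
    IntervalIntegrable (fun u : ℝ => f (t - a * u)) volume 0 1 :=
  (hf.comp (by fun_prop)).intervalIntegrable _ _

lemma boxAverage_lipschitz {f : ℝ → ℝ} {L : NNReal} (hf : LipschitzWith L f) (a : ℝ) :
    LipschitzWith L (boxAverage a f) := by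
  refine LipschitzWith.of_dist_le_mul fun s t => ?_
  rw [Real.dist_eq, boxAverage, boxAverage, ← intervalIntegral.integral_sub
    (boxAverage_integrable hf.continuous a s) (boxAverage_integrable hf.continuous a t)]
  have h := intervalIntegral.norm_integral_le_of_norm_le_const (a := (0 : ℝ)) (b := 1)
    (C := L * dist s t) (f := fun u => f (s - a * u) - f (t - a * u)) (fun u _ => by
      have := hf.dist_le_mul (s - a * u) (t - a * u)
      rwa [Real.dist_eq, dist_sub_right] at this)
  simpa using h

lemma boxAverage_mem_Icc {f : ℝ → ℝ} (hf : Continuous f) (h : ∀ t, f t ∈ Icc (0 : ℝ) 1)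
    (a t : ℝ) : boxAverage a f t ∈ Icc (0 : ℝ) 1 := by
  refine ⟨intervalIntegral.integral_nonneg zero_le_one fun u _ => (h _).1, ?_⟩
  have := intervalIntegral.integral_mono_on zero_le_one (boxAverage_integrable hf a t)
    (intervalIntegrable_const (c := (1 : ℝ))) fun u _ => (h (t - a * u)).2
  simpa [boxAverage] using this

lemma boxAverage_sub_le {f g : ℝ → ℝ} (hf : Continuous f) (hg : Continuous g) {ε : ℝ}
    (h : ∀ t, |f t - g t| ≤ ε) (a t : ℝ) : |boxAverage a f t - boxAverage a g t| ≤ ε := by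
  rw [boxAverage, boxAverage, ← intervalIntegral.integral_sub
    (boxAverage_integrable hf a t) (boxAverage_integrable hg a t)]
  have := intervalIntegral.norm_integral_le_of_norm_le_const (a := (0 : ℝ)) (b := 1)
    (C := ε) (f := fun u => f (t - a * u) - g (t - a * u)) (fun u _ => h _)
  simpa using this

lemma boxAverage_sub_self_le {f : ℝ → ℝ} {L : NNReal} (hf : LipschitzWith L f) {a : ℝ}
    (ha : 0 ≤ a) (t : ℝ) : |boxAverage a f t - f t| ≤ L * a := by
  have h0 : f t = ∫ u in (0 : ℝ)..1, f t := by simp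
  rw [h0, boxAverage, ← intervalIntegral.integral_sub
    (boxAverage_integrable hf.continuous a t) intervalIntegrable_const]
  have := intervalIntegral.norm_integral_le_of_norm_le_const (a := (0 : ℝ)) (b := 1)
    (C := L * a) (f := fun u => f (t - a * u) - f t) (fun u hu => by
      rw [uIoc_of_le zero_le_one] at hu
      have := hf.dist_le_mul (t - a * u) t
      rw [Real.dist_eq, Real.dist_eq] at this
      refine this.trans (mul_le_mul_of_nonneg_left ?_ L.2)
      rw [sub_sub_cancel_left, abs_neg, abs_of_nonneg (mul_nonneg ha hu.1.le)]
      nlinarith [hu.2])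
  simpa using this

lemma boxAverage_hasDerivAt {f : ℝ → ℝ} (hf : Continuous f) {a : ℝ} (ha : a ≠ 0) (t : ℝ) :
    HasDerivAt (boxAverage a f) ((f t - f (t - a)) / a) t := by
  have h1 : boxAverage a f = fun t => a⁻¹ * ((∫ x in (0 : ℝ)..t, f x) -
      ∫ x in (0 : ℝ)..(t - a), f x) := by
    funext s
    rw [boxAverage, intervalIntegral.integral_comp_sub_mul f ha,
      intervalIntegral.integral_interval_sub_left (hf.intervalIntegrable 0 s)
        (hf.intervalIntegrable 0 (s - a))]
    simp
  rw [h1]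
  have h2 : HasDerivAt (fun t => ∫ x in (0 : ℝ)..t, f x) (f t) t :=
    (hf.integral_hasStrictDerivAt 0 t).hasDerivAt
  have h3 : HasDerivAt (fun t => ∫ x in (0 : ℝ)..(t - a), f x) (f (t - a)) t := by
    exact (hf.integral_hasStrictDerivAt 0 (t - a)).hasDerivAt.comp_sub_const t a
  have h4 := (h2.sub h3).const_mul a⁻¹
  rwa [inv_mul_eq_div] at h4

section SmoothStep

variable {a : ℕ → ℝ} {S : ℝ → ℝ} {L : NNReal}

lemma iteratedBoxAverage_lipschitz (hS : LipschitzWith L S) (m K : ℕ) :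
    LipschitzWith L (iteratedBoxAverage a S m K) := by
  induction m generalizing K with
  | zero => exact hS
  | succ m ih => exact boxAverage_lipschitz (ih _) _

lemma iteratedBoxAverage_mem_Icc (hS : LipschitzWith L S) (h : ∀ t, S t ∈ Icc (0 : ℝ) 1)
    (m K : ℕ) (t : ℝ) : iteratedBoxAverage a S m K t ∈ Icc (0 : ℝ) 1 := by
  induction m generalizing K t with
  | zero => exact h t
  | succ m ih =>
    exact boxAverage_mem_Icc (iteratedBoxAverage_lipschitz hS _ _).continuous (ih _) _ _

lemma iteratedBoxAverage_succ_sub_le (hS : LipschitzWith L S) (ha : ∀ k, 0 < a k) (m K : ℕ)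
    (t : ℝ) :
    |iteratedBoxAverage a S (m + 1) K t - iteratedBoxAverage a S m K t| ≤ L * a (K + m) := by
  induction m generalizing K t with
  | zero => exact boxAverage_sub_self_le hS (ha _).le t
  | succ m ih =>
    refine boxAverage_sub_le (iteratedBoxAverage_lipschitz hS _ _).continuous
      (iteratedBoxAverage_lipschitz hS _ _).continuous (fun s => ?_) _ _
    have := ih (K + 1) s
    rwa [show K + 1 + m = K + (m + 1) by ring] at this

lemma iteratedBoxAverage_eq_one (ha : ∀ k, 0 < a k) (h : ∀ t ≤ 0, S t = 1) (m K : ℕ) {t : ℝ}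
    (ht : t ≤ 0) : iteratedBoxAverage a S m K t = 1 := by
  induction m generalizing K t with
  | zero => exact h t ht
  | succ m ih =>
    have : ∀ u ∈ uIcc (0 : ℝ) 1, iteratedBoxAverage a S m (K + 1) (t - a K * u) = 1 := by
      intro u hu
      rw [uIcc_of_le zero_le_one] at hu
      exact ih _ (by nlinarith [ha K, hu.1, mul_nonneg (ha K).le hu.1])
    rw [iteratedBoxAverage, boxAverage, intervalIntegral.integral_congr this]
    simp

lemma iteratedBoxAverage_eq_zero (ha : ∀ k, 0 < a k) {θ : ℝ} {σ : ℕ → ℝ}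
    (hσ0 : ∀ k, 0 ≤ σ k) (hσ : ∀ k, a k + σ (k + 1) ≤ σ k) (h : ∀ t, θ ≤ t → S t = 0)
    (m K : ℕ) {t : ℝ} (ht : θ + σ K ≤ t) : iteratedBoxAverage a S m K t = 0 := by
  induction m generalizing K t with
  | zero => exact h t (by linarith [hσ0 K])
  | succ m ih =>
    have : ∀ u ∈ uIcc (0 : ℝ) 1, iteratedBoxAverage a S m (K + 1) (t - a K * u) = 0 := by
      intro u hu
      rw [uIcc_of_le zero_le_one] at hu
      exact ih _ (by nlinarith [ha K, hu.2, mul_le_mul_of_nonneg_left hu.2 (ha K).le, hσ K])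
    rw [iteratedBoxAverage, boxAverage, intervalIntegral.integral_congr this]
    simp

/-- The limit of infinitely many box averages of a Lipschitz step. The index `K` says where the
sequence of widths starts, and the recursion is what makes all derivatives explicit. -/
lemma exists_smooth_step (ha : ∀ k, 0 < a k) {θ : ℝ} (hθ : 0 < θ) {σ : ℕ → ℝ}
    (hσ0 : ∀ k, 0 ≤ σ k) (hσ : ∀ k, a k + σ (k + 1) ≤ σ k) :
    ∃ F : ℕ → ℝ → ℝ, (∀ K, Continuous (F K)) ∧ (∀ K t, F K t ∈ Icc (0 : ℝ) 1) ∧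
      (∀ K, F K = boxAverage (a K) (F (K + 1))) ∧ (∀ K t, t ≤ 0 → F K t = 1) ∧
      (∀ K t, θ + σ K ≤ t → F K t = 0) := by
  set L : NNReal := ⟨θ⁻¹, by positivity⟩ with hL
  set S : ℝ → ℝ := fun t => max 0 (min 1 (1 - θ⁻¹ * t)) with hSdef
  have hS : LipschitzWith L S := by
    have h1 : LipschitzWith L (fun t : ℝ => 1 - θ⁻¹ * t) := by
      refine LipschitzWith.of_dist_le_mul fun s t => ?_
      rw [Real.dist_eq, Real.dist_eq, show 1 - θ⁻¹ * s - (1 - θ⁻¹ * t) = -(θ⁻¹ * (s - t)) by ring,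
        abs_neg, abs_mul, abs_of_pos (inv_pos.2 hθ)]
      exact le_rfl
    exact (h1.const_min 1).const_max 0
  have hS01 : ∀ t, S t ∈ Icc (0 : ℝ) 1 := fun t =>
    ⟨le_max_left _ _, max_le zero_le_one (min_le_left _ _)⟩
  have hS1 : ∀ t ≤ 0, S t = 1 := fun t ht => by
    have : θ⁻¹ * t ≤ 0 := mul_nonpos_of_nonneg_of_nonpos (inv_pos.2 hθ).le ht
    simp only [hSdef]
    rw [min_eq_left (by linarith), max_eq_right zero_le_one]
  have hS0 : ∀ t, θ ≤ t → S t = 0 := fun t ht => by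
    have : 1 ≤ θ⁻¹ * t := by rw [inv_mul_eq_div, le_div_iff₀ hθ]; linarith
    simp only [hSdef]
    exact max_eq_left ((min_le_right _ _).trans (by linarith))
  have hsum : Summable a := by
    refine summable_of_sum_range_le (c := σ 0) (fun k => (ha k).le) fun n => ?_
    have : ∀ n, ∑ i ∈ Finset.range n, a i + σ n ≤ σ 0 := by
      intro n
      induction n with
      | zero => simp
      | succ n ih => rw [Finset.sum_range_succ]; linarith [hσ n]
    linarith [this n, hσ0 n]
  have hcau : ∀ K t, CauchySeq fun m => iteratedBoxAverage a S m K t := by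
    intro K t
    refine cauchySeq_of_dist_le_of_summable (fun m => L * a (K + m)) (fun m => ?_) ?_
    · rw [dist_comm, Real.dist_eq]
      exact iteratedBoxAverage_succ_sub_le hS ha m K t
    · have := (summable_nat_add_iff K).2 hsum
      exact Summable.mul_left _ (by simpa [add_comm] using this)
  choose F hF using fun K t => cauchySeq_tendsto_of_complete (hcau K t)
  have hlip : ∀ K, LipschitzWith L (F K) := by
    intro K
    refine LipschitzWith.of_dist_le_mul fun s t => ?_
    refine le_of_tendsto ((hF K s).dist (hF K t)) (Filter.Eventually.of_forall fun m => ?_)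
    exact (iteratedBoxAverage_lipschitz hS m K).dist_le_mul s t
  refine ⟨F, fun K => (hlip K).continuous, fun K t => ?_, fun K => ?_, fun K t ht => ?_,
    fun K t ht => ?_⟩
  · exact isClosed_Icc.mem_of_tendsto (hF K t)
      (Filter.Eventually.of_forall fun m => iteratedBoxAverage_mem_Icc hS hS01 m K t)
  · funext t
    have h1 : Filter.Tendsto (fun m => iteratedBoxAverage a S (m + 1) K t) Filter.atTop
        (nhds (F K t)) := (hF K t).comp (Filter.tendsto_add_atTop_nat 1)
    refine tendsto_nhds_unique h1 ?_
    refine intervalIntegral.tendsto_integral_filter_of_dominated_convergence (fun _ => (1 : ℝ))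
      (Filter.Eventually.of_forall fun m => ?_) (Filter.Eventually.of_forall fun m => ?_)
      intervalIntegrable_const ?_
    · exact ((iteratedBoxAverage_lipschitz hS m (K + 1)).continuous.comp
        (by fun_prop : Continuous fun u : ℝ => t - a K * u)).aestronglyMeasurable
    · refine Filter.Eventually.of_forall fun u _ => ?_
      have := iteratedBoxAverage_mem_Icc (a := a) hS hS01 m (K + 1) (t - a K * u)
      rw [Real.norm_eq_abs, abs_of_nonneg this.1]
      exact this.2
    · exact Filter.Eventually.of_forall fun u _ => hF (K + 1) (t - a K * u)
  · exact tendsto_nhds_unique (hF K t) (tendsto_const_nhds.congr fun m =>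
      (iteratedBoxAverage_eq_one ha hS1 m K ht).symm)
  · exact tendsto_nhds_unique (hF K t) (tendsto_const_nhds.congr fun m =>
      (iteratedBoxAverage_eq_zero ha hσ0 hσ hS0 m K ht).symm)

end SmoothStep

/-- The derivatives of the smooth step: `stepDerivative a F j K` is the `j`-th derivative of
`F K` when `F K = boxAverage (a K) (F (K + 1))` for all `K`. -/
def stepDerivative (a : ℕ → ℝ) (F : ℕ → ℝ → ℝ) : ℕ → ℕ → ℝ → ℝ
  | 0, K => F K
  | j + 1, K => fun t =>
      (stepDerivative a F j (K + 1) t - stepDerivative a F j (K + 1) (t - a K)) / a K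

/-- A smooth cut-off equal to `1` before `0` and to `0` after `θ + σ 0`, whose `j`-th derivative
is at most `∏ i < j, 2 / a i`. The functions `H j` are its successive derivatives. -/
lemma exists_cutoff_jet {a : ℕ → ℝ} (ha : ∀ k, 0 < a k) {θ : ℝ} (hθ : 0 < θ) {σ : ℕ → ℝ}
    (hσ0 : ∀ k, 0 ≤ σ k) (hσ : ∀ k, a k + σ (k + 1) ≤ σ k) :
    ∃ H : ℕ → ℝ → ℝ, (∀ j t, HasDerivAt (H j) (H (j + 1) t) t) ∧
      (∀ j t, |H j t| ≤ ∏ i ∈ Finset.range j, 2 / a i) ∧ (∀ t ≤ 0, H 0 t = 1) ∧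
      (∀ j, ∀ t ≤ 0, H (j + 1) t = 0) ∧ (∀ j t, θ + σ 0 ≤ t → H j t = 0) := by
  obtain ⟨F, hFc, hF01, hFrec, hF1, hF0⟩ := exists_smooth_step ha hθ hσ0 hσ
  have hder : ∀ j K t, HasDerivAt (stepDerivative a F j K) (stepDerivative a F (j + 1) K t) t := by
    intro j
    induction j with
    | zero =>
      intro K t
      have := boxAverage_hasDerivAt (hFc (K + 1)) (ha K).ne' t
      rwa [← hFrec K] at this
    | succ j ih =>
      intro K t
      have h1 := ih (K + 1) t
      have h2 : HasDerivAt (fun t => stepDerivative a F j (K + 1) (t - a K))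
          (stepDerivative a F (j + 1) (K + 1) (t - a K)) t :=
        (ih (K + 1) (t - a K)).comp_sub_const t (a K)
      exact (h1.sub h2).div_const (a K)
  have hbd : ∀ j K t, |stepDerivative a F j K t| ≤ ∏ i ∈ Finset.range j, 2 / a (K + i) := by
    intro j
    induction j with
    | zero =>
      intro K t
      have := hF01 K t
      simpa [stepDerivative, abs_of_nonneg this.1] using this.2
    | succ j ih =>
      intro K t
      have h1 := ih (K + 1) t
      have h2 := ih (K + 1) (t - a K)
      have h3 : ∏ i ∈ Finset.range (j + 1), 2 / a (K + i)
          = (∏ i ∈ Finset.range j, 2 / a (K + 1 + i)) * (2 / a K) := by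
        rw [Finset.prod_range_succ']
        simp [add_comm, add_left_comm]
      rw [h3, stepDerivative, abs_div, abs_of_pos (ha K), mul_div_assoc', div_le_div_iff_of_pos_right
        (ha K)]
      have := abs_sub (stepDerivative a F j (K + 1) t) (stepDerivative a F j (K + 1) (t - a K))
      linarith
  have hzero : ∀ j K t, θ + σ K ≤ t → stepDerivative a F j K t = 0 := by
    intro j
    induction j with
    | zero => exact hF0
    | succ j ih =>
      intro K t ht
      simp only [stepDerivative]
      rw [ih (K + 1) t (by linarith [hσ K, ha K]),
        ih (K + 1) (t - a K) (by linarith [hσ K]), sub_zero, zero_div]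
  have hone : ∀ j K t, t ≤ 0 → stepDerivative a F (j + 1) K t = 0 := by
    intro j
    induction j with
    | zero =>
      intro K t ht
      simp [stepDerivative, hF1 _ _ ht, hF1 (K + 1) (t - a K) (by linarith [ha K])]
    | succ j ih =>
      intro K t ht
      change (stepDerivative a F (j + 1) (K + 1) t
        - stepDerivative a F (j + 1) (K + 1) (t - a K)) / a K = 0
      rw [ih (K + 1) t ht, ih (K + 1) (t - a K) (by linarith [ha K]), sub_zero, zero_div]
  exact ⟨fun j => stepDerivative a F j 0, fun j t => hder j 0 t,
    fun j t => by simpa using hbd j 0 t, hF1 0, fun j t ht => hone j 0 t ht,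
    fun j t ht => hzero j 0 t ht⟩

/-- Discrete form of `∫ x in K..K+1, x ^ (-γ)`, which makes the tails of `∑ k ^ (-γ)` telescope. -/
lemma rpow_neg_le_telescope {γ : ℝ} (hγ : 1 < γ) {x : ℝ} (hx : 0 < x) :
    1 / (x + 1) ^ γ ≤ (x ^ (1 - γ) - (x + 1) ^ (1 - γ)) / (γ - 1) := by
  have hx1 : 0 < x + 1 := by linarith
  have hs : 0 < γ - 1 := by linarith
  have h1 : 1 + (γ - 1) / (x + 1) ≤ (x / (x + 1)) ^ (1 - γ) := by
    have hlog : Real.log (x / (x + 1)) ≤ - (1 / (x + 1)) := by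
      have := Real.log_le_sub_one_of_pos (div_pos hx hx1)
      have h2 : x / (x + 1) - 1 = - (1 / (x + 1)) := by field_simp; ring
      linarith
    rw [Real.rpow_def_of_pos (div_pos hx hx1)]
    have h3 := Real.add_one_le_exp (Real.log (x / (x + 1)) * (1 - γ))
    have h4 : (γ - 1) / (x + 1) ≤ Real.log (x / (x + 1)) * (1 - γ) := by
      have := mul_le_mul_of_nonneg_left hlog hs.le
      rw [div_eq_mul_one_div]
      linarith
    linarith
  rw [Real.div_rpow hx.le hx1.le] at h1
  have hp : 0 < (x + 1) ^ (1 - γ) := Real.rpow_pos_of_pos hx1 _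
  rw [le_div_iff₀ hp] at h1
  rw [le_div_iff₀ hs]
  have h5 : (x + 1) ^ (1 - γ) = (x + 1) * (1 / (x + 1) ^ γ) := by
    rw [Real.rpow_sub hx1, Real.rpow_one]; ring
  have h6 : (1 + (γ - 1) / (x + 1)) * (x + 1) ^ (1 - γ)
      = (x + 1) ^ (1 - γ) + 1 / (x + 1) ^ γ * (γ - 1) := by
    rw [add_mul, one_mul]
    congr 1
    rw [h5]
    field_simp
  linarith

lemma prod_rpow_add_le (γ : ℝ) (hγ : 0 ≤ γ) (K j : ℕ) :
    ∏ i ∈ Finset.range j, ((K + i + 1 : ℕ) : ℝ) ^ γ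
      ≤ ((j.factorial : ℝ) * 2 ^ (K + j)) ^ γ := by
  rw [Real.finsetProd_rpow _ _ (fun i _ => Nat.cast_nonneg _), ← Nat.cast_prod]
  refine Real.rpow_le_rpow (Nat.cast_nonneg _) ?_ hγ
  have h : ∏ i ∈ Finset.range j, (K + i + 1) = j.factorial * (K + j).choose j := by
    rw [← Nat.ascFactorial_eq_factorial_mul_choose, Nat.ascFactorial_eq_prod_range]
    exact Finset.prod_congr rfl fun i _ => by ring
  rw [h, Nat.cast_mul]
  gcongr
  exact_mod_cast Nat.choose_le_two_pow _ _

/-- `H 0` is a cut-off that drops from `1` to `0` between the times `T / 2` and `T`, and `H j` is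
its `j`-th derivative, with Gevrey bounds. -/
structure CutoffJet (γ M A T : ℝ) (H : ℕ → ℝ → ℝ) : Prop where
  deriv : ∀ j t, HasDerivAt (H j) (H (j + 1) t) t
  bound : ∀ j t, |H j t| ≤ M * A ^ j * (j.factorial : ℝ) ^ γ
  le_one : ∀ t, |H 0 t| ≤ 1
  one : ∀ t ≤ T / 2, H 0 t = 1
  flat : ∀ j, ∀ t ≤ T / 2, H (j + 1) t = 0
  zero : ∀ j t, T ≤ t → H j t = 0

/-- A cut-off of Gevrey order `γ` whose radius of regularity `A` may be prescribed, at the cost of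
a constant `exp (κ / T ^ (1 / (γ - 1)))`: the box widths are `c / k ^ γ`, starting at an index `K`
so large that their sum is at most `T / 4`. -/
lemma exists_gevrey_cutoff {γ : ℝ} (hγ : 1 < γ) {A : ℝ} (hA : 0 < A) :
    ∃ κ : ℝ, 0 < κ ∧ ∀ T : ℝ, 0 < T → T ≤ 1 → ∃ H : ℕ → ℝ → ℝ,
      CutoffJet γ (Real.exp (κ / T ^ (1 / (γ - 1)))) A T H := by
  have hs : 0 < γ - 1 := by linarith
  set c : ℝ := 2 * 2 ^ γ / A with hc
  have hcpos : 0 < c := by positivity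
  refine ⟨γ * Real.log 2 * ((4 * c / (γ - 1)) ^ (1 / (γ - 1)) + 2), by positivity, ?_⟩
  intro T hT hT1
  -- the smallest index from which the tail bound `c / (γ - 1) * X ^ (1 - γ)` is at most `T / 4`
  set X : ℝ := (4 * c / ((γ - 1) * T)) ^ (1 / (γ - 1)) with hX
  have hXpos : 0 < X := by positivity
  set K : ℕ := ⌈X⌉₊ + 1 with hK
  have hKX : X ≤ K := by rw [hK]; push_cast; linarith [Nat.le_ceil X]
  have hKX2 : (K : ℝ) ≤ X + 2 := by
    rw [hK]; push_cast; linarith [(Nat.ceil_lt_add_one hXpos.le).le]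
  have hKpos : (0 : ℝ) < K := by rw [hK]; positivity
  set a : ℕ → ℝ := fun i => c / ((K + i + 1 : ℕ) : ℝ) ^ γ with ha
  set σ : ℕ → ℝ := fun i => c / (γ - 1) * ((K + i : ℕ) : ℝ) ^ (1 - γ) with hσ
  have hapos : ∀ i, 0 < a i := fun i => by
    have : (0 : ℝ) < ((K + i + 1 : ℕ) : ℝ) := by positivity
    simp only [ha]; positivity
  have hσ0 : ∀ i, 0 ≤ σ i := fun i => by simp only [hσ]; positivity
  have hrec : ∀ i, a i + σ (i + 1) ≤ σ i := fun i => by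
    have hx : (0 : ℝ) < ((K + i : ℕ) : ℝ) := by push_cast; positivity
    have h := mul_le_mul_of_nonneg_left (rpow_neg_le_telescope hγ hx) hcpos.le
    simp only [ha, hσ]
    rw [show K + (i + 1) = K + i + 1 by ring, Nat.cast_add (K + i) 1, Nat.cast_one]
    have e : c * ((((K + i : ℕ) : ℝ) ^ (1 - γ) - (((K + i : ℕ) : ℝ) + 1) ^ (1 - γ)) / (γ - 1))
      = c / (γ - 1) * ((K + i : ℕ) : ℝ) ^ (1 - γ)
        - c / (γ - 1) * (((K + i : ℕ) : ℝ) + 1) ^ (1 - γ) := by ring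
    rw [e, mul_one_div] at h
    linarith
  have hσT : σ 0 ≤ T / 4 := by
    have h1 : 4 * c / ((γ - 1) * T) ≤ (K : ℝ) ^ (γ - 1) := by
      have := Real.rpow_le_rpow hXpos.le hKX hs.le
      rwa [hX, ← Real.rpow_mul (by positivity), one_div_mul_cancel hs.ne', Real.rpow_one] at this
    have h2 : (K : ℝ) ^ (1 - γ) = 1 / (K : ℝ) ^ (γ - 1) := by
      rw [← neg_sub, Real.rpow_neg hKpos.le, one_div]
    have hp : 0 < (K : ℝ) ^ (γ - 1) := by positivity
    simp only [hσ, add_zero]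
    rw [h2, mul_one_div, div_le_iff₀ hp, div_le_iff₀ hs]
    rw [div_le_iff₀ (by positivity)] at h1
    nlinarith
  obtain ⟨H, h1, h2, h3, h4, h5⟩ := exists_cutoff_jet hapos (θ := T / 4) (by linarith) hσ0 hrec
  refine ⟨fun j t => H j (t - T / 2), fun j t => (h1 j (t - T / 2)).comp_sub_const t (T / 2),
    fun j t => ?_, fun t => by simpa using h2 0 (t - T / 2), fun t ht => h3 _ (by linarith), fun j t ht => h4 _ _ (by linarith),
    fun j t ht => h5 _ _ (by linarith)⟩
  refine (h2 j _).trans ?_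
  have e1 : ∏ i ∈ Finset.range j, 2 / a i
      = (2 / c) ^ j * ∏ i ∈ Finset.range j, ((K + i + 1 : ℕ) : ℝ) ^ γ := by
    rw [← Finset.card_range j, ← Finset.prod_const, Finset.card_range, ← Finset.prod_mul_distrib]
    refine Finset.prod_congr rfl fun i _ => ?_
    simp only [ha]
    rw [div_div_eq_mul_div, mul_comm (2 / c), mul_div_assoc', mul_comm]
  have e2 : (2 / c) ^ j * ((j.factorial : ℝ) * 2 ^ (K + j)) ^ γ
      = (2 : ℝ) ^ (γ * K) * A ^ j * (j.factorial : ℝ) ^ γ := by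
    have e3 : ((2 : ℝ) ^ (K + j)) ^ γ = 2 ^ (γ * K) * (2 ^ γ) ^ j := by
      rw [pow_add, Real.mul_rpow (by positivity) (by positivity), ← Real.rpow_natCast,
        ← Real.rpow_mul (by norm_num), mul_comm (K : ℝ), ← Real.rpow_natCast 2 j,
        ← Real.rpow_natCast _ j, ← Real.rpow_mul (by norm_num), ← Real.rpow_mul (by norm_num),
        mul_comm (j : ℝ)]
    have e4 : 2 / c * 2 ^ γ = A := by rw [hc]; field_simp
    rw [Real.mul_rpow (by positivity) (by positivity), e3, ← e4, mul_pow]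
    ring
  have e5 : (2 : ℝ) ^ (γ * K) ≤ Real.exp (γ * Real.log 2 *
      ((4 * c / (γ - 1)) ^ (1 / (γ - 1)) + 2) / T ^ (1 / (γ - 1))) := by
    rw [Real.rpow_def_of_pos (by norm_num)]
    refine Real.exp_le_exp.2 ?_
    have hX' : X = (4 * c / (γ - 1)) ^ (1 / (γ - 1)) / T ^ (1 / (γ - 1)) := by
      rw [hX, ← div_div, Real.div_rpow (by positivity) hT.le]
    have hTp : T ^ (1 / (γ - 1)) ≤ 1 := Real.rpow_le_one hT.le hT1 (by positivity)
    have h6 : 2 ≤ 2 / T ^ (1 / (γ - 1)) := by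
      rw [le_div_iff₀ (by positivity)]; linarith
    have h7 : (K : ℝ) ≤ ((4 * c / (γ - 1)) ^ (1 / (γ - 1)) + 2) / T ^ (1 / (γ - 1)) := by
      rw [add_div, ← hX']; linarith
    have h8 : 0 ≤ γ * Real.log 2 := by positivity
    calc Real.log 2 * (γ * K) = γ * Real.log 2 * K := by ring
      _ ≤ _ := by rw [mul_div_assoc]; exact mul_le_mul_of_nonneg_left h7 h8
  rw [e1]
  calc _ ≤ (2 / c) ^ j * ((j.factorial : ℝ) * 2 ^ (K + j)) ^ γ := by
        gcongr
        exact prod_rpow_add_le γ (by linarith) K j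
    _ = _ := e2
    _ ≤ _ := by gcongr


/-! ### Infinite products as operators of infinite order -/

open Polynomial Filter in
/-- The `j`-th Taylor coefficient of the infinite product `∏ k, (1 + p k * w)`, as the limit of
the coefficients of the finite products. -/
def infProdCoeff (p : ℕ → ℂ) (j : ℕ) : ℂ :=
  limUnder atTop fun N => (∏ k ∈ Finset.range N, (1 + C (p k) * X) : ℂ[X]).coeff j

section InfProd

open Polynomial Filter

lemma coeff_one_add_mul {R : Type*} [CommRing R] (P : R[X]) (a : R) (j : ℕ) :
    ((1 + C a * X) * P).coeff (j + 1) = P.coeff (j + 1) + a * P.coeff j := by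
  rw [add_mul, one_mul, coeff_add, mul_assoc, coeff_C_mul, coeff_X_mul]

lemma coeff_zero_one_add_mul {R : Type*} [CommRing R] (P : R[X]) (a : R) :
    ((1 + C a * X) * P).coeff 0 = P.coeff 0 := by
  simp [mul_coeff_zero]

lemma coeff_majorant_nonneg (p : ℕ → ℂ) (N j : ℕ) :
    0 ≤ (∏ k ∈ Finset.range N, (1 + C ‖p k‖ * X) : ℝ[X]).coeff j := by
  induction N generalizing j with
  | zero => simp only [Finset.range_zero, Finset.prod_empty, coeff_one]; split_ifs <;> norm_num
  | succ N ih =>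
    rw [Finset.prod_range_succ, mul_comm]
    cases j with
    | zero => rw [coeff_zero_one_add_mul]; exact ih 0
    | succ j => rw [coeff_one_add_mul]; exact add_nonneg (ih _) (mul_nonneg (norm_nonneg _) (ih _))

lemma norm_coeff_le_majorant (p : ℕ → ℂ) (N j : ℕ) :
    ‖(∏ k ∈ Finset.range N, (1 + C (p k) * X) : ℂ[X]).coeff j‖
      ≤ (∏ k ∈ Finset.range N, (1 + C ‖p k‖ * X) : ℝ[X]).coeff j := by
  induction N generalizing j with
  | zero => simp only [Finset.range_zero, Finset.prod_empty, coeff_one]; split_ifs <;> norm_num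
  | succ N ih =>
    rw [Finset.prod_range_succ, Finset.prod_range_succ, mul_comm, mul_comm (Finset.prod _ _)]
    cases j with
    | zero => rw [coeff_zero_one_add_mul, coeff_zero_one_add_mul]; exact ih 0
    | succ j =>
      rw [coeff_one_add_mul, coeff_one_add_mul]
      refine (norm_add_le _ _).trans (add_le_add (ih _) ?_)
      rw [norm_mul]
      exact mul_le_mul_of_nonneg_left (ih _) (norm_nonneg _)

lemma coeff_majorant_mul_pow_le (p : ℕ → ℂ) (N j : ℕ) {x : ℝ} (hx : 0 ≤ x) :
    (∏ k ∈ Finset.range N, (1 + C ‖p k‖ * X) : ℝ[X]).coeff j * x ^ j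
      ≤ ∏ k ∈ Finset.range N, (1 + x * ‖p k‖) := by
  set M : ℝ[X] := ∏ k ∈ Finset.range N, (1 + C ‖p k‖ * X) with hM
  have h1 : ∏ k ∈ Finset.range N, (1 + x * ‖p k‖) = M.eval x := by
    rw [hM, eval_prod]
    exact Finset.prod_congr rfl fun k _ => by
      rw [eval_add, eval_one, eval_mul, eval_C, eval_X, mul_comm]
  rw [h1, eval_eq_sum_range]
  have hnn : ∀ i ∈ Finset.range (M.natDegree + 1), 0 ≤ M.coeff i * x ^ i := fun i _ =>
    mul_nonneg (coeff_majorant_nonneg p N i) (pow_nonneg hx i)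
  by_cases hj : j ∈ Finset.range (M.natDegree + 1)
  · exact Finset.single_le_sum hnn hj
  · rw [Finset.mem_range, not_lt] at hj
    rw [coeff_eq_zero_of_natDegree_lt (by omega), zero_mul]
    exact Finset.sum_nonneg hnn

variable {γ B : ℝ} {p : ℕ → ℂ}

/-- The growth condition `∏ (1 + x |p k|) ≤ exp (C x ^ (1 / γ))` at `x = j ^ γ`, with
`B = exp C`. -/
def ProductBound (γ B : ℝ) (p : ℕ → ℂ) : Prop :=
  ∀ j : ℕ, 1 ≤ j → ∀ N : ℕ, ∏ k ∈ Finset.range N, (1 + (j : ℝ) ^ γ * ‖p k‖) ≤ B ^ j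

lemma coeff_majorant_le (hγ : 0 ≤ γ) (hp : ProductBound γ B p) (N j : ℕ) :
    (∏ k ∈ Finset.range N, (1 + C ‖p k‖ * X) : ℝ[X]).coeff j
      ≤ B ^ j / (j.factorial : ℝ) ^ γ := by
  rcases Nat.eq_zero_or_pos j with rfl | hj
  · have : (∏ k ∈ Finset.range N, (1 + C ‖p k‖ * X) : ℝ[X]).coeff 0 = 1 := by
      simp [coeff_zero_eq_eval_zero, eval_prod]
    simp [this]
  · rw [le_div_iff₀ (by positivity)]
    have h1 := (coeff_majorant_mul_pow_le p N j (x := (j : ℝ) ^ γ) (by positivity)).trans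
      (hp j hj N)
    refine le_trans (mul_le_mul_of_nonneg_left ?_ (coeff_majorant_nonneg p N j)) h1
    rw [← Real.rpow_natCast, ← Real.rpow_mul (by positivity), mul_comm γ,
      Real.rpow_mul (by positivity), Real.rpow_natCast]
    refine Real.rpow_le_rpow (by positivity) ?_ hγ
    exact_mod_cast Nat.factorial_le_pow j

lemma tendsto_infProdCoeff (hγ : 0 ≤ γ) (hp : ProductBound γ B p) (j : ℕ) :
    Tendsto (fun N => (∏ k ∈ Finset.range N, (1 + C (p k) * X) : ℂ[X]).coeff j) atTop
      (nhds (infProdCoeff p j)) := by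
  refine CauchySeq.tendsto_limUnder ?_
  set m : ℕ → ℝ := fun N => (∏ k ∈ Finset.range N, (1 + C ‖p k‖ * X) : ℝ[X]).coeff j with hm
  have hnn : ∀ N, 0 ≤ m (N + 1) - m N := fun N => by
    simp only [hm]
    rw [Finset.prod_range_succ, mul_comm]
    cases j with
    | zero => rw [coeff_zero_one_add_mul, sub_self]
    | succ j =>
      rw [coeff_one_add_mul, add_sub_cancel_left]
      exact mul_nonneg (norm_nonneg _) (coeff_majorant_nonneg p N j)
  refine cauchySeq_of_dist_le_of_summable (fun N => m (N + 1) - m N) (fun N => ?_) ?_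
  · simp only [hm]
    rw [dist_comm, dist_eq_norm, Finset.prod_range_succ, Finset.prod_range_succ, mul_comm,
      mul_comm (Finset.prod _ _) (1 + C ‖p N‖ * X)]
    cases j with
    | zero => simp
    | succ j =>
      rw [coeff_one_add_mul, coeff_one_add_mul, add_sub_cancel_left, add_sub_cancel_left, norm_mul]
      exact mul_le_mul_of_nonneg_left (norm_coeff_le_majorant p N j) (norm_nonneg _)
  · refine summable_of_sum_range_le (c := B ^ j / (j.factorial : ℝ) ^ γ) hnn fun N => ?_
    rw [Finset.sum_range_sub]
    have h0 : 0 ≤ m 0 := coeff_majorant_nonneg p 0 j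
    have h1 : m N ≤ _ := coeff_majorant_le hγ hp N j
    linarith

lemma norm_infProdCoeff_le (hγ : 0 ≤ γ) (hp : ProductBound γ B p) (j : ℕ) :
    ‖infProdCoeff p j‖ ≤ B ^ j / (j.factorial : ℝ) ^ γ :=
  le_of_tendsto (tendsto_infProdCoeff hγ hp j).norm (Eventually.of_forall fun N =>
    (norm_coeff_le_majorant p N j).trans (coeff_majorant_le hγ hp N j))

lemma infProdCoeff_zero (hγ : 0 ≤ γ) (hp : ProductBound γ B p) : infProdCoeff p 0 = 1 := by
  refine tendsto_nhds_unique (tendsto_infProdCoeff hγ hp 0) (tendsto_const_nhds.congr fun N => ?_)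
  simp [coeff_zero_eq_eval_zero, eval_prod]

lemma ProductBound.update (hp : ProductBound γ B p) (m : ℕ) :
    ProductBound γ B (Function.update p m 0) := by
  intro j hj N
  refine le_trans (Finset.prod_le_prod (fun k _ => by positivity) fun k _ => ?_) (hp j hj N)
  by_cases h : k = m
  · subst h; simp; positivity
  · rw [Function.update_of_ne h]

/-- Splitting off one factor of the infinite product. -/
lemma infProdCoeff_succ_eq (hγ : 0 ≤ γ) (hp : ProductBound γ B p) (m j : ℕ) :
    infProdCoeff p (j + 1) = infProdCoeff (Function.update p m 0) (j + 1)
      + p m * infProdCoeff (Function.update p m 0) j := by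
  have h := (tendsto_infProdCoeff hγ (hp.update m) (j + 1)).add
    ((tendsto_infProdCoeff hγ (hp.update m) j).const_mul (p m))
  refine tendsto_nhds_unique (tendsto_infProdCoeff hγ hp (j + 1)) (h.congr' ?_)
  filter_upwards [eventually_gt_atTop m] with N hN
  have hm : m ∈ Finset.range N := Finset.mem_range.2 hN
  rw [← Finset.mul_prod_erase _ _ hm, ← Finset.mul_prod_erase _ (fun k => 1 + C (p k) * X) hm,
    Function.update_self, map_zero, zero_mul, add_zero, one_mul, coeff_one_add_mul]
  have : ∏ x ∈ (Finset.range N).erase m, (1 + C (Function.update p m 0 x) * X)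
      = ∏ x ∈ (Finset.range N).erase m, (1 + C (p x) * X) :=
    Finset.prod_congr rfl fun k hk => by rw [Function.update_of_ne (Finset.ne_of_mem_erase hk)]
  rw [this]

end InfProd

/-! ### Products over well separated points -/

lemma prod_Icc_eq_factorial (j : ℕ) : ∏ m ∈ Finset.Icc 1 j, m = j.factorial := by
  induction j with
  | zero => simp
  | succ j ih => rw [Finset.prod_Icc_succ_top (by omega), ih, Nat.factorial_succ, mul_comm]

lemma sum_log_div_le (j : ℕ) : ∑ m ∈ Finset.Icc 1 j, Real.log (j / m) ≤ j := by
  rcases Nat.eq_zero_or_pos j with rfl | hj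
  · simp
  have hj' : (0 : ℝ) < j := by exact_mod_cast hj
  have h1 : ∑ m ∈ Finset.Icc 1 j, Real.log (j / m) = Real.log ((j : ℝ) ^ j / j.factorial) := by
    rw [← Real.log_prod]
    · rw [Finset.prod_div_distrib, Finset.prod_const, Nat.card_Icc, Nat.add_sub_cancel,
        ← Nat.cast_prod, prod_Icc_eq_factorial]
    · intro m hm
      have : (0 : ℝ) < m := by exact_mod_cast (Finset.mem_Icc.1 hm).1
      positivity
  rw [h1, Real.log_le_iff_le_exp (by positivity)]
  exact Real.pow_div_factorial_le_exp _ hj'.le j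

lemma sum_inv_rpow_tail_le {γ : ℝ} (hγ : 1 < γ) {j : ℕ} (hj : 1 ≤ j) (N : ℕ) :
    ∑ m ∈ Finset.Ioc j N, 1 / (m : ℝ) ^ γ ≤ (j : ℝ) ^ (1 - γ) / (γ - 1) := by
  have hs : 0 < γ - 1 := by linarith
  have key : ∀ N, j ≤ N → ∑ m ∈ Finset.Ioc j N, 1 / (m : ℝ) ^ γ
      ≤ ((j : ℝ) ^ (1 - γ) - (N : ℝ) ^ (1 - γ)) / (γ - 1) := by
    intro N hN
    induction N, hN using Nat.le_induction with
    | base => simp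
    | succ N hN ih =>
      rw [← Finset.insert_Ioc_right_eq_Ioc_add_one hN, Finset.sum_insert (by simp)]
      have hN' : (0 : ℝ) < N := by exact_mod_cast (by omega : 0 < N)
      have := rpow_neg_le_telescope hγ hN'
      push_cast
      rw [sub_div] at this ih ⊢
      linarith
  rcases le_total j N with h | h
  · refine (key N h).trans ?_
    gcongr
    have : 0 ≤ (N : ℝ) ^ (1 - γ) := by positivity
    linarith
  · rw [Finset.Ioc_eq_empty (by omega), Finset.sum_empty]
    positivity

lemma sum_log_one_add_rpow_le {γ a : ℝ} (hγ : 1 < γ) (ha : 0 < a) {j : ℕ} (hj : 1 ≤ j) (N : ℕ) :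
    ∑ m ∈ Finset.Icc 1 N, Real.log (1 + a * (j : ℝ) ^ γ / (m : ℝ) ^ γ)
      ≤ (Real.log (1 + a) + γ + a / (γ - 1)) * j := by
  have hs : 0 < γ - 1 := by linarith
  have hj' : (1 : ℝ) ≤ j := by exact_mod_cast hj
  have hj0 : (0 : ℝ) < j := by linarith
  set f : ℕ → ℝ := fun m => Real.log (1 + a * (j : ℝ) ^ γ / (m : ℝ) ^ γ) with hf
  have hf0 : ∀ m, 0 ≤ f m := fun m => Real.log_nonneg (by
    have : 0 ≤ a * (j : ℝ) ^ γ / (m : ℝ) ^ γ := by positivity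
    linarith)
  have hsub : Finset.Icc 1 N ⊆ Finset.Icc 1 j ∪ Finset.Ioc j N := by
    intro m hm
    simp only [Finset.mem_union, Finset.mem_Icc, Finset.mem_Ioc] at *
    omega
  have hdisj : Disjoint (Finset.Icc 1 j) (Finset.Ioc j N) := by
    rw [Finset.disjoint_left]
    intro m h1 h2
    simp only [Finset.mem_Icc, Finset.mem_Ioc] at *
    omega
  have h1 : ∑ m ∈ Finset.Icc 1 j, f m ≤ (Real.log (1 + a) + γ) * j := by
    have : ∀ m ∈ Finset.Icc 1 j, f m ≤ Real.log (1 + a) + γ * Real.log (j / m) := by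
      intro m hm
      have hm1 : (0 : ℝ) < m := by exact_mod_cast (Finset.mem_Icc.1 hm).1
      have hmj : (m : ℝ) ≤ j := by exact_mod_cast (Finset.mem_Icc.1 hm).2
      have h1 : 1 ≤ (j / m : ℝ) ^ γ :=
        Real.one_le_rpow (by rw [le_div_iff₀ hm1]; linarith) (by linarith)
      rw [← Real.log_rpow (by positivity), ← Real.log_mul (by positivity) (by positivity)]
      refine Real.log_le_log (by positivity) ?_
      rw [mul_div_assoc, ← Real.div_rpow hj0.le hm1.le]
      linarith
    refine (Finset.sum_le_sum this).trans ?_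
    rw [Finset.sum_add_distrib, ← Finset.mul_sum, Finset.sum_const, Nat.card_Icc,
      Nat.add_sub_cancel, nsmul_eq_mul]
    have := mul_le_mul_of_nonneg_left (sum_log_div_le j) (by linarith : 0 ≤ γ)
    linarith
  have h2 : ∑ m ∈ Finset.Ioc j N, f m ≤ a / (γ - 1) * j := by
    have : ∀ m ∈ Finset.Ioc j N, f m ≤ a * (j : ℝ) ^ γ * (1 / (m : ℝ) ^ γ) := by
      intro m hm
      have h3 : 0 ≤ a * (j : ℝ) ^ γ / (m : ℝ) ^ γ := by positivity
      have := Real.log_le_sub_one_of_pos (show 0 < 1 + a * (j : ℝ) ^ γ / (m : ℝ) ^ γ by linarith)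
      rw [mul_one_div]
      simp only [hf]
      linarith
    refine (Finset.sum_le_sum this).trans ?_
    rw [← Finset.mul_sum]
    have h3 := mul_le_mul_of_nonneg_left (sum_inv_rpow_tail_le hγ hj N)
      (show 0 ≤ a * (j : ℝ) ^ γ by positivity)
    have h4 : (j : ℝ) ^ γ * (j : ℝ) ^ (1 - γ) = j := by
      rw [← Real.rpow_add hj0, add_sub_cancel, Real.rpow_one]
    calc _ ≤ _ := h3
      _ = a / (γ - 1) * ((j : ℝ) ^ γ * (j : ℝ) ^ (1 - γ)) := by ring
      _ = _ := by rw [h4]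
  calc ∑ m ∈ Finset.Icc 1 N, f m ≤ ∑ m ∈ Finset.Icc 1 j ∪ Finset.Ioc j N, f m :=
        Finset.sum_le_sum_of_subset_of_nonneg hsub fun m _ _ => hf0 m
    _ = _ := Finset.sum_union hdisj
    _ ≤ _ := by linarith

/-- If the points `κ k`, `k ≥ R`, satisfy `c |k - l| ^ γ ≤ |κ k - κ l|`, then the product over
those at distance at least `δ` from `z` is bounded uniformly in `z`: if `κ k₀` is the point closest
to `z`, then `|κ k - z| ≥ |κ k - κ k₀| / 2 ≥ c |k - k₀| ^ γ / 2`. -/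
lemma exists_productBound {γ c δ : ℝ} (hγ : 1 < γ) (hc : 0 < c) (hδ : 0 < δ) (R : ℕ) :
    ∃ B : ℝ, 0 < B ∧ ∀ κ : ℕ → ℂ,
      (∀ k l : ℕ, R ≤ k → R ≤ l → c * |(k : ℝ) - l| ^ γ ≤ ‖κ k - κ l‖) →
      ∀ (z : ℂ) (p : ℕ → ℂ), (∀ k, p k = 0 ∨ (p k = 1 / (z - κ k) ∧ δ ≤ ‖z - κ k‖)) →
        ProductBound γ B p := by
  set a : ℝ := 2 / c with ha
  have hapos : 0 < a := by positivity
  set E : ℝ := Real.log (1 + a) + γ + a / (γ - 1) with hE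
  set D : ℝ := Real.log (1 + 1 / δ) + γ with hD
  have hs : 0 < γ - 1 := by linarith
  have hDpos : 0 ≤ D := add_nonneg (Real.log_nonneg (by
    have : 0 < 1 / δ := by positivity
    linarith)) (by linarith)
  refine ⟨Real.exp (R * D + D + 2 * E), Real.exp_pos _, fun κ hκ z p hp j hj N => ?_⟩
  have hj' : (1 : ℝ) ≤ j := by exact_mod_cast hj
  have hj0 : (0 : ℝ) < j := by linarith
  set f : ℕ → ℝ := fun k => Real.log (1 + (j : ℝ) ^ γ * ‖p k‖) with hf
  have hf0 : ∀ k, 0 ≤ f k := fun k => Real.log_nonneg (by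
    have : 0 ≤ (j : ℝ) ^ γ * ‖p k‖ := by positivity
    linarith)
  -- each single factor is at most `exp (D * j)`
  have hsingle : ∀ k, f k ≤ D * j := by
    intro k
    have h1 : ‖p k‖ ≤ 1 / δ := by
      rcases hp k with h | ⟨h, h2⟩
      · rw [h, norm_zero]; positivity
      · rw [h, norm_div, norm_one]; exact one_div_le_one_div_of_le hδ h2
    have h2 : 1 ≤ (j : ℝ) ^ γ := Real.one_le_rpow hj' (by linarith)
    have h3 : f k ≤ Real.log ((1 + 1 / δ) * (j : ℝ) ^ γ) := by
      refine Real.log_le_log (by positivity) ?_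
      have := mul_le_mul_of_nonneg_left h1 (by linarith : 0 ≤ (j : ℝ) ^ γ)
      linarith
    rw [Real.log_mul (by positivity) (by positivity), Real.log_rpow hj0] at h3
    have h4 : Real.log j ≤ j := (Real.log_le_sub_one_of_pos hj0).trans (by linarith)
    have h5 : 0 ≤ Real.log (1 + 1 / δ) := Real.log_nonneg (by
      have : 0 < 1 / δ := by positivity
      linarith)
    have h6 : Real.log (1 + 1 / δ) ≤ Real.log (1 + 1 / δ) * j := le_mul_of_one_le_right h5 hj'
    have h7 := mul_le_mul_of_nonneg_left h4 (by linarith : 0 ≤ γ)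
    rw [hD]; linarith
  set s : Finset ℕ := (Finset.range N).filter fun k => R ≤ k ∧ p k ≠ 0 with hsdef
  have hsplit : ∑ k ∈ Finset.range N, f k ≤ ∑ k ∈ Finset.range R, f k + ∑ k ∈ s, f k := by
    have hz : ∑ k ∈ Finset.range N, f k = ∑ k ∈ (Finset.range N).filter (fun k => p k ≠ 0), f k := by
      symm
      refine Finset.sum_filter_of_ne fun k _ h => ?_
      contrapose! h
      simp [hf, h]
    have hdisj : Disjoint (Finset.range R) s := by
      rw [Finset.disjoint_left]
      intro m h1 h2
      simp only [hsdef, Finset.mem_range, Finset.mem_filter] at *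
      omega
    rw [hz, ← Finset.sum_union hdisj]
    refine Finset.sum_le_sum_of_subset_of_nonneg (fun k hk => ?_) fun k _ _ => hf0 k
    simp only [hsdef, Finset.mem_union, Finset.mem_range, Finset.mem_filter] at *
    rcases lt_or_ge k R with h | h
    · exact Or.inl h
    · exact Or.inr ⟨hk.1, h, hk.2⟩
  have hlow : ∑ k ∈ Finset.range R, f k ≤ R * D * j := by
    refine (Finset.sum_le_sum fun k _ => hsingle k).trans ?_
    rw [Finset.sum_const, Finset.card_range, nsmul_eq_mul]
    linarith
  have hhigh : ∑ k ∈ s, f k ≤ (D + 2 * E) * j := by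
    have hE0 : 0 ≤ E * j := by
      refine le_trans ?_ (sum_log_one_add_rpow_le hγ hapos hj 0)
      simp
    rcases s.eq_empty_or_nonempty with hemp | hne
    · rw [hemp, Finset.sum_empty]
      have : 0 ≤ D * j := by positivity
      linarith
    obtain ⟨k₀, hk₀, hmin⟩ := s.exists_min_image (fun k => ‖z - κ k‖) hne
    have hk₀' := (Finset.mem_filter.1 hk₀).2
    have hfar : ∀ k ∈ s, k ≠ k₀ →
        f k ≤ Real.log (1 + a * (j : ℝ) ^ γ / |(k : ℝ) - k₀| ^ γ) := by
      intro k hk hkk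
      have hk' := (Finset.mem_filter.1 hk).2
      have h1 : c * |(k : ℝ) - k₀| ^ γ ≤ 2 * ‖z - κ k‖ := by
        refine (hκ k k₀ hk'.1 hk₀'.1).trans ?_
        have h2 : κ k - κ k₀ = (z - κ k₀) - (z - κ k) := by ring
        rw [h2]
        have := norm_sub_le (z - κ k₀) (z - κ k)
        linarith [hmin k hk]
      have hpos : 0 < |(k : ℝ) - k₀| := abs_pos.2 (sub_ne_zero.2 (by exact_mod_cast hkk))
      have hpos' : 0 < |(k : ℝ) - k₀| ^ γ := by positivity
      have hz : 0 < ‖z - κ k‖ := by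
        have : 0 < c * |(k : ℝ) - k₀| ^ γ := by positivity
        linarith
      rcases hp k with h | ⟨h, -⟩
      · exact absurd h hk'.2
      refine Real.log_le_log (by positivity) ?_
      rw [h, norm_div, norm_one, mul_one_div, ha]
      have h3 : 1 / ‖z - κ k‖ ≤ 2 / c / |(k : ℝ) - k₀| ^ γ := by
        rw [div_div, div_le_div_iff₀ hz (by positivity)]
        linarith
      have h4 := mul_le_mul_of_nonneg_left h3 (show 0 ≤ (j : ℝ) ^ γ by positivity)
      have e1 : (j : ℝ) ^ γ * (1 / ‖z - κ k‖) = (j : ℝ) ^ γ / ‖z - κ k‖ := by ring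
      have e2 : (j : ℝ) ^ γ * (2 / c / |(k : ℝ) - k₀| ^ γ)
        = 2 / c * (j : ℝ) ^ γ / |(k : ℝ) - k₀| ^ γ := by ring
      linarith
    set g : ℕ → ℝ := fun m => Real.log (1 + a * (j : ℝ) ^ γ / (m : ℝ) ^ γ) with hg
    have hg0 : ∀ m, 0 ≤ g m := fun m => Real.log_nonneg (by
      have : 0 ≤ a * (j : ℝ) ^ γ / (m : ℝ) ^ γ := by positivity
      linarith)
    have hle : ∀ t : Finset ℕ, ∀ d : ℕ → ℕ, Set.InjOn d t → (∀ k ∈ t, d k ∈ Finset.Icc 1 N) →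
        (∀ k ∈ t, f k ≤ g (d k)) → ∑ k ∈ t, f k ≤ E * j := by
      intro t d hd hdN hfg
      refine (Finset.sum_le_sum hfg).trans ?_
      rw [← Finset.sum_image (f := g) hd]
      refine le_trans (Finset.sum_le_sum_of_subset_of_nonneg ?_ fun m _ _ => hg0 m)
        (sum_log_one_add_rpow_le hγ hapos hj N)
      intro m hm
      obtain ⟨k, hk, rfl⟩ := Finset.mem_image.1 hm
      exact hdN k hk
    have hkN : ∀ k ∈ s, k < N := fun k hk => Finset.mem_range.1 (Finset.mem_filter.1 hk).1
    have hleft : ∑ k ∈ s.filter (· < k₀), f k ≤ E * j := by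
      refine hle _ (fun k => k₀ - k) ?_ ?_ ?_
      · intro k hk l hl h
        simp only [Finset.coe_filter, Set.mem_ofPred_eq] at hk hl h
        omega
      · intro k hk
        have := hkN _ hk₀
        simp only [Finset.mem_filter] at hk
        simp only [Finset.mem_Icc]
        omega
      · intro k hk
        simp only [Finset.mem_filter] at hk
        have := hfar k hk.1 hk.2.ne
        rwa [abs_sub_comm, ← Nat.cast_sub hk.2.le, Nat.abs_cast] at this
    have hright : ∑ k ∈ s.filter (k₀ < ·), f k ≤ E * j := by
      refine hle _ (fun k => k - k₀) ?_ ?_ ?_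
      · intro k hk l hl h
        simp only [Finset.coe_filter, Set.mem_ofPred_eq] at hk hl h
        omega
      · intro k hk
        simp only [Finset.mem_filter] at hk
        have := hkN _ hk.1
        simp only [Finset.mem_Icc]
        omega
      · intro k hk
        simp only [Finset.mem_filter] at hk
        have := hfar k hk.1 hk.2.ne'
        rwa [← Nat.cast_sub hk.2.le, Nat.abs_cast] at this
    have hcover : s ⊆ {k₀} ∪ (s.filter (· < k₀) ∪ s.filter (k₀ < ·)) := by
      intro k hk
      simp only [Finset.mem_union, Finset.mem_singleton, Finset.mem_filter]
      rcases lt_trichotomy k k₀ with h | h | h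
      · exact Or.inr (Or.inl ⟨hk, h⟩)
      · exact Or.inl h
      · exact Or.inr (Or.inr ⟨hk, h⟩)
    have hun : ∀ t u : Finset ℕ, ∑ k ∈ t ∪ u, f k ≤ ∑ k ∈ t, f k + ∑ k ∈ u, f k := by
      intro t u
      rw [← Finset.sum_union_inter]
      exact le_add_of_nonneg_right (Finset.sum_nonneg fun k _ => hf0 k)
    have h1 := Finset.sum_le_sum_of_subset_of_nonneg hcover fun k _ _ => hf0 k
    have h2 := hun {k₀} (s.filter (· < k₀) ∪ s.filter (k₀ < ·))
    have h3 := hun (s.filter (· < k₀)) (s.filter (k₀ < ·))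
    rw [Finset.sum_singleton] at h2
    linarith [hsingle k₀]
  have htot : ∑ k ∈ Finset.range N, f k ≤ (R * D + D + 2 * E) * j := by linarith
  have hprod : ∏ k ∈ Finset.range N, (1 + (j : ℝ) ^ γ * ‖p k‖)
      = Real.exp (∑ k ∈ Finset.range N, f k) := by
    rw [Real.exp_sum]
    refine Finset.prod_congr rfl fun k _ => ?_
    rw [Real.exp_log (by positivity)]
  rw [hprod, ← Real.exp_nat_mul, mul_comm (j : ℝ)]
  exact Real.exp_le_exp.2 htot


/-! ### The characteristic roots of the damped modes -/

/-- The damping coefficient `ρ n^(2α)` of the mode `n`. -/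
def modeDamping (α ρ : ℝ) (n : ℕ) : ℝ := ρ * (n : ℝ) ^ (2 * α)

/-- The discriminant of `z² + ρ n^(2α) z + n⁴`. -/
def modeDisc (α ρ : ℝ) (n : ℕ) : ℝ := modeDamping α ρ n ^ 2 - 4 * (n : ℝ) ^ 4

/-- A complex square root of the discriminant. -/
def modeSqrtDisc (α ρ : ℝ) (n : ℕ) : ℂ :=
  if 0 ≤ modeDisc α ρ n then (Real.sqrt (modeDisc α ρ n) : ℂ)
  else (Real.sqrt (-modeDisc α ρ n) : ℂ) * Complex.I

/-- The characteristic root of mode `n` of smaller modulus when the roots are real. -/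
def slowRoot (α ρ : ℝ) (n : ℕ) : ℂ := (-(modeDamping α ρ n : ℂ) + modeSqrtDisc α ρ n) / 2

/-- The other characteristic root of mode `n`. -/
def fastRoot (α ρ : ℝ) (n : ℕ) : ℂ := (-(modeDamping α ρ n : ℂ) - modeSqrtDisc α ρ n) / 2

/-- The growth exponent of the characteristic roots; the control cost is
`exp (K / T ^ (1 / (γ - 1)))`. -/
def rootExponent (α : ℝ) : ℝ := if α ≤ 1 then 2 else 4 - 2 * α

section Roots

variable {α ρ : ℝ}

lemma one_lt_rootExponent (hα : α < 3 / 2) : 1 < rootExponent α := by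
  unfold rootExponent; split_ifs <;> linarith

lemma rootExponent_le_two : rootExponent α ≤ 2 := by
  unfold rootExponent; split_ifs <;> linarith

lemma modeDamping_nonneg (hρ : 0 < ρ) (n : ℕ) : 0 ≤ modeDamping α ρ n := by
  unfold modeDamping; positivity

lemma modeSqrtDisc_sq (n : ℕ) : modeSqrtDisc α ρ n ^ 2 = (modeDisc α ρ n : ℂ) := by
  unfold modeSqrtDisc
  split_ifs with h
  · rw [← Complex.ofReal_pow, Real.sq_sqrt h]
  · rw [mul_pow, Complex.I_sq, ← Complex.ofReal_pow, Real.sq_sqrt (by linarith)]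
    push_cast; ring

lemma norm_modeSqrtDisc (n : ℕ) : ‖modeSqrtDisc α ρ n‖ = Real.sqrt |modeDisc α ρ n| := by
  unfold modeSqrtDisc
  split_ifs with h
  · rw [Complex.norm_real, Real.norm_of_nonneg (Real.sqrt_nonneg _), abs_of_nonneg h]
  · rw [norm_mul, Complex.norm_I, mul_one, Complex.norm_real,
      Real.norm_of_nonneg (Real.sqrt_nonneg _), abs_of_neg (by linarith)]

lemma slowRoot_add_fastRoot (n : ℕ) :
    slowRoot α ρ n + fastRoot α ρ n = -(modeDamping α ρ n : ℂ) := by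
  unfold slowRoot fastRoot; ring

lemma slowRoot_mul_fastRoot (n : ℕ) : slowRoot α ρ n * fastRoot α ρ n = (n : ℂ) ^ 4 := by
  have h := modeSqrtDisc_sq (α := α) (ρ := ρ) n
  have : slowRoot α ρ n * fastRoot α ρ n
      = ((modeDamping α ρ n : ℂ) ^ 2 - modeSqrtDisc α ρ n ^ 2) / 4 := by
    unfold slowRoot fastRoot; ring
  rw [this, h, modeDisc]
  push_cast; ring

lemma slowRoot_sub_fastRoot (n : ℕ) :
    slowRoot α ρ n - fastRoot α ρ n = modeSqrtDisc α ρ n := by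
  unfold slowRoot fastRoot; ring

lemma abs_re_modeSqrtDisc_le (hρ : 0 < ρ) (n : ℕ) :
    |(modeSqrtDisc α ρ n).re| ≤ modeDamping α ρ n := by
  have hb := modeDamping_nonneg (α := α) hρ n
  unfold modeSqrtDisc
  split_ifs with h
  · rw [Complex.ofReal_re, abs_of_nonneg (Real.sqrt_nonneg _), Real.sqrt_le_left hb, modeDisc]
    have : 0 ≤ (n : ℝ) ^ 4 := by positivity
    linarith
  · simpa using hb

lemma re_slowRoot_nonpos (hρ : 0 < ρ) (n : ℕ) : (slowRoot α ρ n).re ≤ 0 := by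
  have h := (abs_le.1 (abs_re_modeSqrtDisc_le (α := α) hρ n)).2
  have : (slowRoot α ρ n).re = (-modeDamping α ρ n + (modeSqrtDisc α ρ n).re) / 2 := by
    unfold slowRoot; simp
  rw [this]; linarith

lemma re_fastRoot_nonpos (hρ : 0 < ρ) (n : ℕ) : (fastRoot α ρ n).re ≤ 0 := by
  have h := (abs_le.1 (abs_re_modeSqrtDisc_le (α := α) hρ n)).1
  have : (fastRoot α ρ n).re = (-modeDamping α ρ n - (modeSqrtDisc α ρ n).re) / 2 := by
    unfold fastRoot; simp
  rw [this]; linarith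

lemma norm_modeSqrtDisc_le (hρ : 0 < ρ) (n : ℕ) :
    ‖modeSqrtDisc α ρ n‖ ≤ modeDamping α ρ n + 2 * (n : ℝ) ^ 2 := by
  have hb := modeDamping_nonneg (α := α) hρ n
  have hn : 0 ≤ (n : ℝ) ^ 2 := by positivity
  rw [norm_modeSqrtDisc, Real.sqrt_le_left (by positivity), modeDisc, abs_le]
  constructor <;> nlinarith [mul_nonneg hb hn]

lemma norm_slowRoot_le (hρ : 0 < ρ) (n : ℕ) :
    ‖slowRoot α ρ n‖ ≤ modeDamping α ρ n + (n : ℝ) ^ 2 := by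
  have hb := modeDamping_nonneg (α := α) hρ n
  have h := norm_add_le (-(modeDamping α ρ n : ℂ)) (modeSqrtDisc α ρ n)
  rw [norm_neg, Complex.norm_real, Real.norm_of_nonneg hb] at h
  unfold slowRoot
  rw [norm_div, Complex.norm_ofNat]
  linarith [norm_modeSqrtDisc_le (α := α) hρ n]

lemma norm_fastRoot_le (hρ : 0 < ρ) (n : ℕ) :
    ‖fastRoot α ρ n‖ ≤ modeDamping α ρ n + (n : ℝ) ^ 2 := by
  have hb := modeDamping_nonneg (α := α) hρ n
  have h := norm_sub_le (-(modeDamping α ρ n : ℂ)) (modeSqrtDisc α ρ n)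
  rw [norm_neg, Complex.norm_real, Real.norm_of_nonneg hb] at h
  unfold fastRoot
  rw [norm_div, Complex.norm_ofNat]
  linarith [norm_modeSqrtDisc_le (α := α) hρ n]

/-- `n^(4α) = n⁴ n^(4α-4)`: the discriminant relative to `n⁴`. -/
lemma modeDisc_eq {n : ℕ} (hn : 1 ≤ n) :
    modeDisc α ρ n = (n : ℝ) ^ 4 * (ρ ^ 2 * (n : ℝ) ^ (4 * α - 4) - 4) := by
  have hn0 : (0 : ℝ) < n := by exact_mod_cast hn
  have h1 : ((n : ℝ) ^ (2 * α)) ^ 2 = (n : ℝ) ^ 4 * (n : ℝ) ^ (4 * α - 4) := by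
    rw [← Real.rpow_natCast _ 2, ← Real.rpow_mul hn0.le, ← Real.rpow_natCast _ 4,
      ← Real.rpow_add hn0]
    congr 1; push_cast; ring
  rw [modeDisc, modeDamping, mul_pow, h1]; ring

lemma rpow_superadditive {γ x y : ℝ} (hγ : 1 ≤ γ) (hy : 0 ≤ y) (hxy : y ≤ x) :
    (x - y) ^ γ ≤ x ^ γ - y ^ γ := by
  have := NNReal.add_rpow_le_rpow_add ⟨x - y, by linarith⟩ ⟨y, hy⟩ hγ
  have h2 : (x - y) ^ γ + y ^ γ ≤ (x - y + y) ^ γ := by exact_mod_cast this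
  rw [sub_add_cancel] at h2
  linarith

lemma separated_of_lt {κ : ℕ → ℂ} {c γ : ℝ} {R : ℕ} (hγ : 0 < γ)
    (h : ∀ k l : ℕ, R ≤ l → l < k → c * ((k : ℝ) - l) ^ γ ≤ ‖κ k - κ l‖) (k l : ℕ) (hk : R ≤ k)
    (hl : R ≤ l) : c * |(k : ℝ) - l| ^ γ ≤ ‖κ k - κ l‖ := by
  rcases lt_trichotomy k l with hkl | rfl | hkl
  · rw [abs_sub_comm, abs_of_pos (sub_pos.2 (by exact_mod_cast hkl)), norm_sub_rev]
    exact h l k hk hkl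
  · simp [Real.zero_rpow hγ.ne']
  · rw [abs_of_pos (sub_pos.2 (by exact_mod_cast hkl))]
    exact h k l hl hkl

lemma exists_pos_le_norm_or_eq_zero (s : ℕ → ℂ) (R : ℕ) :
    ∃ δ : ℝ, 0 < δ ∧ ∀ n < R, s n = 0 ∨ δ ≤ ‖s n‖ := by
  induction R with
  | zero => exact ⟨1, one_pos, fun n hn => absurd hn (by omega)⟩
  | succ R ih =>
    obtain ⟨δ, hδ, h⟩ := ih
    rcases eq_or_ne (s R) 0 with h0 | h0
    · refine ⟨δ, hδ, fun n hn => ?_⟩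
      rcases Nat.lt_succ_iff_lt_or_eq.1 hn with h1 | rfl
      · exact h n h1
      · exact Or.inl h0
    · refine ⟨min δ ‖s R‖, lt_min hδ (norm_pos_iff.2 h0), fun n hn => ?_⟩
      rcases Nat.lt_succ_iff_lt_or_eq.1 hn with h1 | rfl
      · exact (h n h1).imp id fun h => (min_le_left _ _).trans h
      · exact Or.inr (min_le_right _ _)

/-- What the control construction needs to know about the characteristic roots: each of the two
branches is separated like the sequence `n ^ γ`, the two roots of a mode are equal or uniformly
apart, and the smoothing by the slow root makes up for the size of the fast root. -/
structure RootBounds (α ρ c δ C : ℝ) (R : ℕ) : Prop where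
  slow_sep : ∀ k l : ℕ, R ≤ k → R ≤ l →
    c * |(k : ℝ) - l| ^ rootExponent α ≤ ‖slowRoot α ρ k - slowRoot α ρ l‖
  fast_sep : ∀ k l : ℕ, R ≤ k → R ≤ l →
    c * |(k : ℝ) - l| ^ rootExponent α ≤ ‖fastRoot α ρ k - fastRoot α ρ l‖
  disc : ∀ n, 1 ≤ n → modeSqrtDisc α ρ n = 0 ∨ δ ≤ ‖modeSqrtDisc α ρ n‖
  slow_le : ∀ n, 1 ≤ n → ‖slowRoot α ρ n‖ ≤ C * (n : ℝ) ^ 2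
  fast_le : ∀ n, 1 ≤ n → ∀ t : ℝ, 0 < t → t ≤ 1 →
    ‖fastRoot α ρ n‖ * Real.exp (t * (slowRoot α ρ n).re) ≤ C * (n : ℝ) ^ 2 / t

lemma fast_le_of_norm_le (hρ : 0 < ρ) {C : ℝ} {n : ℕ} (h : ‖fastRoot α ρ n‖ ≤ C * (n : ℝ) ^ 2)
    {t : ℝ} (ht : 0 < t) (ht1 : t ≤ 1) :
    ‖fastRoot α ρ n‖ * Real.exp (t * (slowRoot α ρ n).re) ≤ C * (n : ℝ) ^ 2 / t := by
  have h1 : Real.exp (t * (slowRoot α ρ n).re) ≤ 1 :=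
    Real.exp_le_one_iff.2 (mul_nonpos_of_nonneg_of_nonpos ht.le (re_slowRoot_nonpos hρ n))
  have h0 : 0 ≤ C * (n : ℝ) ^ 2 := (norm_nonneg _).trans h
  calc _ ≤ ‖fastRoot α ρ n‖ * 1 := by gcongr
    _ ≤ C * (n : ℝ) ^ 2 := by linarith
    _ ≤ _ := by rw [le_div_iff₀ ht]; exact mul_le_of_le_one_right h0 ht1

lemma modeDamping_le_of_le_one (hρ : 0 < ρ) (hα : α ≤ 1) {n : ℕ} (hn : 1 ≤ n) :
    modeDamping α ρ n ≤ ρ * (n : ℝ) ^ 2 := by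
  have hn1 : (1 : ℝ) ≤ n := by exact_mod_cast hn
  unfold modeDamping
  gcongr
  rw [← Real.rpow_natCast]
  exact Real.rpow_le_rpow_of_exponent_le hn1 (by push_cast; linarith)

/-- For `α < 1` the roots are complex conjugate from some mode on, and their imaginary parts are
separated like the squares of the integers. -/
lemma exists_rootBounds_of_lt_one (hρ : 0 < ρ) (hα : α < 1) :
    ∃ c δ C : ℝ, ∃ R : ℕ, 0 < c ∧ 0 < δ ∧ 0 < C ∧ RootBounds α ρ c δ C R := by
  have hγ : rootExponent α = 2 := if_pos hα.le
  -- from `R` on the roots are complex, with imaginary parts at least `n² / 2`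
  obtain ⟨R, hR1, hR⟩ : ∃ R : ℕ, 1 ≤ R ∧ ∀ n : ℕ, R ≤ n →
      ρ ^ 2 * (n : ℝ) ^ (4 * α - 4) ≤ 3 := by
    have h1 : Filter.Tendsto (fun n : ℕ => ρ ^ 2 * (n : ℝ) ^ (-(4 - 4 * α))) Filter.atTop
        (nhds (ρ ^ 2 * 0)) :=
      ((tendsto_rpow_neg_atTop (by linarith)).comp tendsto_natCast_atTop_atTop).const_mul _
    rw [mul_zero] at h1
    obtain ⟨R, hR⟩ := Filter.eventually_atTop.1 (h1.eventually (ge_mem_nhds (show (0 : ℝ) < 3 by norm_num)))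
    exact ⟨R + 1, by omega, fun n hn => by
      have := hR n (by omega)
      rwa [neg_sub] at this⟩
  obtain ⟨δ, hδ, hδs⟩ := exists_pos_le_norm_or_eq_zero (modeSqrtDisc α ρ) R
  have hneg : ∀ n, R ≤ n → modeDisc α ρ n ≤ -(n : ℝ) ^ 4 := by
    intro n hn
    rw [modeDisc_eq (by omega)]
    have := hR n hn
    have h4 : 0 ≤ (n : ℝ) ^ 4 := by positivity
    nlinarith
  have hs : ∀ n, R ≤ n → modeSqrtDisc α ρ n
      = (((n : ℝ) ^ 2 * Real.sqrt (4 - ρ ^ 2 * (n : ℝ) ^ (4 * α - 4)) : ℝ) : ℂ) * Complex.I := by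
    intro n hn
    have hn0 : (0 : ℝ) < n := by exact_mod_cast (by omega : 0 < n)
    have h1 := hneg n hn
    have h4 : 0 < (n : ℝ) ^ 4 := by positivity
    rw [modeSqrtDisc, if_neg (by linarith)]
    congr 2
    rw [modeDisc_eq (by omega), show -((n : ℝ) ^ 4 * (ρ ^ 2 * (n : ℝ) ^ (4 * α - 4) - 4))
      = ((n : ℝ) ^ 2) ^ 2 * (4 - ρ ^ 2 * (n : ℝ) ^ (4 * α - 4)) by ring,
      Real.sqrt_mul (by positivity), Real.sqrt_sq (by positivity)]
  have hsep : ∀ k l : ℕ, R ≤ l → l < k →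
      ((k : ℝ) - l) ^ (2 : ℝ) ≤ ‖modeSqrtDisc α ρ k - modeSqrtDisc α ρ l‖ := by
    intro k l hl hkl
    have hl0 : (0 : ℝ) < l := by exact_mod_cast (by omega : 0 < l)
    have hkl' : (l : ℝ) < k := by exact_mod_cast hkl
    have hmono : (k : ℝ) ^ (4 * α - 4) ≤ (l : ℝ) ^ (4 * α - 4) :=
      Real.rpow_le_rpow_of_nonpos hl0 hkl'.le (by linarith)
    have h1 : Real.sqrt (4 - ρ ^ 2 * (l : ℝ) ^ (4 * α - 4))
        ≤ Real.sqrt (4 - ρ ^ 2 * (k : ℝ) ^ (4 * α - 4)) := by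
      apply Real.sqrt_le_sqrt
      have := mul_le_mul_of_nonneg_left hmono (sq_nonneg ρ)
      linarith
    have h2 : 1 ≤ Real.sqrt (4 - ρ ^ 2 * (k : ℝ) ^ (4 * α - 4)) := by
      rw [Real.one_le_sqrt]
      have := hR k (by omega)
      linarith
    rw [hs k (by omega), hs l hl, ← sub_mul, norm_mul, Complex.norm_I, mul_one,
      ← Complex.ofReal_sub, Complex.norm_real]
    refine le_trans ?_ (le_abs_self _)
    rw [show (2 : ℝ) = ((2 : ℕ) : ℝ) by norm_num, Real.rpow_natCast]
    have h3 : (l : ℝ) ^ 2 * Real.sqrt (4 - ρ ^ 2 * (l : ℝ) ^ (4 * α - 4))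
        ≤ (l : ℝ) ^ 2 * Real.sqrt (4 - ρ ^ 2 * (k : ℝ) ^ (4 * α - 4)) := by gcongr
    have h4 : 0 ≤ (k : ℝ) ^ 2 - (l : ℝ) ^ 2 := by nlinarith
    have h5 := mul_le_mul_of_nonneg_left h2 h4
    nlinarith
  refine ⟨1 / 2, min δ 1, ρ + 1, R, by norm_num, lt_min hδ one_pos, by positivity, ?_, ?_, ?_, ?_,
    ?_⟩
  · refine separated_of_lt (by rw [hγ]; norm_num) fun k l hl hkl => ?_
    have h1 := hsep k l hl hkl
    have hb : ((slowRoot α ρ k - slowRoot α ρ l).im)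
        = (modeSqrtDisc α ρ k - modeSqrtDisc α ρ l).im / 2 := by
      unfold slowRoot; simp; ring
    have h2 : ‖modeSqrtDisc α ρ k - modeSqrtDisc α ρ l‖
        = |(modeSqrtDisc α ρ k - modeSqrtDisc α ρ l).im| := by
      rw [hs k (by omega), hs l hl, ← sub_mul, ← Complex.ofReal_sub, norm_mul, Complex.norm_I,
        mul_one, Complex.norm_real, Complex.im_ofReal_mul, Complex.I_im, mul_one,
        Real.norm_eq_abs]
    have h3 := Complex.abs_im_le_norm (slowRoot α ρ k - slowRoot α ρ l)
    rw [hb, abs_div, abs_two, ← h2] at h3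
    rw [hγ]; linarith
  · refine separated_of_lt (by rw [hγ]; norm_num) fun k l hl hkl => ?_
    have h1 := hsep k l hl hkl
    have hb : ((fastRoot α ρ k - fastRoot α ρ l).im)
        = -(modeSqrtDisc α ρ k - modeSqrtDisc α ρ l).im / 2 := by
      unfold fastRoot; simp; ring
    have h2 : ‖modeSqrtDisc α ρ k - modeSqrtDisc α ρ l‖
        = |(modeSqrtDisc α ρ k - modeSqrtDisc α ρ l).im| := by
      rw [hs k (by omega), hs l hl, ← sub_mul, ← Complex.ofReal_sub, norm_mul, Complex.norm_I,
        mul_one, Complex.norm_real, Complex.im_ofReal_mul, Complex.I_im, mul_one,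
        Real.norm_eq_abs]
    have h3 := Complex.abs_im_le_norm (fastRoot α ρ k - fastRoot α ρ l)
    rw [hb, abs_div, abs_neg, abs_two, ← h2] at h3
    rw [hγ]; linarith
  · intro n hn
    rcases lt_or_ge n R with h | h
    · exact (hδs n h).imp id fun h => (min_le_left _ _).trans h
    · refine Or.inr ((min_le_right _ _).trans ?_)
      have hn1 : (1 : ℝ) ≤ n := by exact_mod_cast hn
      have h4 : 1 ≤ (n : ℝ) ^ 4 := one_le_pow₀ hn1
      have := hneg n h
      rw [norm_modeSqrtDisc, Real.one_le_sqrt, abs_of_neg (by linarith)]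
      linarith
  · intro n hn
    have h1 := modeDamping_le_of_le_one hρ hα.le hn
    have h2 := norm_slowRoot_le (α := α) hρ n
    linarith
  · intro n hn t ht ht1
    refine fast_le_of_norm_le hρ ?_ ht ht1
    have h1 := modeDamping_le_of_le_one hρ hα.le hn
    have h2 := norm_fastRoot_le (α := α) hρ n
    linarith

/-- For `α = 1` all modes are scalings of the first one. -/
lemma exists_rootBounds_of_eq_one (hρ : 0 < ρ) :
    ∃ c δ C : ℝ, ∃ R : ℕ, 0 < c ∧ 0 < δ ∧ 0 < C ∧ RootBounds 1 ρ c δ C R := by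
  have hγ : rootExponent 1 = 2 := if_pos le_rfl
  have hb : ∀ n : ℕ, modeDamping 1 ρ n = (n : ℝ) ^ 2 * ρ := by
    intro n
    rw [modeDamping, show (2 * 1 : ℝ) = ((2 : ℕ) : ℝ) by norm_num, Real.rpow_natCast, mul_comm]
  have hs : ∀ n : ℕ, 1 ≤ n → modeSqrtDisc 1 ρ n = (n : ℂ) ^ 2 * modeSqrtDisc 1 ρ 1 := by
    intro n hn
    have hn0 : (0 : ℝ) < n := by exact_mod_cast hn
    have hD : modeDisc 1 ρ n = ((n : ℝ) ^ 2) ^ 2 * modeDisc 1 ρ 1 := by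
      rw [modeDisc, modeDisc, hb, hb]; push_cast; ring
    unfold modeSqrtDisc
    have hiff : 0 ≤ modeDisc 1 ρ n ↔ 0 ≤ modeDisc 1 ρ 1 := by
      rw [hD]; exact mul_nonneg_iff_of_pos_left (by positivity)
    by_cases h : 0 ≤ modeDisc 1 ρ 1
    · rw [if_pos (hiff.2 h), if_pos h, hD, Real.sqrt_mul (by positivity),
        Real.sqrt_sq (by positivity)]
      push_cast; ring
    · rw [if_neg (mt hiff.1 h), if_neg h, hD, ← mul_neg, Real.sqrt_mul (by positivity),
        Real.sqrt_sq (by positivity)]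
      push_cast; ring
  have hslow : ∀ n : ℕ, 1 ≤ n → slowRoot 1 ρ n = (n : ℂ) ^ 2 * slowRoot 1 ρ 1 := by
    intro n hn
    unfold slowRoot
    rw [hs n hn, hb, hb]; push_cast; ring
  have hfast : ∀ n : ℕ, 1 ≤ n → fastRoot 1 ρ n = (n : ℂ) ^ 2 * fastRoot 1 ρ 1 := by
    intro n hn
    unfold fastRoot
    rw [hs n hn, hb, hb]; push_cast; ring
  have hprod := slowRoot_mul_fastRoot (α := 1) (ρ := ρ) 1
  have hS : 0 < ‖slowRoot 1 ρ 1‖ := norm_pos_iff.2 fun h => by simp [h] at hprod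
  have hF : 0 < ‖fastRoot 1 ρ 1‖ := norm_pos_iff.2 fun h => by simp [h] at hprod
  have hsep : ∀ (ζ : ℂ) (k l : ℕ), l < k →
      ‖ζ‖ * ((k : ℝ) - l) ^ (2 : ℝ) ≤ ‖(k : ℂ) ^ 2 * ζ - (l : ℂ) ^ 2 * ζ‖ := by
    intro ζ k l hkl
    have hkl' : (l : ℝ) < k := by exact_mod_cast hkl
    have hl0 : (0 : ℝ) ≤ l := Nat.cast_nonneg l
    have e : (k : ℂ) ^ 2 - (l : ℂ) ^ 2 = (((k : ℝ) ^ 2 - (l : ℝ) ^ 2 : ℝ) : ℂ) := by push_cast; ring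
    rw [← sub_mul, norm_mul, mul_comm, e, Complex.norm_real]
    refine mul_le_mul_of_nonneg_right (le_trans ?_ (le_abs_self _)) (norm_nonneg _)
    rw [show (2 : ℝ) = ((2 : ℕ) : ℝ) by norm_num, Real.rpow_natCast]
    nlinarith
  have h1 : ∀ n : ℕ, 1 ≤ n → (1 : ℝ) ≤ (n : ℝ) ^ 2 := fun n hn =>
    one_le_pow₀ (by exact_mod_cast hn)
  obtain ⟨δ, hδ, hδs⟩ := exists_pos_le_norm_or_eq_zero (modeSqrtDisc 1 ρ) 2
  refine ⟨min ‖slowRoot 1 ρ 1‖ ‖fastRoot 1 ρ 1‖, δ, ρ + 1, 1, lt_min hS hF, hδ, by positivity,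
    ?_, ?_, ?_, ?_, ?_⟩
  · refine separated_of_lt (by rw [hγ]; norm_num) fun k l hl hkl => ?_
    rw [hslow k (by omega), hslow l hl, hγ]
    refine le_trans ?_ (hsep _ k l hkl)
    have : (0 : ℝ) ≤ ((k : ℝ) - l) ^ (2 : ℝ) := by
      apply Real.rpow_nonneg
      have : (l : ℝ) < k := by exact_mod_cast hkl
      linarith
    exact mul_le_mul_of_nonneg_right (min_le_left _ _) this
  · refine separated_of_lt (by rw [hγ]; norm_num) fun k l hl hkl => ?_
    rw [hfast k (by omega), hfast l hl, hγ]
    refine le_trans ?_ (hsep _ k l hkl)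
    have : (0 : ℝ) ≤ ((k : ℝ) - l) ^ (2 : ℝ) := by
      apply Real.rpow_nonneg
      have : (l : ℝ) < k := by exact_mod_cast hkl
      linarith
    exact mul_le_mul_of_nonneg_right (min_le_right _ _) this
  · intro n hn
    rw [hs n hn]
    rcases hδs 1 (by norm_num) with h | h
    · left; rw [h, mul_zero]
    · right
      rw [norm_mul, norm_pow, Complex.norm_natCast]
      nlinarith [h1 n hn]
  · intro n hn
    have h1 := modeDamping_le_of_le_one hρ le_rfl hn
    have h2 := norm_slowRoot_le (α := 1) hρ n
    linarith
  · intro n hn t ht ht1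
    refine fast_le_of_norm_le hρ ?_ ht ht1
    have h1 := modeDamping_le_of_le_one hρ le_rfl hn
    have h2 := norm_fastRoot_le (α := 1) hρ n
    linarith

lemma one_sub_rpow_le {γ p y : ℝ} (hγ : 0 < γ) (hp : p ≤ 3 * γ) (hy : 0 < y) (hy1 : y ≤ 1) :
    1 - y ^ p ≤ 3 * (1 - y ^ γ) := by
  have h1 : y ^ (3 * γ) ≤ y ^ p := Real.rpow_le_rpow_of_exponent_ge hy hy1 hp
  have h2 : y ^ (3 * γ) = (y ^ γ) ^ 3 := by
    rw [mul_comm, Real.rpow_mul hy.le]; exact_mod_cast rfl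
  have h3 : y ^ γ ≤ 1 := Real.rpow_le_one hy.le hy1 hγ.le
  have h4 : 0 ≤ y ^ γ := by positivity
  rw [h2] at h1
  nlinarith [mul_nonneg h4 (sub_nonneg.2 h3), mul_nonneg (mul_nonneg h4 h4) (sub_nonneg.2 h3)]

/-- For `α > 1` the roots are real from some mode on. Subtracting the equations
`r² - b r + n⁴ = 0` of the two slow rates `r` gives
`(r_k - r_l) (b_k - r_k - r_l) = k⁴ - l⁴ - r_l (b_k - b_l)`, and `r_l` is close to
`l^(4-2α) / ρ`. -/
lemma exists_rootBounds_of_one_lt (hρ : 0 < ρ) (hα1 : 1 < α) (hα : α < 3 / 2) :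
    ∃ c δ C : ℝ, ∃ R : ℕ, 0 < c ∧ 0 < δ ∧ 0 < C ∧ RootBounds α ρ c δ C R := by
  set γ : ℝ := rootExponent α with hγdef
  have hγ : γ = 4 - 2 * α := if_neg (by linarith)
  have hγ1 : 1 < γ := by linarith
  obtain ⟨R, hR1, hR⟩ : ∃ R : ℕ, 1 ≤ R ∧ ∀ n : ℕ, R ≤ n →
      10 ≤ ρ ^ 2 * (n : ℝ) ^ (4 * α - 4) := by
    have h1 : Filter.Tendsto (fun n : ℕ => ρ ^ 2 * (n : ℝ) ^ (4 * α - 4)) Filter.atTop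
        Filter.atTop :=
      ((tendsto_rpow_atTop (by linarith)).comp tendsto_natCast_atTop_atTop).const_mul_atTop
        (by positivity)
    obtain ⟨R, hR⟩ := Filter.eventually_atTop.1 (h1.eventually_ge_atTop 10)
    exact ⟨R + 1, by omega, fun n hn => hR n (by omega)⟩
  obtain ⟨δ, hδ, hδs⟩ := exists_pos_le_norm_or_eq_zero (modeSqrtDisc α ρ) R
  set b : ℕ → ℝ := modeDamping α ρ with hb
  set D : ℕ → ℝ := modeDisc α ρ with hD
  have hbdef : ∀ n, b n = ρ * (n : ℝ) ^ (2 * α) := fun n => rfl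
  have hDdef : ∀ n, D n = b n ^ 2 - 4 * (n : ℝ) ^ 4 := fun n => rfl
  have hn0 : ∀ n, R ≤ n → (0 : ℝ) < n := fun n hn => by exact_mod_cast (by omega : 0 < n)
  have hbpos : ∀ n, R ≤ n → 0 < b n := fun n hn => by
    have := hn0 n hn
    rw [hbdef]; positivity
  have hb2 : ∀ n, R ≤ n → b n ^ 2 = (n : ℝ) ^ 4 * (ρ ^ 2 * (n : ℝ) ^ (4 * α - 4)) := by
    intro n hn
    have := modeDisc_eq (α := α) (ρ := ρ) (n := n) (by omega)
    have h2 := hDdef n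
    linarith
  have hbig : ∀ n, R ≤ n → 10 * (n : ℝ) ^ 4 ≤ b n ^ 2 := by
    intro n hn
    rw [hb2 n hn]
    nlinarith [hR n hn, pow_pos (hn0 n hn) 4]
  have hDpos : ∀ n, R ≤ n → 1 ≤ D n := by
    intro n hn
    have h1 : (1 : ℝ) ≤ (n : ℝ) ^ 4 := one_le_pow₀ (by exact_mod_cast (by omega : 1 ≤ n))
    rw [hDdef]
    linarith [hbig n hn]
  set q : ℕ → ℝ := fun n => Real.sqrt (D n) with hq
  have hq2 : ∀ n, R ≤ n → q n ^ 2 = D n := fun n hn => Real.sq_sqrt (by linarith [hDpos n hn])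
  have hq0 : ∀ n, 0 ≤ q n := fun n => Real.sqrt_nonneg _
  have hqb : ∀ n, R ≤ n → q n ≤ b n := fun n hn => by
    refine abs_le_of_sq_le_sq' ?_ (hbpos n hn).le |>.2
    rw [hq2 n hn, hDdef]
    linarith [pow_pos (hn0 n hn) 4]
  have hq57 : ∀ n, R ≤ n → 5 / 7 * b n ≤ q n := fun n hn => by
    refine abs_le_of_sq_le_sq' ?_ (hq0 n) |>.2
    rw [hq2 n hn, hDdef]
    linarith [hbig n hn, pow_pos (hn0 n hn) 4]
  have hs : ∀ n, R ≤ n → modeSqrtDisc α ρ n = ((q n : ℝ) : ℂ) := fun n hn => by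
    rw [modeSqrtDisc, if_pos (by linarith [hDpos n hn])]
  -- the slow and the fast decay rates
  set r : ℕ → ℝ := fun n => (b n - q n) / 2 with hr
  set s : ℕ → ℝ := fun n => (b n + q n) / 2 with hsdef
  have hslow : ∀ n, R ≤ n → slowRoot α ρ n = ((-(r n) : ℝ) : ℂ) := fun n hn => by
    rw [slowRoot, hs n hn, hr]; push_cast; ring
  have hfast : ∀ n, R ≤ n → fastRoot α ρ n = ((-(s n) : ℝ) : ℂ) := fun n hn => by
    rw [fastRoot, hs n hn, hsdef]; push_cast; ring
  have hr0 : ∀ n, R ≤ n → 0 ≤ r n := fun n hn => by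
    simp only [hr]; linarith [hqb n hn]
  have hrs : ∀ n, R ≤ n → r n * s n = (n : ℝ) ^ 4 := fun n hn => by
    have : r n * s n = (b n ^ 2 - q n ^ 2) / 4 := by simp only [hr, hsdef]; ring
    rw [this, hq2 n hn, hDdef]; ring
  have hn4 : ∀ n, R ≤ n → (n : ℝ) ^ 4 = (n : ℝ) ^ γ * (n : ℝ) ^ (2 * α) := fun n hn => by
    rw [← Real.rpow_add (hn0 n hn), hγ, sub_add_cancel]
    exact_mod_cast rfl
  have hr76 : ∀ n, R ≤ n → ρ * r n ≤ 7 / 6 * (n : ℝ) ^ γ := fun n hn => by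
    have hX : 0 < (n : ℝ) ^ (2 * α) := Real.rpow_pos_of_pos (hn0 n hn) _
    have h1 := hrs n hn
    have h2 : 6 / 7 * b n ≤ s n := by simp only [hsdef]; linarith [hq57 n hn]
    have h3 := mul_le_mul_of_nonneg_left h2 (hr0 n hn)
    rw [h1, hn4 n hn, hbdef] at h3
    have h4 : (ρ * r n) * (n : ℝ) ^ (2 * α) ≤ 7 / 6 * (n : ℝ) ^ γ * (n : ℝ) ^ (2 * α) := by
      linarith
    exact le_of_mul_le_mul_right h4 hX
  have hrlow : ∀ n, R ≤ n → (n : ℝ) ^ γ ≤ ρ * r n := fun n hn => by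
    have hX : 0 < (n : ℝ) ^ (2 * α) := Real.rpow_pos_of_pos (hn0 n hn) _
    have h1 := hrs n hn
    have h2 : s n ≤ b n := by simp only [hsdef]; linarith [hqb n hn]
    have h3 := mul_le_mul_of_nonneg_left h2 (hr0 n hn)
    rw [h1, hn4 n hn, hbdef] at h3
    exact le_of_mul_le_mul_right (by linarith) hX
  have hmonoD : ∀ k l, R ≤ l → l < k → q l ≤ q k := by
    intro k l hl hkl
    have hl0 := hn0 l hl
    have hkl' : (l : ℝ) ≤ k := by exact_mod_cast hkl.le
    apply Real.sqrt_le_sqrt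
    rw [hDdef, hDdef, hb2 k (by omega), hb2 l hl]
    have h1 : (l : ℝ) ^ (4 * α - 4) ≤ (k : ℝ) ^ (4 * α - 4) :=
      Real.rpow_le_rpow hl0.le hkl' (by linarith)
    have h2 : (l : ℝ) ^ 4 ≤ (k : ℝ) ^ 4 := by gcongr
    have h3 := mul_le_mul_of_nonneg_left h1 (sq_nonneg ρ)
    have h4 := hR l hl
    nlinarith [mul_nonneg (sub_nonneg.2 h2) (by linarith : (0:ℝ) ≤ ρ ^ 2 * (l : ℝ) ^ (4 * α - 4) - 4),
      mul_nonneg (sub_nonneg.2 h3) (by positivity : (0 : ℝ) ≤ (k : ℝ) ^ 4)]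
  refine ⟨min (1 / (2 * ρ)) (ρ / 2), min δ 1, ρ + ρ * (R : ℝ) ^ (2 * α) + (R : ℝ) ^ 2 + 1
    + 7 / (6 * ρ) + (ρ + 1) * ρ, R, by positivity, lt_min hδ one_pos, by positivity,
    ?_, ?_, ?_, ?_, ?_⟩
  · refine separated_of_lt (by linarith) fun k l hl hkl => ?_
    have hl0 := hn0 l hl
    have hk : R ≤ k := by omega
    have hk0 := hn0 k hk
    have hkl' : (l : ℝ) ≤ k := by exact_mod_cast hkl.le
    rw [hslow k hk, hslow l hl, ← Complex.ofReal_sub, Complex.norm_real]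
    have hsup := rpow_superadditive hγ1.le hl0.le hkl'
    have hd0 : 0 ≤ ((k : ℝ) - l) ^ γ := Real.rpow_nonneg (by linarith) _
    have hX : 0 < (k : ℝ) ^ (2 * α) := by positivity
    have hid : (r k - r l) * (s k - r l) = (k : ℝ) ^ 4 - (l : ℝ) ^ 4 - r l * (b k - b l) := by
      have h1 := hrs k hk
      have h2 := hrs l hl
      have h3 : s k = b k - r k := by simp only [hr, hsdef]; ring
      have h4 : s l = b l - r l := by simp only [hr, hsdef]; ring
      rw [h3] at h1 ⊢
      rw [h4] at h2
      linarith
    have hcomp : (l : ℝ) ^ γ * ((k : ℝ) ^ (2 * α) - (l : ℝ) ^ (2 * α))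
        ≤ 3 * ((k : ℝ) ^ (2 * α) * ((k : ℝ) ^ γ - (l : ℝ) ^ γ)) := by
      have hy : 0 < (l : ℝ) / k := by positivity
      have hy1 : (l : ℝ) / k ≤ 1 := by rw [div_le_one hk0]; exact hkl'
      have h1 := one_sub_rpow_le (p := 2 * α) (by linarith : 0 < γ) (by linarith) hy hy1
      rw [Real.div_rpow hl0.le hk0.le, Real.div_rpow hl0.le hk0.le] at h1
      have hK : 0 < (k : ℝ) ^ γ := by positivity
      have hL : (l : ℝ) ^ γ ≤ (k : ℝ) ^ γ := Real.rpow_le_rpow hl0.le hkl' (by linarith)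
      have hL2 : (l : ℝ) ^ (2 * α) ≤ (k : ℝ) ^ (2 * α) :=
        Real.rpow_le_rpow hl0.le hkl' (by linarith)
      have h2 := mul_le_mul_of_nonneg_left h1 (mul_pos hX hK).le
      have e1 : (k : ℝ) ^ (2 * α) * (k : ℝ) ^ γ * (1 - (l : ℝ) ^ (2 * α) / (k : ℝ) ^ (2 * α))
          = (k : ℝ) ^ γ * ((k : ℝ) ^ (2 * α) - (l : ℝ) ^ (2 * α)) := by field_simp
      have e2 : (k : ℝ) ^ (2 * α) * (k : ℝ) ^ γ * (3 * (1 - (l : ℝ) ^ γ / (k : ℝ) ^ γ))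
          = 3 * ((k : ℝ) ^ (2 * α) * ((k : ℝ) ^ γ - (l : ℝ) ^ γ)) := by field_simp
      rw [e1, e2] at h2
      exact (mul_le_mul_of_nonneg_right hL (sub_nonneg.2 hL2)).trans h2
    have hrhs : 1 / 2 * ((k : ℝ) ^ (2 * α) * ((k : ℝ) ^ γ - (l : ℝ) ^ γ))
        ≤ (r k - r l) * (s k - r l) := by
      rw [hid, hn4 k hk, hn4 l hl, hbdef, hbdef]
      have hL2 : (l : ℝ) ^ (2 * α) ≤ (k : ℝ) ^ (2 * α) :=
        Real.rpow_le_rpow hl0.le hkl' (by linarith)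
      have h1 := mul_le_mul_of_nonneg_right (hr76 l hl) (sub_nonneg.2 hL2)
      linarith
    have hss : r l ≤ s k := by
      have h1 : s l ≤ s k := by
        have hbb : b l ≤ b k := by
          rw [hbdef, hbdef]
          have := Real.rpow_le_rpow hl0.le hkl' (by linarith : 0 ≤ 2 * α)
          gcongr
        simp only [hsdef]
        linarith [hmonoD k l hl hkl]
      have h2 : r l ≤ s l := by simp only [hr, hsdef]; linarith [hq0 l]
      linarith
    have hpos : 0 < r k - r l := by
      by_contra hcon
      have h1 : (r k - r l) * (s k - r l) ≤ 0 :=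
        mul_nonpos_of_nonpos_of_nonneg (not_lt.1 hcon) (by linarith)
      have h2 : 0 < ((k : ℝ) - l) ^ γ :=
        Real.rpow_pos_of_pos (sub_pos.2 (by exact_mod_cast hkl)) _
      have h3 : 0 < (k : ℝ) ^ (2 * α) * ((k : ℝ) ^ γ - (l : ℝ) ^ γ) :=
        mul_pos hX (by linarith)
      linarith
    have hupper : (r k - r l) * (s k - r l) ≤ (r k - r l) * (ρ * (k : ℝ) ^ (2 * α)) := by
      refine mul_le_mul_of_nonneg_left ?_ hpos.le
      rw [← hbdef]
      have : s k ≤ b k := by simp only [hsdef]; linarith [hqb k hk]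
      linarith [hr0 l hl]
    have hmain : 1 / 2 * ((k : ℝ) ^ γ - (l : ℝ) ^ γ) ≤ ρ * (r k - r l) := by
      refine le_of_mul_le_mul_right ?_ hX
      linarith
    rw [Real.norm_eq_abs, show -r k - -r l = -(r k - r l) by ring, abs_neg, abs_of_pos hpos]
    calc min (1 / (2 * ρ)) (ρ / 2) * ((k : ℝ) - l) ^ γ ≤ 1 / (2 * ρ) * ((k : ℝ) - l) ^ γ :=
          mul_le_mul_of_nonneg_right (min_le_left _ _) hd0
      _ ≤ r k - r l := by
          rw [div_mul_eq_mul_div, one_mul, div_le_iff₀ (by positivity)]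
          linarith
  · refine separated_of_lt (by linarith) fun k l hl hkl => ?_
    have hl0 := hn0 l hl
    have hk : R ≤ k := by omega
    have hkl' : (l : ℝ) ≤ k := by exact_mod_cast hkl.le
    have hd1 : (1 : ℝ) ≤ (k : ℝ) - l := by
      have : (l : ℝ) + 1 ≤ k := by exact_mod_cast hkl
      linarith
    have hd0 : 0 ≤ ((k : ℝ) - l) ^ γ := Real.rpow_nonneg (by linarith) _
    rw [hfast k hk, hfast l hl, ← Complex.ofReal_sub, Complex.norm_real, Real.norm_eq_abs,
      abs_sub_comm]
    refine le_trans ?_ (le_abs_self _)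
    have h1 := rpow_superadditive (γ := 2 * α) (by linarith) hl0.le hkl'
    have h2 : ((k : ℝ) - l) ^ γ ≤ ((k : ℝ) - l) ^ (2 * α) :=
      Real.rpow_le_rpow_of_exponent_le hd1 (by linarith)
    have h3 : ρ / 2 * ((k : ℝ) - l) ^ γ ≤ (b k - b l) / 2 := by
      rw [hbdef, hbdef]
      have := mul_le_mul_of_nonneg_left (h2.trans h1) hρ.le
      linarith
    have h4 := hmonoD k l hl hkl
    have h5 := mul_le_mul_of_nonneg_right (min_le_right (1 / (2 * ρ)) (ρ / 2)) hd0
    simp only [hsdef]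
    linarith
  · intro n hn
    rcases lt_or_ge n R with h | h
    · exact (hδs n h).imp id fun h => (min_le_left _ _).trans h
    · refine Or.inr ((min_le_right _ _).trans ?_)
      rw [norm_modeSqrtDisc, Real.one_le_sqrt]
      exact (hDpos n h).trans (le_abs_self _)
  · intro n hn
    have hn1 : (1 : ℝ) ≤ n := by exact_mod_cast hn
    have hn2 : (1 : ℝ) ≤ (n : ℝ) ^ 2 := one_le_pow₀ hn1
    have hR2 : 0 ≤ ρ * (R : ℝ) ^ (2 * α) := by positivity
    have hR3 : 0 ≤ (R : ℝ) ^ 2 := by positivity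
    have hR4 : 0 < 7 / (6 * ρ) := by positivity
    have hR5 : 0 < (ρ + 1) * ρ := by positivity
    rcases lt_or_ge n R with h | h
    · have h1 := norm_slowRoot_le (α := α) hρ n
      have h2 : modeDamping α ρ n ≤ ρ * (R : ℝ) ^ (2 * α) := by
        unfold modeDamping
        gcongr
      nlinarith
    · have h1 := hr76 n h
      rw [hslow n h, Complex.norm_real, norm_neg, Real.norm_of_nonneg (hr0 n h)]
      have h2 : (n : ℝ) ^ γ ≤ (n : ℝ) ^ 2 := by
        rw [← Real.rpow_natCast]
        exact Real.rpow_le_rpow_of_exponent_le hn1 (by push_cast; linarith)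
      have h3 : r n ≤ 7 / (6 * ρ) * (n : ℝ) ^ 2 := by
        rw [div_mul_eq_mul_div, le_div_iff₀ (by positivity)]
        linarith
      nlinarith
  · intro n hn t ht ht1
    have hn1 : (1 : ℝ) ≤ n := by exact_mod_cast hn
    have hn2 : (1 : ℝ) ≤ (n : ℝ) ^ 2 := one_le_pow₀ hn1
    have hR2 : 0 ≤ ρ * (R : ℝ) ^ (2 * α) := by positivity
    have hR3 : 0 ≤ (R : ℝ) ^ 2 := by positivity
    have hR4 : 0 < 7 / (6 * ρ) := by positivity
    have hR5 : 0 < (ρ + 1) * ρ := by positivity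
    rcases lt_or_ge n R with h | h
    · refine fast_le_of_norm_le hρ ?_ ht ht1
      have h1 := norm_fastRoot_le (α := α) hρ n
      have h2 : modeDamping α ρ n ≤ ρ * (R : ℝ) ^ (2 * α) := by
        unfold modeDamping
        gcongr
      nlinarith
    · have h1 : ‖fastRoot α ρ n‖ ≤ (ρ + 1) * ((n : ℝ) ^ 2 * (n : ℝ) ^ γ) := by
        have h2 := norm_fastRoot_le (α := α) hρ n
        have h3 : (n : ℝ) ^ (2 * α) ≤ (n : ℝ) ^ 2 * (n : ℝ) ^ γ := by
          rw [← Real.rpow_natCast _ 2, ← Real.rpow_add (hn0 n h)]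
          exact Real.rpow_le_rpow_of_exponent_le hn1 (by push_cast; linarith)
        have h4 : (1 : ℝ) ≤ (n : ℝ) ^ γ := Real.one_le_rpow hn1 (by linarith)
        have h5 : (n : ℝ) ^ 2 * 1 ≤ (n : ℝ) ^ 2 * (n : ℝ) ^ γ := by gcongr
        have h6 := mul_le_mul_of_nonneg_left h3 hρ.le
        have h7 : modeDamping α ρ n = ρ * (n : ℝ) ^ (2 * α) := rfl
        linarith
      have h2 : (slowRoot α ρ n).re = -(r n) := by rw [hslow n h, Complex.ofReal_re]
      have h3 : (n : ℝ) ^ γ * Real.exp (t * (slowRoot α ρ n).re) ≤ ρ / t := by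
        rw [h2, mul_neg, Real.exp_neg, ← div_eq_mul_inv, div_le_div_iff₀ (Real.exp_pos _) ht]
        have h4 := Real.add_one_le_exp (t * r n)
        have h5 := mul_le_mul_of_nonneg_left (hrlow n h) ht.le
        have h6 := mul_le_mul_of_nonneg_left h4 hρ.le
        linarith
      calc ‖fastRoot α ρ n‖ * Real.exp (t * (slowRoot α ρ n).re)
          ≤ (ρ + 1) * ((n : ℝ) ^ 2 * (n : ℝ) ^ γ) * Real.exp (t * (slowRoot α ρ n).re) := by
            gcongr
        _ = (ρ + 1) * (n : ℝ) ^ 2 * ((n : ℝ) ^ γ * Real.exp (t * (slowRoot α ρ n).re)) := by ring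
        _ ≤ (ρ + 1) * (n : ℝ) ^ 2 * (ρ / t) := by gcongr
        _ = (ρ + 1) * ρ * (n : ℝ) ^ 2 / t := by ring
        _ ≤ _ := by
            gcongr
            linarith

lemma exists_rootBounds (hρ : 0 < ρ) (hα : α < 3 / 2) :
    ∃ c δ C : ℝ, ∃ R : ℕ, 0 < c ∧ 0 < δ ∧ 0 < C ∧ RootBounds α ρ c δ C R := by
  rcases lt_trichotomy α 1 with h | rfl | h
  · exact exists_rootBounds_of_lt_one hρ h
  · exact exists_rootBounds_of_eq_one hρ
  · exact exists_rootBounds_of_one_lt hρ h hα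

end Roots


/-! ### Operators of infinite order acting on the cut-off -/

/-- The operator `∑ j, q j ∂^j` applied to the `i`-th derivative of `H 0`, where `H j` is the
`j`-th derivative of `H 0`. -/
def seriesOp (q : ℕ → ℂ) (H : ℕ → ℝ → ℝ) (i : ℕ) (t : ℝ) : ℂ := ∑' j, q j * (H (j + i) t : ℂ)

section SeriesOp

variable {γ M N A B : ℝ} {q q' : ℕ → ℂ} {H : ℕ → ℝ → ℝ}

/-- The growth conditions under which the series defining `seriesOp q H` converges geometrically:
the Gevrey order of `H` is exactly the one that the decay of `q` can absorb. -/
structure GevreyPair (γ M N A B : ℝ) (q : ℕ → ℂ) (H : ℕ → ℝ → ℝ) : Prop where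
  exponent_nonneg : 0 ≤ γ
  const_nonneg : 0 ≤ M
  coeff_const_nonneg : 0 ≤ N
  jet_radius_nonneg : 0 ≤ A
  coeff_radius_nonneg : 0 ≤ B
  jet_radius_le : 2 ^ γ * A ≤ 1
  product_le : 2 ^ γ * A * B ≤ 1 / 2
  coeff_le : ∀ j, ‖q j‖ ≤ N * (B ^ j / (j.factorial : ℝ) ^ γ)
  jet_le : ∀ j t, |H j t| ≤ M * A ^ j * (j.factorial : ℝ) ^ γ
  jet_deriv : ∀ j t, HasDerivAt (H j) (H (j + 1) t) t

lemma GevreyPair.term_le (h : GevreyPair γ M N A B q H) (i j : ℕ) (t : ℝ) :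
    ‖q j * (H (j + i) t : ℂ)‖ ≤ N * M * (i.factorial : ℝ) ^ γ * (1 / 2) ^ j := by
  have hγ := h.exponent_nonneg
  have hM := h.const_nonneg
  have hN := h.coeff_const_nonneg
  have hA := h.jet_radius_nonneg
  have hB := h.coeff_radius_nonneg
  rw [norm_mul, Complex.norm_real, Real.norm_eq_abs]
  have h1 : ((j + i).factorial : ℝ) ^ γ
      ≤ (2 ^ γ) ^ (j + i) * ((j.factorial : ℝ) ^ γ * (i.factorial : ℝ) ^ γ) := by
    rw [← Real.rpow_natCast, ← Real.rpow_mul (by norm_num), mul_comm γ,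
      Real.rpow_mul (by norm_num), Real.rpow_natCast,
      ← Real.mul_rpow (by positivity) (by positivity),
      ← Real.mul_rpow (by positivity) (by positivity)]
    refine Real.rpow_le_rpow (by positivity) ?_ hγ
    have h2 : (j + i).factorial ≤ 2 ^ (j + i) * (j.factorial * i.factorial) := by
      rw [← Nat.add_choose_mul_factorial_mul_factorial, mul_assoc]
      exact Nat.mul_le_mul_right _ (Nat.choose_le_two_pow _ _)
    exact_mod_cast h2
  have hj : 0 < (j.factorial : ℝ) ^ γ := by positivity
  calc ‖q j‖ * |H (j + i) t|
      ≤ (N * (B ^ j / (j.factorial : ℝ) ^ γ)) * (M * A ^ (j + i) *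
        ((2 ^ γ) ^ (j + i) * ((j.factorial : ℝ) ^ γ * (i.factorial : ℝ) ^ γ))) := by
        refine mul_le_mul (h.coeff_le j) ((h.jet_le (j + i) t).trans ?_) (abs_nonneg _)
          (by positivity)
        gcongr
    _ = N * M * (i.factorial : ℝ) ^ γ * ((2 ^ γ * A * B) ^ j * (2 ^ γ * A) ^ i) := by
        field_simp
        ring
    _ ≤ N * M * (i.factorial : ℝ) ^ γ * ((1 / 2) ^ j * 1 ^ i) := by
        gcongr
        · exact h.product_le
        · exact h.jet_radius_le
    _ = _ := by rw [one_pow, mul_one]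

lemma summable_geometric_bound (γ M N : ℝ) (i : ℕ) :
    Summable fun j : ℕ => N * M * (i.factorial : ℝ) ^ γ * (1 / 2 : ℝ) ^ j :=
  (summable_geometric_two).mul_left _

lemma GevreyPair.summable (h : GevreyPair γ M N A B q H) (i : ℕ) (t : ℝ) :
    Summable fun j => q j * (H (j + i) t : ℂ) :=
  Summable.of_norm_bounded (summable_geometric_bound γ M N i) fun j => h.term_le i j t

lemma GevreyPair.norm_seriesOp_le (h : GevreyPair γ M N A B q H) (i : ℕ) (t : ℝ) :
    ‖seriesOp q H i t‖ ≤ 2 * (N * M * (i.factorial : ℝ) ^ γ) := by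
  have h1 : HasSum (fun j : ℕ => N * M * (i.factorial : ℝ) ^ γ * (1 / 2 : ℝ) ^ j)
      (N * M * (i.factorial : ℝ) ^ γ * 2) := hasSum_geometric_two.mul_left _
  have := tsum_of_norm_bounded h1 fun j => h.term_le i j t
  unfold seriesOp
  linarith

lemma GevreyPair.hasDerivAt (h : GevreyPair γ M N A B q H) (i : ℕ) (t : ℝ) :
    HasDerivAt (seriesOp q H i) (seriesOp q H (i + 1) t) t := by
  refine hasDerivAt_tsum (summable_geometric_bound γ M N (i + 1)) (fun j s => ?_)
    (fun j s => h.term_le (i + 1) j s) (h.summable i 0) t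
  exact ((h.jet_deriv (j + i) s).ofReal_comp).const_mul (q j)

lemma GevreyPair.continuous (h : GevreyPair γ M N A B q H) (i : ℕ) :
    Continuous (seriesOp q H i) :=
  continuous_iff_continuousAt.2 fun t => (h.hasDerivAt i t).continuousAt

/-- Multiplying the symbol by `1 + a w` amounts to applying `1 + a ∂`. -/
lemma GevreyPair.seriesOp_eq (h : GevreyPair γ M N A B q H) (h' : GevreyPair γ M N A B q' H)
    {a : ℂ} (h0 : q 0 = q' 0) (hs : ∀ j, q (j + 1) = q' (j + 1) + a * q' j) (i : ℕ) (t : ℝ) :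
    seriesOp q H i t = seriesOp q' H i t + a * seriesOp q' H (i + 1) t := by
  unfold seriesOp
  rw [(h.summable i t).tsum_eq_zero_add, (h'.summable i t).tsum_eq_zero_add, h0, add_assoc,
    ← tsum_mul_left, ← Summable.tsum_add]
  · congr 1
    refine tsum_congr fun j => ?_
    rw [hs, show j + (i + 1) = j + 1 + i by ring]
    ring
  · exact (summable_nat_add_iff 1).2 (h'.summable i t)
  · exact (h'.summable (i + 1) t).mul_left a

end SeriesOp

/-! ### Steering a single mode -/

/-- The forcing `g` drives the oscillator `r'' + b r' + c r = g` from the state `(y₀, y₁)` at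
time `0` to rest at time `T`. -/
def Steers {𝕜 : Type*} [RCLike 𝕜] (b c T : ℝ) (g : ℝ → 𝕜) (y₀ y₁ : 𝕜) : Prop :=
  ∃ r v : ℝ → 𝕜, (∀ t, HasDerivAt r (v t) t) ∧
    (∀ t, HasDerivAt v (g t - (b : 𝕜) * v t - (c : 𝕜) * r t) t) ∧ r 0 = y₀ ∧ v 0 = y₁ ∧
    ∀ t, T ≤ t → r t = 0 ∧ v t = 0

section Steers

variable {𝕜 : Type*} [RCLike 𝕜] {b c T : ℝ} {g g' : ℝ → 𝕜} {y₀ y₁ y₀' y₁' : 𝕜}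

lemma Steers.add (h : Steers b c T g y₀ y₁) (h' : Steers b c T g' y₀' y₁') :
    Steers b c T (fun t => g t + g' t) (y₀ + y₀') (y₁ + y₁') := by
  obtain ⟨r, v, h1, h2, h3, h4, h5⟩ := h
  obtain ⟨r', v', h1', h2', h3', h4', h5'⟩ := h'
  refine ⟨fun t => r t + r' t, fun t => v t + v' t, fun t => (h1 t).add (h1' t), fun t => ?_,
    by simp only [h3, h3'], by simp only [h4, h4'], fun t ht => ?_⟩
  · exact ((h2 t).add (h2' t)).congr_deriv (by ring)
  · simp [h5 t ht, h5' t ht]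

lemma Steers.const_mul (h : Steers b c T g y₀ y₁) (a : 𝕜) :
    Steers b c T (fun t => a * g t) (a * y₀) (a * y₁) := by
  obtain ⟨r, v, h1, h2, h3, h4, h5⟩ := h
  refine ⟨fun t => a * r t, fun t => a * v t, fun t => (h1 t).const_mul a, fun t => ?_,
    by simp only [h3], by simp only [h4], fun t ht => ?_⟩
  · exact ((h2 t).const_mul a).congr_deriv (by ring)
  · simp [h5 t ht]

lemma Steers.congr (h : Steers b c T g y₀ y₁) (hg : ∀ t, g' t = g t) (h0 : y₀' = y₀)
    (h1 : y₁' = y₁) : Steers b c T g' y₀' y₁' := by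
  have : g' = g := funext hg
  rw [this, h0, h1]; exact h

lemma Steers.zero : Steers b c T (fun _ => (0 : 𝕜)) 0 0 :=
  ⟨fun _ => 0, fun _ => 0, fun t => hasDerivAt_const t 0, fun t => by
    simpa using hasDerivAt_const t (0 : 𝕜), rfl, rfl, fun t _ => ⟨rfl, rfl⟩⟩

lemma Steers.sum {ι : Type*} (s : Finset ι) {g : ι → ℝ → 𝕜} {y₀ y₁ : ι → 𝕜}
    (h : ∀ i ∈ s, Steers b c T (g i) (y₀ i) (y₁ i)) :
    Steers b c T (fun t => ∑ i ∈ s, g i t) (∑ i ∈ s, y₀ i) (∑ i ∈ s, y₁ i) := by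
  classical
  induction s using Finset.induction_on with
  | empty => simpa using Steers.zero
  | insert i s hi ih =>
    refine ((h i (Finset.mem_insert_self i s)).add
      (ih fun k hk => h k (Finset.mem_insert_of_mem hk))).congr (fun t => ?_) ?_ ?_ <;>
    rw [Finset.sum_insert hi]

lemma Steers.re {g : ℝ → ℂ} {y₀ y₁ : ℂ} (h : Steers b c T g y₀ y₁) :
    Steers b c T (fun t => (g t).re) y₀.re y₁.re := by
  obtain ⟨r, v, h1, h2, h3, h4, h5⟩ := h
  have hre : ∀ {f : ℝ → ℂ} {f' : ℂ} {t : ℝ}, HasDerivAt f f' t →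
      HasDerivAt (fun t => (f t).re) f'.re t := fun {f f' t} hf =>
    (Complex.reCLM.hasFDerivAt.comp_hasDerivAt t hf)
  refine ⟨fun t => (r t).re, fun t => (v t).re, fun t => hre (h1 t), fun t => ?_, by simp only [h3],
    by simp only [h4], fun t ht => by simp [h5 t ht]⟩
  exact (hre (h2 t)).congr_deriv (by simp)

lemma Steers.ofReal {g : ℝ → ℝ} {y₀ y₁ : ℝ} (h : Steers b c T g y₀ y₁) :
    Steers b c T (fun t => (g t : 𝕜)) (y₀ : 𝕜) (y₁ : 𝕜) := by
  obtain ⟨r, v, h1, h2, h3, h4, h5⟩ := h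
  have hre : ∀ {f : ℝ → ℝ} {f' : ℝ} {t : ℝ}, HasDerivAt f f' t →
      HasDerivAt (fun t => (f t : 𝕜)) (f' : 𝕜) t := fun {f f' t} hf =>
    ((RCLike.ofRealCLM (K := 𝕜)).hasFDerivAt.comp_hasDerivAt t hf)
  refine ⟨fun t => (r t : 𝕜), fun t => (v t : 𝕜), fun t => hre (h1 t), fun t => ?_, by simp only [h3],
    by simp only [h4], fun t ht => by simp [h5 t ht]⟩
  exact (hre (h2 t)).congr_deriv (by simp)

/-- In the variables `r = e^{zt} R`, the oscillator with roots `μ, ν` is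
`R'' + (2 z - μ - ν) R' + (z - μ) (z - ν) R`. -/
lemma steers_exp_mul {μ ν z : ℂ} {R₀ R₁ R₂ : ℝ → ℂ} (hsum : μ + ν = -(b : ℂ))
    (hprod : μ * ν = (c : ℂ)) (h0 : ∀ t, HasDerivAt R₀ (R₁ t) t)
    (h1 : ∀ t, HasDerivAt R₁ (R₂ t) t) (hT : ∀ t, T ≤ t → R₀ t = 0 ∧ R₁ t = 0) :
    Steers b c T (fun t => Complex.exp (z * t) *
      (R₂ t + (2 * z - μ - ν) * R₁ t + (z - μ) * (z - ν) * R₀ t)) (R₀ 0) (z * R₀ 0 + R₁ 0) := by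
  have he : ∀ t : ℝ, HasDerivAt (fun t : ℝ => Complex.exp (z * t)) (Complex.exp (z * t) * z) t := by
    intro t
    have h : HasDerivAt (fun t : ℝ => z * (t : ℂ)) z t := by
      simpa using (Complex.ofRealCLM.hasDerivAt (x := t)).const_mul z
    exact h.cexp
  refine ⟨fun t => Complex.exp (z * t) * R₀ t, fun t => Complex.exp (z * t) * (z * R₀ t + R₁ t),
    fun t => ?_, fun t => ?_, by simp, by simp, fun t ht => by simp [hT t ht]⟩
  · exact ((he t).mul (h0 t)).congr_deriv (by ring)
  · refine ((he t).mul (((h0 t).const_mul z).add (h1 t))).congr_deriv ?_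
    have hb : (b : ℂ) = -(μ + ν) := by rw [hsum]; ring
    have hb' : ((b : ℝ) : ℂ) = (RCLike.ofReal b : ℂ) := rfl
    have hc' : ((c : ℝ) : ℂ) = (RCLike.ofReal c : ℂ) := rfl
    rw [← hb', ← hc', hb, ← hprod, Pi.add_apply]
    ring

end Steers


/-! ### Null controls of one mode that do not disturb the others -/

/-- The sequence `p₁ 0, p₂ 0, p₁ 1, p₂ 1, …`. -/
def interleave (p₁ p₂ : ℕ → ℂ) (i : ℕ) : ℂ := if i % 2 = 0 then p₁ (i / 2) else p₂ (i / 2)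

lemma interleave_even (p₁ p₂ : ℕ → ℂ) (k : ℕ) : interleave p₁ p₂ (2 * k) = p₁ k := by
  simp [interleave]

lemma interleave_odd (p₁ p₂ : ℕ → ℂ) (k : ℕ) : interleave p₁ p₂ (2 * k + 1) = p₂ k := by
  have h1 : (2 * k + 1) % 2 = 1 := by omega
  have h2 : (2 * k + 1) / 2 = k := by omega
  simp [interleave, h1, h2]

lemma ProductBound.interleave {γ B₁ B₂ : ℝ} {p₁ p₂ : ℕ → ℂ} (h₁ : ProductBound γ B₁ p₁)
    (h₂ : ProductBound γ B₂ p₂) : ProductBound γ (B₁ * B₂) (interleave p₁ p₂) := by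
  intro j hj N
  set f : ℕ → ℝ := fun i => 1 + (j : ℝ) ^ γ * ‖_root_.interleave p₁ p₂ i‖ with hf
  have hf1 : ∀ i, 1 ≤ f i := fun i => by
    have : 0 ≤ (j : ℝ) ^ γ * ‖_root_.interleave p₁ p₂ i‖ := by positivity
    simp only [hf]; linarith
  have hN : ∏ i ∈ Finset.range (2 * N), f i
      = (∏ k ∈ Finset.range N, f (2 * k)) * ∏ k ∈ Finset.range N, f (2 * k + 1) := by
    induction N with
    | zero => simp
    | succ N ih =>
      rw [show 2 * (N + 1) = 2 * N + 1 + 1 by ring, Finset.prod_range_succ, Finset.prod_range_succ,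
        ih, Finset.prod_range_succ, Finset.prod_range_succ]
      ring
  have hmono : ∏ i ∈ Finset.range N, f i ≤ ∏ i ∈ Finset.range (2 * N), f i := by
    rw [two_mul, Finset.prod_range_add]
    exact le_mul_of_one_le_right (Finset.prod_nonneg fun i _ => zero_le_one.trans (hf1 i))
      (Finset.one_le_prod fun i _ => hf1 (N + i))
  have e1 : ∏ k ∈ Finset.range N, f (2 * k)
      = ∏ k ∈ Finset.range N, (1 + (j : ℝ) ^ γ * ‖p₁ k‖) :=
    Finset.prod_congr rfl fun k _ => by simp only [hf, interleave_even]
  have e2 : ∏ k ∈ Finset.range N, f (2 * k + 1)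
      = ∏ k ∈ Finset.range N, (1 + (j : ℝ) ^ γ * ‖p₂ k‖) :=
    Finset.prod_congr rfl fun k _ => by simp only [hf, interleave_odd]
  refine hmono.trans ?_
  rw [hN, e1, e2, mul_pow]
  have h3 := h₁ j hj N
  exact mul_le_mul h3 (h₂ j hj N) (Finset.prod_nonneg fun k _ => by positivity)
    ((Finset.prod_nonneg fun k _ => by positivity).trans h3)

section ModeControl

variable {γ M A B T b c : ℝ} {H : ℕ → ℝ → ℝ} {q p : ℕ → ℂ} {μ ν z : ℂ}

lemma CutoffJet.const_nonneg (hH : CutoffJet γ M A T H) : 0 ≤ M := by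
  have := (abs_nonneg _).trans (hH.bound 0 0)
  simpa using this

lemma CutoffJet.seriesOp_of_ge (hH : CutoffJet γ M A T H) (i : ℕ) {t : ℝ} (ht : T ≤ t) :
    seriesOp q H i t = 0 := by
  simp [seriesOp, hH.zero _ t ht]

lemma CutoffJet.seriesOp_of_le (hH : CutoffJet γ M A T H) (i : ℕ) {t : ℝ} (ht : t ≤ T / 2) :
    seriesOp q H (i + 1) t = 0 := by
  simp [seriesOp, ← add_assoc, hH.flat _ t ht]

lemma CutoffJet.seriesOp_zero_of_le (hH : CutoffJet γ M A T H) {t : ℝ} (ht : t ≤ T / 2) :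
    seriesOp q H 0 t = q 0 := by
  unfold seriesOp
  rw [tsum_eq_single 0]
  · simp [hH.one t ht]
  · intro j hj
    obtain ⟨i, rfl⟩ := Nat.exists_eq_succ_of_ne_zero hj
    simp [hH.flat i t ht]

/-- Compatibility of the radii of a cut-off and of an infinite product. -/
structure RadiusCondition (γ A B : ℝ) : Prop where
  exponent_nonneg : 0 ≤ γ
  jet_nonneg : 0 ≤ A
  coeff_nonneg : 0 ≤ B
  jet_le : 2 ^ γ * A ≤ 1
  product_le : 2 ^ γ * A * B ≤ 1 / 2

lemma CutoffJet.gevreyPair (hH : CutoffJet γ M A T H) (hR : RadiusCondition γ A B)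
    (hp : ProductBound γ B p) : GevreyPair γ M 1 A B (infProdCoeff p) H :=
  ⟨hR.1, hH.const_nonneg, zero_le_one, hR.jet_nonneg, hR.coeff_nonneg, hR.jet_le,
    hR.product_le,
    fun j => by rw [one_mul]; exact norm_infProdCoeff_le hR.1 hp j, hH.bound, hH.deriv⟩

/-- If both roots of a mode are zeros of the infinite product, the resulting forcing leaves this
mode at rest: the mode responds by the forcing in which its two factors are removed. -/
lemma CutoffJet.steers_other (hH : CutoffJet γ M A T H) (hT : 0 < T) (hR : RadiusCondition γ A B)
    (hp : ProductBound γ B p) (hsum : μ + ν = -(b : ℂ)) (hprod : μ * ν = (c : ℂ)) {k : ℕ}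
    (hμ : p (2 * k) = 1 / (z - μ)) (hν : p (2 * k + 1) = 1 / (z - ν)) (hzμ : z - μ ≠ 0)
    (hzν : z - ν ≠ 0) (i : ℕ) :
    Steers b c T (fun t => Complex.exp (z * t) * seriesOp (infProdCoeff p) H (i + 1) t) 0 0 := by
  set p' := Function.update p (2 * k) 0 with hp'
  set p'' := Function.update p' (2 * k + 1) 0 with hp''
  have hpb' : ProductBound γ B p' := hp.update _
  have hpb'' : ProductBound γ B p'' := hpb'.update _
  have hG := hH.gevreyPair hR hp
  have hG' := hH.gevreyPair hR hpb'
  have hG'' := hH.gevreyPair hR hpb''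
  have hp'ν : p' (2 * k + 1) = 1 / (z - ν) := by
    rw [hp', Function.update_of_ne (by omega), hν]
  have e1 : ∀ i t, seriesOp (infProdCoeff p) H i t = seriesOp (infProdCoeff p') H i t
      + 1 / (z - μ) * seriesOp (infProdCoeff p') H (i + 1) t := fun i t =>
    hG.seriesOp_eq hG' (by rw [infProdCoeff_zero hR.1 hp, infProdCoeff_zero hR.1 hpb'])
      (fun j => by rw [infProdCoeff_succ_eq hR.1 hp (2 * k), hμ]) i t
  have e2 : ∀ i t, seriesOp (infProdCoeff p') H i t = seriesOp (infProdCoeff p'') H i t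
      + 1 / (z - ν) * seriesOp (infProdCoeff p'') H (i + 1) t := fun i t =>
    hG'.seriesOp_eq hG'' (by rw [infProdCoeff_zero hR.1 hpb', infProdCoeff_zero hR.1 hpb''])
      (fun j => by rw [infProdCoeff_succ_eq hR.1 hpb' (2 * k + 1), hp'ν]) i t
  have h := (steers_exp_mul (T := T) (z := z) hsum hprod (hG''.hasDerivAt (i + 1))
    (hG''.hasDerivAt (i + 1 + 1)) fun t ht => ⟨hH.seriesOp_of_ge _ ht,
      hH.seriesOp_of_ge _ ht⟩).const_mul ((z - μ)⁻¹ * (z - ν)⁻¹)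
  have h0 : (0 : ℝ) ≤ T / 2 := by linarith
  refine h.congr (fun t => ?_) ?_ ?_
  · rw [e1, e2, e2]
    field_simp
    ring
  · rw [hH.seriesOp_of_le i h0, mul_zero]
  · rw [hH.seriesOp_of_le i h0, hH.seriesOp_of_le (i + 1) h0]; ring

/-- The forcing that carries `e^{μt} H` through the oscillator with roots `μ` and `ν`. -/
lemma CutoffJet.steers_own (hH : CutoffJet γ M A T H) (hT : 0 < T) (hR : RadiusCondition γ A B)
    (hp : ProductBound γ B p) (hsum : μ + ν = -(b : ℂ)) (hprod : μ * ν = (c : ℂ)) :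
    Steers b c T (fun t => Complex.exp (μ * t) * seriesOp (infProdCoeff p) H 2 t
      + (μ - ν) * (Complex.exp (μ * t) * seriesOp (infProdCoeff p) H 1 t)) 1 μ := by
  have hG := hH.gevreyPair hR hp
  have h := steers_exp_mul (T := T) (z := μ) hsum hprod (hG.hasDerivAt 0) (hG.hasDerivAt 1)
    fun t ht => ⟨hH.seriesOp_of_ge _ ht, hH.seriesOp_of_ge _ ht⟩
  have h0 : (0 : ℝ) ≤ T / 2 := by linarith
  refine h.congr (fun t => by ring) ?_ ?_
  · rw [hH.seriesOp_zero_of_le h0, infProdCoeff_zero hR.1 hp]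
  · rw [hH.seriesOp_zero_of_le h0, infProdCoeff_zero hR.1 hp, hH.seriesOp_of_le 0 h0]; ring

/-- The second forcing for a mode with a double root: it carries `e^{μt}` times an antiderivative
of `H`, which is affine in `t` before `T / 2`. -/
lemma CutoffJet.steers_own_double (hH : CutoffJet γ M A T H) (hT : 0 < T) (hT1 : T ≤ 1)
    (hR : RadiusCondition γ A B) (hp : ProductBound γ B p)
    (hsum : μ + μ = -(b : ℂ)) (hprod : μ * μ = (c : ℂ)) :
    ∃ σ : ℂ, ‖σ‖ ≤ 1 + B ∧
      Steers b c T (fun t => Complex.exp (μ * t) * seriesOp (infProdCoeff p) H 1 t) σ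
        (μ * σ + 1) := by
  have hγ := hR.1
  set q : ℕ → ℂ := infProdCoeff p with hq
  have hqle := norm_infProdCoeff_le hγ hp
  set qs : ℕ → ℂ := fun j => q (j + 1) with hqs
  have hG := hH.gevreyPair hR hp
  have hGs : GevreyPair γ M B A B qs H := by
    refine ⟨hR.1, hH.const_nonneg, hR.coeff_nonneg, hR.jet_nonneg, hR.coeff_nonneg, hR.jet_le,
    hR.product_le, fun j => ?_, hH.bound, hH.deriv⟩
    refine (hqle (j + 1)).trans ?_
    rw [pow_succ, mul_comm (B ^ j), mul_div_assoc]
    have hB := hR.coeff_nonneg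
    have h1 : ((j.factorial : ℝ)) ^ γ ≤ ((j + 1).factorial : ℝ) ^ γ :=
      Real.rpow_le_rpow (by positivity) (by exact_mod_cast Nat.factorial_le (Nat.le_succ j)) hγ
    gcongr
  have hHc : Continuous (H 0) := continuous_iff_continuousAt.2 fun t => (hH.deriv 0 t).continuousAt
  set G : ℝ → ℝ := fun t => ∫ s in T..t, H 0 s with hGdef
  have hGd : ∀ t, HasDerivAt G (H 0 t) t := fun t =>
    (hHc.integral_hasStrictDerivAt T t).hasDerivAt
  have hG0 : ∀ t, T ≤ t → G t = 0 := fun t ht => by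
    simp only [hGdef]
    rw [intervalIntegral.integral_congr (g := fun _ => (0 : ℝ)) fun s hs => ?_]
    · simp
    · rw [uIcc_of_le ht] at hs
      exact hH.zero 0 s hs.1
  have h0 : (0 : ℝ) ≤ T / 2 := by linarith
  have hq0 : q 0 = 1 := infProdCoeff_zero hγ hp
  -- `R₀` is `∑ j, q j H (j - 1)` with `H (-1) = G`
  have hR0 : ∀ t, HasDerivAt (fun t => (G t : ℂ) + seriesOp qs H 0 t) (seriesOp q H 0 t) t := by
    intro t
    refine ((hGd t).ofReal_comp.add (hGs.hasDerivAt 0 t)).congr_deriv ?_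
    have := (hG.summable 0 t).tsum_eq_zero_add
    unfold seriesOp
    rw [this, infProdCoeff_zero hγ hp, one_mul]
  have h := steers_exp_mul (T := T) (z := μ) hsum hprod hR0 (hG.hasDerivAt 0)
    fun t ht => ⟨by rw [hG0 t ht, hGs.seriesOp_eq hGs (a := 0) rfl (by simp),
      hH.seriesOp_of_ge 0 ht, hH.seriesOp_of_ge 1 ht]; simp, hH.seriesOp_of_ge _ ht⟩
  refine ⟨_, ?_, h.congr (fun t => by ring) rfl ?_⟩
  · refine (norm_add_le _ _).trans (add_le_add ?_ ?_)
    · rw [Complex.norm_real]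
      have := intervalIntegral.norm_integral_le_of_norm_le_const (a := T) (b := 0) (C := 1)
        (f := H 0) fun s _ => hH.le_one s
      refine this.trans ?_
      rw [zero_sub, abs_neg, abs_of_pos hT]
      linarith
    · rw [hH.seriesOp_zero_of_le h0]
      simpa [hqs] using hqle 1
  · rw [hH.seriesOp_zero_of_le (q := q) h0, hq0]

/-- The function vanishes before `T / 2`, so that the exponential contributes its value there. -/
lemma CutoffJet.norm_exp_mul_seriesOp_le (hH : CutoffJet γ M A T H) (hR : RadiusCondition γ A B)
    (hγ2 : γ ≤ 2) (hp : ProductBound γ B p) (hz : z.re ≤ 0) {i : ℕ} (hi : i + 1 ≤ 2) (t : ℝ) :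
    ‖Complex.exp (z * t) * seriesOp (infProdCoeff p) H (i + 1) t‖
      ≤ Real.exp (T / 2 * z.re) * (8 * M) := by
  have hM := hH.const_nonneg
  rcases le_or_gt t (T / 2) with ht | ht
  · rw [hH.seriesOp_of_le i ht, mul_zero, norm_zero]
    positivity
  rw [norm_mul, Complex.norm_exp]
  refine mul_le_mul ?_ ?_ (norm_nonneg _) (Real.exp_pos _).le
  · refine Real.exp_le_exp.2 ?_
    have : (z * (t : ℂ)).re = t * z.re := by simp [mul_comm]
    rw [this]
    exact mul_le_mul_of_nonpos_right ht.le hz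
  · refine ((hH.gevreyPair hR hp).norm_seriesOp_le (i + 1) t).trans ?_
    have h1 : ((i + 1).factorial : ℝ) ≤ 2 := by
      exact_mod_cast (Nat.factorial_le hi)
    have h2 : ((i + 1).factorial : ℝ) ^ γ ≤ 2 ^ (2 : ℝ) := by
      refine (Real.rpow_le_rpow (by positivity) h1 hR.1).trans ?_
      exact Real.rpow_le_rpow_of_exponent_le (by norm_num) hγ2
    have h3 : (2 : ℝ) ^ (2 : ℝ) = 4 := by norm_num
    rw [h3] at h2
    nlinarith

end ModeControl

section ExistsModeControls

variable {α ρ : ℝ}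

/-- Two different modes `n`, `k`, some root of the one being closer than `δ` to some root of the
other. -/
def AreNear (α ρ δ : ℝ) (n k : ℕ) : Prop :=
  1 ≤ n ∧ 1 ≤ k ∧ k ≠ n ∧ (‖slowRoot α ρ n - slowRoot α ρ k‖ < δ ∨
    ‖slowRoot α ρ n - fastRoot α ρ k‖ < δ ∨ ‖fastRoot α ρ n - slowRoot α ρ k‖ < δ ∨
    ‖fastRoot α ρ n - fastRoot α ρ k‖ < δ)

lemma AreNear.symm {δ : ℝ} {n k : ℕ} (h : AreNear α ρ δ n k) : AreNear α ρ δ k n := by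
  obtain ⟨h1, h2, h3, h4⟩ := h
  refine ⟨h2, h1, h3.symm, ?_⟩
  simp only [norm_sub_rev (slowRoot α ρ k), norm_sub_rev (fastRoot α ρ k)]
  tauto

/-- Since each branch of the roots is separated, only boundedly many modes are near a given one. -/
lemma RootBounds.finite_near {c δ C : ℝ} {R : ℕ} (h : RootBounds α ρ c δ C R)
    (hγ' : 0 < rootExponent α) (hc : 0 < c) (n : ℕ) : ∃ s : Finset ℕ, (∀ k, k ∈ s ↔ AreNear α ρ (c / 2) n k) ∧ s.card ≤ R + 4 := by
  classical
  have key : ∀ (κ : ℕ → ℂ) (γ : ℝ), 0 < γ → (∀ k l : ℕ, R ≤ k → R ≤ l →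
      c * |(k : ℝ) - l| ^ γ ≤ ‖κ k - κ l‖) → ∀ z : ℂ, ∃ m : ℕ, ∀ k, R ≤ k →
      ‖z - κ k‖ < c / 2 → k = m := by
    intro κ γ hγ hκ z
    by_cases hex : ∃ m, R ≤ m ∧ ‖z - κ m‖ < c / 2
    · obtain ⟨m, hm, hzm⟩ := hex
      refine ⟨m, fun k hk hzk => ?_⟩
      by_contra hkm
      have h1 := hκ k m hk hm
      have h2 : (1 : ℝ) ≤ |(k : ℝ) - m| := by
        have h3 : (1 : ℤ) ≤ |(k : ℤ) - m| := Int.one_le_abs (by omega)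
        exact_mod_cast h3
      have h3 : 1 ≤ |(k : ℝ) - m| ^ γ := Real.one_le_rpow h2 hγ.le
      have h4 : ‖κ k - κ m‖ ≤ ‖z - κ m‖ + ‖z - κ k‖ := by
        rw [show κ k - κ m = (z - κ m) - (z - κ k) by ring]
        exact norm_sub_le _ _
      nlinarith
    · push Not at hex
      exact ⟨0, fun k hk hzk => absurd (hex k hk) (not_le.2 hzk)⟩
  obtain ⟨m₁, h₁⟩ := key _ _ hγ' h.slow_sep (slowRoot α ρ n)
  obtain ⟨m₂, h₂⟩ := key _ _ hγ' h.fast_sep (slowRoot α ρ n)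
  obtain ⟨m₃, h₃⟩ := key _ _ hγ' h.slow_sep (fastRoot α ρ n)
  obtain ⟨m₄, h₄⟩ := key _ _ hγ' h.fast_sep (fastRoot α ρ n)
  have hsub : {k | AreNear α ρ (c / 2) n k} ⊆ ((Finset.range R ∪ {m₁, m₂, m₃, m₄} : Finset ℕ) : Set ℕ) := by
    intro k hk
    obtain ⟨-, -, -, hk⟩ := hk
    rw [Finset.mem_coe, Finset.mem_union, Finset.mem_range]
    rcases lt_or_ge k R with hkR | hkR
    · exact Or.inl hkR
    · right
      simp only [Finset.mem_insert, Finset.mem_singleton]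
      rcases hk with hk | hk | hk | hk
      · exact Or.inl (h₁ k hkR hk)
      · exact Or.inr (Or.inl (h₂ k hkR hk))
      · exact Or.inr (Or.inr (Or.inl (h₃ k hkR hk)))
      · exact Or.inr (Or.inr (Or.inr (h₄ k hkR hk)))
  have hfin : {k | AreNear α ρ (c / 2) n k}.Finite := (Finset.finite_toSet _).subset hsub
  refine ⟨hfin.toFinset, fun k => by simp, ?_⟩
  refine (Finset.card_le_card (t := Finset.range R ∪ {m₁, m₂, m₃, m₄}) fun k hk => ?_).trans ?_
  · exact hsub (by simpa using hk)
  · refine (Finset.card_union_le _ _).trans ?_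
    rw [Finset.card_range]
    exact Nat.add_le_add_left Finset.card_le_four _

lemma amplitude_le {C N Y₀ Y₁ T a ν e : ℝ} (hC : 0 ≤ C) (hN : 0 ≤ N) (hY₀ : 0 ≤ Y₀)
    (hY₁ : 0 ≤ Y₁) (hT : 0 < T) (hT1 : T ≤ 1) (he : 0 ≤ e) (he1 : e ≤ 1) (ha : a ≤ Y₁ + ν * Y₀)
    (hν : ν * e ≤ C * N / (T / 2)) : a * e ≤ (1 + 2 * C) * (N * Y₀ + Y₁) / T := by
  have h1 : a * e ≤ Y₁ + C * N / (T / 2) * Y₀ := by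
    have h2 := mul_le_mul_of_nonneg_right ha he
    have h3 := mul_le_mul_of_nonneg_right hν hY₀
    have h4 := mul_le_mul_of_nonneg_left he1 hY₁
    linarith
  refine h1.trans ?_
  rw [le_div_iff₀ hT]
  have h5 : (Y₁ + C * N / (T / 2) * Y₀) * T = Y₁ * T + 2 * (C * (N * Y₀)) := by field_simp
  have h6 := mul_le_mul_of_nonneg_left hT1 hY₁
  have h7 : 0 ≤ N * Y₀ := mul_nonneg hN hY₀
  have h8 : 0 ≤ C * Y₁ := mul_nonneg hC hY₁
  rw [h5]; linarith

set_option maxHeartbeats 1000000 in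
/-- Every mode has a control that brings it to rest at time `T` and leaves all modes outside `near n`
at rest. It is the real part of a combination of the functions `e^{zt} P(∂) H'`, `e^{zt} P(∂) H''`, where
`z` is a root of mode `n`, `H` a cut-off, and `P` the infinite product over the roots of the other
modes, those near `n` left out. -/
lemma exists_mode_controls (hρ : 0 < ρ) (hα : α < 3 / 2) :
    ∃ κ C : ℝ, ∃ M : ℕ, ∃ near : ℕ → Finset ℕ, 0 < κ ∧ 0 < C ∧
      (∀ n k, k ∈ near n ↔ n ∈ near k) ∧ (∀ n, n ∉ near n) ∧ (∀ n, (near n).card ≤ M) ∧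
      (∀ n, 0 ∉ near n) ∧
      ∀ T : ℝ, 0 < T → T ≤ 1 → ∀ n : ℕ, 1 ≤ n → ∀ y₀ y₁ : ℝ, ∃ g : ℝ → ℝ, Continuous g ∧
        (∀ t, T ≤ t → g t = 0) ∧
        (∀ t, |g t| ≤ C * Real.exp (κ / T ^ (1 / (rootExponent α - 1))) *
          ((n : ℝ) ^ 2 * |y₀| + |y₁|)) ∧
        ∀ k, 1 ≤ k → k ∉ near n → Steers (modeDamping α ρ k) ((k : ℝ) ^ 4) T g
          (if k = n then y₀ else 0) (if k = n then y₁ else 0) := by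
  obtain ⟨c, δ, C, R, hc, hδ, hC, hroots⟩ := exists_rootBounds hρ hα
  set γ := rootExponent α with hγdef
  have hγ1 : 1 < γ := one_lt_rootExponent hα
  have hγ2 : γ ≤ 2 := rootExponent_le_two
  have hexp : 0 < γ - 1 := by linarith
  obtain ⟨B, hB, hprodB⟩ := exists_productBound hγ1 hc (half_pos hc) R
  obtain ⟨near, hnear⟩ : ∃ near : ℕ → Finset ℕ, ∀ n, (∀ k, k ∈ near n ↔ AreNear α ρ (c / 2) n k) ∧
      (near n).card ≤ R + 4 := ⟨_, fun n => (hroots.finite_near (by linarith) hc n).choose_spec⟩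
  have hmem : ∀ n k, k ∈ near n ↔ AreNear α ρ (c / 2) n k := fun n => (hnear n).1
  set A : ℝ := 1 / (2 * 2 ^ γ * (1 + B * B)) with hA
  have hApos : 0 < A := by positivity
  have hrad : RadiusCondition γ A (B * B) := by
    have h1 : 2 ^ γ * A = 1 / (2 * (1 + B * B)) := by rw [hA]; field_simp
    refine ⟨by linarith, hApos.le, by positivity, ?_, ?_⟩
    · rw [h1, div_le_one (by positivity)]; nlinarith
    · rw [h1, div_mul_eq_mul_div, div_le_div_iff₀ (by positivity) (by positivity)]; nlinarith
  obtain ⟨κ, hκ, hcut⟩ := exists_gevrey_cutoff hγ1 hApos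
  refine ⟨κ + 1, 16 * (1 + 2 * C) * (1 / δ + 1) + 8 * (4 + B * B) * (1 + 2 * C), R + 4, near,
    by linarith, by positivity, fun n k => ?_, fun n => ?_, fun n => (hnear n).2, fun n => ?_, ?_⟩
  · rw [hmem, hmem]; exact ⟨AreNear.symm, AreNear.symm⟩
  · rw [hmem]; exact fun h => h.2.2.1 rfl
  · rw [hmem]; exact fun h => absurd h.2.1 (by norm_num)
  intro T hT hT1 n hn y₀ y₁
  obtain ⟨H, hH⟩ := hcut T hT hT1
  set M : ℝ := Real.exp (κ / T ^ (1 / (γ - 1))) with hM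
  have hMpos : 0 < M := Real.exp_pos _
  -- the zeros of the infinite product based at `z`: the roots of all modes that are not near `n`
  set P : ℂ → ℕ → ℂ := fun z => interleave
    (fun k => if 1 ≤ k ∧ k ≠ n ∧ k ∉ near n then 1 / (z - slowRoot α ρ k) else 0)
    (fun k => if 1 ≤ k ∧ k ≠ n ∧ k ∉ near n then 1 / (z - fastRoot α ρ k) else 0) with hP
  set E : ℂ → ℕ → ℝ → ℂ := fun z i t =>
    Complex.exp (z * t) * seriesOp (infProdCoeff (P z)) H i t with hE
  have hfar : ∀ z, z = slowRoot α ρ n ∨ z = fastRoot α ρ n → ∀ k, 1 ≤ k → k ≠ n → k ∉ near n →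
      c / 2 ≤ ‖z - slowRoot α ρ k‖ ∧ c / 2 ≤ ‖z - fastRoot α ρ k‖ := by
    intro z hz k hk hkn hkm
    rw [hmem] at hkm
    constructor <;> by_contra hlt <;> rw [not_le] at hlt <;> refine hkm ⟨hn, hk, hkn, ?_⟩ <;>
    rcases hz with rfl | rfl <;> tauto
  have hPb : ∀ z, z = slowRoot α ρ n ∨ z = fastRoot α ρ n → ProductBound γ (B * B) (P z) := by
    intro z hz
    refine ProductBound.interleave (hprodB _ hroots.slow_sep z _ fun k => ?_)
      (hprodB _ hroots.fast_sep z _ fun k => ?_)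
    · by_cases h : 1 ≤ k ∧ k ≠ n ∧ k ∉ near n
      · exact Or.inr ⟨if_pos h, (hfar z hz k h.1 h.2.1 h.2.2).1⟩
      · exact Or.inl (if_neg h)
    · by_cases h : 1 ≤ k ∧ k ≠ n ∧ k ∉ near n
      · exact Or.inr ⟨if_pos h, (hfar z hz k h.1 h.2.1 h.2.2).2⟩
      · exact Or.inl (if_neg h)
  have hsum : ∀ k, slowRoot α ρ k + fastRoot α ρ k = -((modeDamping α ρ k : ℝ) : ℂ) :=
    slowRoot_add_fastRoot
  have hprod : ∀ k, slowRoot α ρ k * fastRoot α ρ k = (((k : ℝ) ^ 4 : ℝ) : ℂ) := fun k => by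
    rw [slowRoot_mul_fastRoot]; push_cast; rfl
  have hother : ∀ z, z = slowRoot α ρ n ∨ z = fastRoot α ρ n → ∀ k, 1 ≤ k → k ≠ n → k ∉ near n →
      ∀ i, Steers (modeDamping α ρ k) ((k : ℝ) ^ 4) T (E z (i + 1)) 0 0 := by
    intro z hz k hk hkn hkm i
    have h := hfar z hz k hk hkn hkm
    exact hH.steers_other hT hrad (hPb z hz) (hsum k) (hprod k) (k := k)
      (by simp only [hP]; rw [interleave_even, if_pos ⟨hk, hkn, hkm⟩])
      (by simp only [hP]; rw [interleave_odd, if_pos ⟨hk, hkn, hkm⟩])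
      (norm_pos_iff.1 (by linarith [h.1])) (norm_pos_iff.1 (by linarith [h.2])) i
  have hEc : ∀ z, z = slowRoot α ρ n ∨ z = fastRoot α ρ n → ∀ i, Continuous (E z i) := by
    intro z hz i
    exact (Complex.continuous_exp.comp (continuous_const.mul Complex.continuous_ofReal)).mul
      ((hH.gevreyPair hrad (hPb z hz)).continuous i)
  have hE0 : ∀ z i t, T ≤ t → E z i t = 0 := fun z i t ht => by
    simp only [hE]; rw [hH.seriesOp_of_ge i ht, mul_zero]
  have hEb : ∀ z, z = slowRoot α ρ n ∨ z = fastRoot α ρ n → ∀ i, i + 1 ≤ 2 → ∀ t,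
      ‖E z (i + 1) t‖ ≤ Real.exp (T / 2 * z.re) * (8 * M) := by
    intro z hz i hi t
    refine hH.norm_exp_mul_seriesOp_le hrad hγ2 (hPb z hz) ?_ hi t
    rcases hz with rfl | rfl
    · exact re_slowRoot_nonpos hρ n
    · exact re_fastRoot_nonpos hρ n
  -- it suffices to find a complex control with the bound `C' M / T`
  have hreduce : ∀ C' : ℝ, C' ≤ 16 * (1 + 2 * C) * (1 / δ + 1) + 8 * (4 + B * B) * (1 + 2 * C) →
      ∀ g : ℝ → ℂ, Continuous g → (∀ t, T ≤ t → g t = 0) →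
      (∀ t, ‖g t‖ ≤ C' * (M / T) * ((n : ℝ) ^ 2 * |y₀| + |y₁|)) →
      (∀ k, 1 ≤ k → k ≠ n → k ∉ near n →
        Steers (modeDamping α ρ k) ((k : ℝ) ^ 4) T g 0 0) →
      Steers (modeDamping α ρ n) ((n : ℝ) ^ 4) T g (y₀ : ℂ) (y₁ : ℂ) →
      ∃ g : ℝ → ℝ, Continuous g ∧ (∀ t, T ≤ t → g t = 0) ∧
        (∀ t, |g t| ≤ (16 * (1 + 2 * C) * (1 / δ + 1) + 8 * (4 + B * B) * (1 + 2 * C)) *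
          Real.exp ((κ + 1) / T ^ (1 / (γ - 1))) * ((n : ℝ) ^ 2 * |y₀| + |y₁|)) ∧
        ∀ k, 1 ≤ k → k ∉ near n → Steers (modeDamping α ρ k) ((k : ℝ) ^ 4) T g
          (if k = n then y₀ else 0) (if k = n then y₁ else 0) := by
    intro C' hC' g hgc hg0 hgb hgo hgn
    refine ⟨fun t => (g t).re, Complex.continuous_re.comp hgc, fun t ht => by simp [hg0 t ht],
      fun t => ?_, fun k hk hkm => ?_⟩
    · refine (Complex.abs_re_le_norm _).trans ((hgb t).trans ?_)
      have h1 : M / T ≤ Real.exp ((κ + 1) / T ^ (1 / (γ - 1))) := by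
        rw [add_div, Real.exp_add, ← hM, div_eq_mul_one_div]
        refine mul_le_mul_of_nonneg_left ?_ hMpos.le
        have h2 : T ^ (1 / (γ - 1)) ≤ T := by
          have h3 := Real.rpow_le_rpow_of_exponent_ge hT hT1
            (show (1 : ℝ) ≤ 1 / (γ - 1) by rw [le_div_iff₀ hexp]; linarith)
          rwa [Real.rpow_one] at h3
        have h4 : 1 / T ≤ 1 / T ^ (1 / (γ - 1)) :=
          one_div_le_one_div_of_le (by positivity) h2
        linarith [Real.add_one_le_exp (1 / T ^ (1 / (γ - 1)))]
      have h5 : 0 ≤ M / T := by positivity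
      gcongr
    · rcases eq_or_ne k n with rfl | hkn
      · rw [if_pos rfl, if_pos rfl]
        simpa using hgn.re
      · rw [if_neg hkn, if_neg hkn]
        simpa using (hgo k hk hkn hkm).re
  have hn1 : (1 : ℝ) ≤ (n : ℝ) ^ 2 := one_le_pow₀ (by exact_mod_cast hn)
  set W : ℝ := (n : ℝ) ^ 2 * |y₀| + |y₁| with hW
  have hy₀ : 0 ≤ |y₀| := abs_nonneg _
  have hy₁ : 0 ≤ |y₁| := abs_nonneg _
  have hy₀W : |y₀| ≤ W := by
    have := mul_le_mul_of_nonneg_right hn1 hy₀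
    linarith
  have hW0 : 0 ≤ W := by linarith
  set F : ℝ := (1 + 2 * C) * W / T with hF
  have hWF : W ≤ F := by
    rw [hF, le_div_iff₀ hT]
    have h1 := mul_le_mul_of_nonneg_left hT1 hW0
    have h2 := mul_nonneg hC.le hW0
    linarith
  have hF0 : 0 ≤ F := hW0.trans hWF
  have hexpslow : Real.exp (T / 2 * (slowRoot α ρ n).re) ≤ 1 := Real.exp_le_one_iff.2
    (mul_nonpos_of_nonneg_of_nonpos (by linarith) (re_slowRoot_nonpos hρ n))
  -- the two amplitudes
  have hfastF : ‖(y₁ : ℂ) - fastRoot α ρ n * y₀‖ * Real.exp (T / 2 * (slowRoot α ρ n).re) ≤ F := by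
    refine amplitude_le hC.le (by positivity) hy₀ hy₁ hT hT1 (Real.exp_pos _).le hexpslow ?_
      (hroots.fast_le n hn (T / 2) (by linarith) (by linarith))
    refine (norm_sub_le _ _).trans ?_
    rw [norm_mul, Complex.norm_real, Complex.norm_real, Real.norm_eq_abs, Real.norm_eq_abs]
  have hslowF : ‖(y₁ : ℂ) - slowRoot α ρ n * y₀‖ ≤ F := by
    have h := amplitude_le (a := ‖(y₁ : ℂ) - slowRoot α ρ n * y₀‖) (ν := ‖slowRoot α ρ n‖) hC.le
      (show (0 : ℝ) ≤ (n : ℝ) ^ 2 by positivity) hy₀ hy₁ hT hT1 zero_le_one le_rfl (by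
        refine (norm_sub_le _ _).trans ?_
        rw [norm_mul, Complex.norm_real, Complex.norm_real, Real.norm_eq_abs, Real.norm_eq_abs]) (by
        rw [mul_one]
        refine (hroots.slow_le n hn).trans ?_
        rw [le_div_iff₀ (by linarith)]
        exact mul_le_of_le_one_right (by positivity) (by linarith))
    rwa [mul_one] at h
  have hexpfast : Real.exp (T / 2 * (fastRoot α ρ n).re) ≤ 1 := Real.exp_le_one_iff.2
    (mul_nonpos_of_nonneg_of_nonpos (by linarith) (re_fastRoot_nonpos hρ n))
  set μ := slowRoot α ρ n with hμ
  set ν := fastRoot α ρ n with hν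
  have hPμ := hPb μ (Or.inl rfl)
  have hPν := hPb ν (Or.inr rfl)
  have hownμ := hH.steers_own hT hrad hPμ (hsum n) (hprod n)
  rcases hroots.disc n hn with hd | hd
  · -- double root: the solution `t e^{μt}` is reached by `steers_own_double`, which also moves the
    -- amplitude of `e^{μt}` by `c₁ * σ`
    have hμν : μ = ν := sub_eq_zero.1 (by rw [hμ, hν, slowRoot_sub_fastRoot, hd])
    obtain ⟨σ, hσ, hdbl⟩ := hH.steers_own_double hT hT1 hrad hPμ
      (by have := hsum n; rwa [← hν, ← hμν] at this) (by have := hprod n; rwa [← hν, ← hμν] at this)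
    set c₁ : ℂ := (y₁ : ℂ) - μ * y₀ with hc₁
    set c₀ : ℂ := (y₀ : ℂ) - c₁ * σ with hc₀
    have hc₀F : ‖c₀‖ ≤ (2 + B * B) * F := by
      have h1 : ‖c₀‖ ≤ |y₀| + ‖c₁‖ * ‖σ‖ := by
        refine (norm_sub_le _ _).trans ?_
        rw [norm_mul, Complex.norm_real, Real.norm_eq_abs]
      have h2 : ‖c₁‖ * ‖σ‖ ≤ F * (1 + B * B) := mul_le_mul hslowF hσ (norm_nonneg _) hF0
      linarith
    refine hreduce (8 * (4 + B * B) * (1 + 2 * C)) (le_add_of_nonneg_left (by positivity))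
      (fun t => c₀ * E μ 2 t + c₁ * E μ 1 t)
      (((hEc μ (Or.inl rfl) 2).const_smul c₀).add ((hEc μ (Or.inl rfl) 1).const_smul c₁))
      (fun t ht => by simp [hE0 μ _ t ht]) (fun t => ?_) (fun k hk hkn hkm => ?_) ?_
    · have h1 := (hEb μ (Or.inl rfl) 1 le_rfl t).trans (mul_le_of_le_one_left (by positivity) hexpslow)
      have h2 := (hEb μ (Or.inl rfl) 0 (by norm_num) t).trans
        (mul_le_of_le_one_left (by positivity) hexpslow)
      have h3 := norm_add_le (c₀ * E μ 2 t) (c₁ * E μ 1 t)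
      rw [norm_mul c₀, norm_mul c₁] at h3
      have h4 : ‖c₀‖ * ‖E μ 2 t‖ ≤ (2 + B * B) * F * (8 * M) :=
        mul_le_mul hc₀F h1 (norm_nonneg _) (by positivity)
      have h5 : ‖c₁‖ * ‖E μ 1 t‖ ≤ F * (8 * M) := mul_le_mul hslowF h2 (norm_nonneg _) hF0
      have h6 : 8 * (4 + B * B) * (1 + 2 * C) * (M / T) * W = (4 + B * B) * F * (8 * M) := by
        rw [hF]; ring
      rw [h6]
      have h7 : 0 ≤ F * (8 * M) := by positivity
      nlinarith
    · refine (((hother μ (Or.inl rfl) k hk hkn hkm 1).const_mul c₀).add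
        ((hother μ (Or.inl rfl) k hk hkn hkm 0).const_mul c₁)).congr (fun t => rfl) ?_ ?_ <;> simp
    · refine ((hownμ.const_mul c₀).add (hdbl.const_mul c₁)).congr (fun t => ?_) ?_ ?_
      · have e : slowRoot α ρ n - fastRoot α ρ n = 0 := by rw [slowRoot_sub_fastRoot, hd]
        simp only [hE, e, hμ]
        ring
      · rw [hc₀]; ring
      · rw [hc₀, hc₁]; ring
  · -- distinct roots: the initial data are split along `e^{μt}` and `e^{νt}`; the size of `ν` in the
    -- amplitude `a` is absorbed by the decay of `e^{μt}` up to the time `T / 2`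
    have hownν := hH.steers_own hT hrad hPν (by rw [add_comm]; exact hsum n)
      (by rw [mul_comm]; exact hprod n)
    set ε := μ - ν with hε
    have hεδ : δ ≤ ‖ε‖ := by rw [hε, hμ, hν, slowRoot_sub_fastRoot]; exact hd
    have hε0 : ε ≠ 0 := norm_pos_iff.1 (by linarith)
    set a : ℂ := ((y₁ : ℂ) - ν * y₀) / ε with ha
    set b : ℂ := -((y₁ : ℂ) - μ * y₀) / ε with hb
    have hterm : ∀ (x e₂ e₁ : ℂ) (X ex : ℝ), ‖x‖ * ex ≤ X → 0 ≤ ex → ‖e₂‖ ≤ ex * (8 * M) →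
        ‖e₁‖ ≤ ex * (8 * M) → ∀ ε' : ℂ, ‖ε'‖ = ‖ε‖ →
        ‖x / ε * (e₂ + ε' * e₁)‖ ≤ X * (8 * M) * (1 / δ + 1) := by
      intro x e₂ e₁ X ex hX hex he₂ he₁ ε' hε'
      have hεp : 0 < ‖ε‖ := by linarith
      have h1 : ‖e₂ + ε' * e₁‖ ≤ ex * (8 * M) * (1 + ‖ε‖) := by
        refine (norm_add_le _ _).trans ?_
        rw [norm_mul, hε']
        nlinarith
      have h3 : (1 + ‖ε‖) / ‖ε‖ ≤ 1 / δ + 1 := by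
        rw [add_div, div_self hεp.ne']
        have := one_div_le_one_div_of_le hδ hεδ
        linarith
      have hX0 : 0 ≤ X := (mul_nonneg (norm_nonneg x) hex).trans hX
      calc ‖x / ε * (e₂ + ε' * e₁)‖ = ‖x‖ / ‖ε‖ * ‖e₂ + ε' * e₁‖ := by rw [norm_mul, norm_div]
        _ ≤ ‖x‖ / ‖ε‖ * (ex * (8 * M) * (1 + ‖ε‖)) := by gcongr
        _ = ‖x‖ * ex * (8 * M) * ((1 + ‖ε‖) / ‖ε‖) := by ring
        _ ≤ X * (8 * M) * (1 / δ + 1) := by gcongr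
    refine hreduce (16 * (1 + 2 * C) * (1 / δ + 1)) (le_add_of_nonneg_right (by positivity))
      (fun t => a * (E μ 2 t + ε * E μ 1 t) + b * (E ν 2 t + (-ε) * E ν 1 t))
      ((((hEc μ (Or.inl rfl) 2).add ((hEc μ (Or.inl rfl) 1).const_smul ε)).const_smul a).add
        (((hEc ν (Or.inr rfl) 2).add ((hEc ν (Or.inr rfl) 1).const_smul (-ε))).const_smul b))
      (fun t ht => by simp [hE0 _ _ t ht]) (fun t => ?_) (fun k hk hkn hkm => ?_) ?_
    · have h1 := hterm ((y₁ : ℂ) - ν * y₀) (E μ 2 t) (E μ 1 t) F _ hfastF (Real.exp_pos _).le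
        (hEb μ (Or.inl rfl) 1 le_rfl t) (hEb μ (Or.inl rfl) 0 (by norm_num) t) ε rfl
      have h2 := hterm (-((y₁ : ℂ) - μ * y₀)) (E ν 2 t) (E ν 1 t) F 1
        (by rw [norm_neg, mul_one]; exact hslowF) zero_le_one
        ((hEb ν (Or.inr rfl) 1 le_rfl t).trans (mul_le_mul_of_nonneg_right hexpfast (by positivity)))
        ((hEb ν (Or.inr rfl) 0 (by norm_num) t).trans
          (mul_le_mul_of_nonneg_right hexpfast (by positivity))) (-ε) (norm_neg ε)
      refine (norm_add_le _ _).trans ((add_le_add h1 h2).trans (le_of_eq ?_))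
      rw [hF]; ring
    · refine ((((hother μ (Or.inl rfl) k hk hkn hkm 1).add
        ((hother μ (Or.inl rfl) k hk hkn hkm 0).const_mul ε)).const_mul a).add
        (((hother ν (Or.inr rfl) k hk hkn hkm 1).add
        ((hother ν (Or.inr rfl) k hk hkn hkm 0).const_mul (-ε))).const_mul b)).congr
        (fun t => rfl) ?_ ?_ <;> simp
    · refine ((hownμ.const_mul a).add (hownν.const_mul b)).congr (fun t => ?_) ?_ ?_
      · simp only [hE, hε]; ring
      · rw [ha, hb]
        field_simp
        rw [hε]; ring
      · rw [ha, hb]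
        field_simp
        rw [hε]; ring

end ExistsModeControls


/-! ### A Turán inequality for sine polynomials with few terms -/

/-- The normalized eigenfunction `√(2/π) sin (n x)`. -/
def sineFun (n : ℕ) (x : ℝ) : ℝ := Real.sqrt (2 / Real.pi) * Real.sin (n * x)

lemma continuous_sineFun (n : ℕ) : Continuous (sineFun n) := by
  unfold sineFun; fun_prop

lemma integral_cos_int_mul (m : ℤ) :
    ∫ x in (0 : ℝ)..Real.pi, Real.cos (m * x) = if m = 0 then Real.pi else 0 := by
  split_ifs with h
  · simp [h]
  · have hm : (m : ℝ) ≠ 0 := by exact_mod_cast h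
    rw [intervalIntegral.integral_comp_mul_left (fun x => Real.cos x) hm, integral_cos,
      Real.sin_int_mul_pi]
    simp

lemma integral_sineFun_mul (j k : ℕ) (hj : 1 ≤ j) :
    ∫ x in (0 : ℝ)..Real.pi, sineFun j x * sineFun k x = if j = k then 1 else 0 := by
  have h1 : ∀ x, sineFun j x * sineFun k x
      = 1 / Real.pi * (Real.cos (((j : ℤ) - k : ℤ) * x) - Real.cos (((j : ℤ) + k : ℤ) * x)) := by
    intro x
    have h2 : Real.sqrt (2 / Real.pi) * Real.sqrt (2 / Real.pi) = 2 / Real.pi :=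
      Real.mul_self_sqrt (by positivity)
    push_cast
    rw [sub_mul, add_mul, Real.cos_sub, Real.cos_add]
    unfold sineFun
    calc _ = Real.sqrt (2 / Real.pi) * Real.sqrt (2 / Real.pi)
        * (Real.sin (j * x) * Real.sin (k * x)) := by ring
      _ = _ := by rw [h2]; ring
  simp_rw [h1]
  rw [intervalIntegral.integral_const_mul, intervalIntegral.integral_sub
    ((by fun_prop : Continuous _).intervalIntegrable _ _)
    ((by fun_prop : Continuous _).intervalIntegrable _ _), integral_cos_int_mul,
    integral_cos_int_mul, if_neg (by omega : ¬ ((j : ℤ) + k = 0))]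
  have : ((j : ℤ) - k = 0) ↔ j = k := by omega
  simp only [this]
  split_ifs
  · field_simp; ring
  · simp

section Turan

open Polynomial

lemma sin_recursion (k h x : ℝ) :
    Real.sin (k * (x + 2 * h)) - 2 * Real.cos (k * h) * Real.sin (k * (x + h))
      + Real.sin (k * x) = 0 := by
  have h1 : k * (x + 2 * h) = k * (x + h) + k * h := by ring
  have h2 : k * x = k * (x + h) - k * h := by ring
  rw [h1, h2, Real.sin_add, Real.sin_sub]; ring

/-- A linear recursion with bounded coefficients satisfied, along every arithmetic progression
of step `h`, by all sine polynomials with frequencies in `s`. Its symbol is the product of the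
`X² - 2 cos (k h) X + 1` over the frequencies `k`. -/
lemma exists_recursion (s : Finset ℕ) (h : ℝ) :
    ∃ P : ℝ[X], P.coeff 0 = 1 ∧ P.natDegree ≤ 2 * s.card ∧ (∀ l, |P.coeff l| ≤ 4 ^ s.card) ∧
      ∀ k ∈ s, ∀ N, P.natDegree < N → ∀ x : ℝ,
        ∑ l ∈ Finset.range N, P.coeff l * Real.sin (k * (x + l * h)) = 0 := by
  classical
  set τ : Module.End ℝ (ℝ → ℝ) :=
    { toFun := fun f x => f (x + h), map_add' := fun _ _ => rfl, map_smul' := fun _ _ => rfl }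
    with hτ
  have hpow : ∀ (l : ℕ) (f : ℝ → ℝ) (x : ℝ), (τ ^ l) f x = f (x + l * h) := by
    intro l
    induction l with
    | zero => intro f x; simp
    | succ l ih =>
      intro f x
      rw [pow_succ, Module.End.mul_apply, ih]
      change f (x + l * h + h) = _
      congr 1
      push_cast; ring
  have haeval : ∀ (P : ℝ[X]) (N : ℕ), P.natDegree < N → ∀ (f : ℝ → ℝ) (x : ℝ),
      (aeval τ P) f x = ∑ l ∈ Finset.range N, P.coeff l * f (x + l * h) := by
    intro P N hN f x
    rw [aeval_eq_sum_range' hN, LinearMap.sum_apply, Finset.sum_apply]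
    refine Finset.sum_congr rfl fun l _ => ?_
    rw [LinearMap.smul_apply, Pi.smul_apply, hpow, smul_eq_mul]
  have main : ∃ P : ℝ[X], P.coeff 0 = 1 ∧ P.natDegree ≤ 2 * s.card ∧
      (∀ l, |P.coeff l| ≤ 4 ^ s.card) ∧
      ∀ k ∈ s, (aeval τ P) (fun x => Real.sin ((k : ℕ) * x)) = 0 := by
    induction s using Finset.induction_on with
    | empty =>
      refine ⟨1, by simp, by simp, fun l => ?_, by simp⟩
      rw [coeff_one]; split_ifs <;> simp
    | insert k s hk ih =>
      obtain ⟨P, h0, hdeg, hco, hann⟩ := ih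
      set c : ℝ := 2 * Real.cos (k * h) with hc
      have hcabs : |c| ≤ 2 := by
        rw [hc, abs_mul, abs_two]; linarith [Real.abs_cos_le_one (k * h)]
      set F : ℝ[X] := X ^ 2 - C c * X + 1 with hF
      have hFdeg : F.natDegree ≤ 2 := by rw [hF]; compute_degree
      have hPF : P * F = P * X * X - C c * (P * X) + P := by rw [hF]; ring
      refine ⟨P * F, ?_, ?_, fun l => ?_, fun j hj => ?_⟩
      · rw [hPF]; simp [h0]
      · rw [Finset.card_insert_of_notMem hk]
        exact (natDegree_mul_le).trans (by omega)
      · rw [Finset.card_insert_of_notMem hk, hPF, coeff_add, coeff_sub, coeff_C_mul, pow_succ]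
        have hX : ∀ Q : ℝ[X], (∀ l, |Q.coeff l| ≤ 4 ^ s.card) →
            ∀ l, |(Q * X).coeff l| ≤ 4 ^ s.card := by
          intro Q hQ l
          cases l with
          | zero => simp
          | succ l => rw [coeff_mul_X]; exact hQ l
        have h1 := hX _ (hX P hco) l
        have h2 := hX P hco l
        have h3 := hco l
        have h4 : |c * (P * X).coeff l| ≤ 2 * 4 ^ s.card := by
          rw [abs_mul]; exact mul_le_mul hcabs h2 (abs_nonneg _) (by norm_num)
        have h5 := abs_add_le ((P * X * X).coeff l - c * (P * X).coeff l) (P.coeff l)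
        have h6 := abs_sub ((P * X * X).coeff l) (c * (P * X).coeff l)
        linarith
      · rcases Finset.mem_insert.1 hj with rfl | hj
        · rw [map_mul, Module.End.mul_apply]
          have : (aeval τ F) (fun x => Real.sin ((j : ℕ) * x)) = 0 := by
            funext x
            have hF' : aeval τ F = τ ^ 2 - c • τ + 1 := by
              rw [hF, map_add, map_sub, map_mul, map_pow, aeval_X, aeval_C, map_one]
              rw [Algebra.algebraMap_eq_smul_one, smul_mul_assoc, one_mul]
            rw [hF', LinearMap.add_apply, LinearMap.sub_apply, LinearMap.smul_apply,
              Module.End.one_apply]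
            simp only [Pi.add_apply, Pi.sub_apply, Pi.smul_apply, smul_eq_mul, hpow,
              Pi.zero_apply]
            have := sin_recursion j h x
            push_cast
            exact this
          rw [this, map_zero]
        · rw [mul_comm, map_mul, Module.End.mul_apply, hann j hj, map_zero]
  obtain ⟨P, h0, hdeg, hco, hann⟩ := main
  refine ⟨P, h0, hdeg, hco, fun k hk N hN x => ?_⟩
  have := congrFun (hann k hk) x
  rwa [haeval P N hN] at this

/-- A sine polynomial with at most `M` terms is controlled at `x` by its values at the next `2 M`
points of any arithmetic progression. -/
lemma sq_le_sum_sq_shift {M : ℕ} {s : Finset ℕ} (hs : s.card ≤ M) (c : ℕ → ℝ) (h x : ℝ) :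
    (∑ k ∈ s, c k * sineFun k x) ^ 2 ≤ (2 * M) * (4 ^ M) ^ 2 *
      ∑ l ∈ Finset.range (2 * M), (∑ k ∈ s, c k * sineFun k (x + (l + 1 : ℕ) * h)) ^ 2 := by
  obtain ⟨P, h0, hdeg, hco, hann⟩ := exists_recursion s h
  set p : ℝ → ℝ := fun x => ∑ k ∈ s, c k * sineFun k x with hp
  have h1 : ∑ l ∈ Finset.range (2 * M + 1), P.coeff l * p (x + l * h) = 0 := by
    simp only [hp, Finset.mul_sum]
    rw [Finset.sum_comm]
    refine Finset.sum_eq_zero fun k hk => ?_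
    have := hann k hk (2 * M + 1) (by omega) x
    have e : ∑ l ∈ Finset.range (2 * M + 1), P.coeff l * (c k * sineFun k (x + l * h))
        = c k * Real.sqrt (2 / Real.pi) *
          ∑ l ∈ Finset.range (2 * M + 1), P.coeff l * Real.sin (k * (x + l * h)) := by
      rw [Finset.mul_sum]
      refine Finset.sum_congr rfl fun l _ => ?_
      unfold sineFun; ring
    rw [e, this, mul_zero]
  rw [Finset.sum_range_succ', h0] at h1
  simp only [Nat.cast_zero, zero_mul, add_zero, one_mul] at h1
  have h2 : p x = -∑ l ∈ Finset.range (2 * M), P.coeff (l + 1) * p (x + (l + 1 : ℕ) * h) := by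
    linarith
  change p x ^ 2 ≤ _ * ∑ l ∈ Finset.range (2 * M), p (x + (l + 1 : ℕ) * h) ^ 2
  rw [h2, neg_sq]
  refine (Finset.sum_mul_sq_le_sq_mul_sq _ _ _).trans ?_
  refine mul_le_mul_of_nonneg_right ?_ (Finset.sum_nonneg fun _ _ => sq_nonneg _)
  have h4 : ∀ l ∈ Finset.range (2 * M), P.coeff (l + 1) ^ 2 ≤ ((4 : ℝ) ^ M) ^ 2 := by
    intro l _
    rw [sq_le_sq, abs_of_pos (show (0 : ℝ) < 4 ^ M by positivity)]
    exact (hco _).trans (pow_le_pow_right₀ (by norm_num) hs)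
  refine (Finset.sum_le_sum h4).trans ?_
  rw [Finset.sum_const, Finset.card_range, nsmul_eq_mul]
  push_cast
  exact le_rfl

/-- Extending the interval of integration to the left by a step `h`, of which it contains `2 M`,
costs a constant factor that depends only on the number of terms. -/
lemma integral_sq_extend_left {M : ℕ} {s : Finset ℕ} (hs : s.card ≤ M) (c : ℕ → ℝ) {h a b : ℝ}
    (hh : 0 < h) (hab : a + 2 * M * h ≤ b) :
    ∫ x in (a - h)..b, (∑ k ∈ s, c k * sineFun k x) ^ 2
      ≤ (1 + (2 * M) * (4 ^ M) ^ 2 * (2 * M)) *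
        ∫ x in a..b, (∑ k ∈ s, c k * sineFun k x) ^ 2 := by
  set q : ℝ → ℝ := fun x => (∑ k ∈ s, c k * sineFun k x) ^ 2 with hq
  have hqc : Continuous q := by
    have := continuous_sineFun
    simp only [hq]; fun_prop
  have hq0 : ∀ x, 0 ≤ q x := fun x => sq_nonneg _
  have hi : ∀ u v, IntervalIntegrable q volume u v := fun u v => hqc.intervalIntegrable u v
  have hM0 : 0 ≤ 2 * (M : ℝ) * h := by positivity
  change ∫ x in (a - h)..b, q x ≤ _ * ∫ x in a..b, q x
  rw [← intervalIntegral.integral_add_adjacent_intervals (hi (a - h) a) (hi a b), add_mul, one_mul,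
    add_comm]
  refine add_le_add le_rfl ?_
  have h1 : ∫ x in (a - h)..a, q x ≤ ∫ x in (a - h)..a, (2 * M) * (4 ^ M) ^ 2 *
      ∑ l ∈ Finset.range (2 * M), q (x + (l + 1 : ℕ) * h) := by
    refine intervalIntegral.integral_mono_on (by linarith) (hi _ _) ?_ fun x _ =>
      sq_le_sum_sq_shift hs c h x
    exact (by fun_prop : Continuous _).intervalIntegrable _ _
  refine h1.trans ?_
  rw [intervalIntegral.integral_const_mul, mul_assoc (2 * (M : ℝ) * (4 ^ M) ^ 2)]
  refine mul_le_mul_of_nonneg_left ?_ (by positivity)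
  have hshift : ∀ l ∈ Finset.range (2 * M),
      IntervalIntegrable (fun x => q (x + (l + 1 : ℕ) * h)) volume (a - h) a := fun l _ =>
    (by fun_prop : Continuous fun x => q (x + (l + 1 : ℕ) * h)).intervalIntegrable _ _
  rw [intervalIntegral.integral_finsetSum hshift]
  have h2 : ∀ l ∈ Finset.range (2 * M), ∫ x in (a - h)..a, q (x + (l + 1 : ℕ) * h)
      ≤ ∫ x in a..b, q x := by
    intro l hl
    rw [intervalIntegral.integral_comp_add_right]
    have hl' : (l : ℝ) + 1 ≤ 2 * M := by
      have := Finset.mem_range.1 hl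
      exact_mod_cast this
    have hl0 : (0 : ℝ) ≤ l := Nat.cast_nonneg l
    push_cast
    refine intervalIntegral.integral_mono_interval ?_ ?_ ?_
      (Filter.Eventually.of_forall hq0) (hi a b)
    · nlinarith
    · nlinarith
    · nlinarith
  refine (Finset.sum_le_sum h2).trans ?_
  rw [Finset.sum_const, Finset.card_range, nsmul_eq_mul]
  push_cast
  exact le_rfl

lemma integral_sq_full (s : Finset ℕ) (hs : ∀ k ∈ s, 1 ≤ k) (c : ℕ → ℝ) :
    ∫ x in (0 : ℝ)..Real.pi, (∑ k ∈ s, c k * sineFun k x) ^ 2 = ∑ k ∈ s, c k ^ 2 := by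
  have hc := continuous_sineFun
  have h1 : ∀ x, (∑ k ∈ s, c k * sineFun k x) ^ 2
      = ∑ j ∈ s, ∑ k ∈ s, c j * c k * (sineFun j x * sineFun k x) := by
    intro x
    rw [sq, Finset.sum_mul_sum]
    exact Finset.sum_congr rfl fun j _ => Finset.sum_congr rfl fun k _ => by ring
  simp_rw [h1]
  rw [intervalIntegral.integral_finsetSum fun j _ =>
    (by fun_prop : Continuous _).intervalIntegrable _ _]
  refine Finset.sum_congr rfl fun j hj => ?_
  rw [intervalIntegral.integral_finsetSum fun k _ =>
    (by fun_prop : Continuous _).intervalIntegrable _ _]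
  rw [Finset.sum_eq_single_of_mem j hj]
  · rw [intervalIntegral.integral_const_mul, integral_sineFun_mul j j (hs j hj), if_pos rfl]; ring
  · intro k hk hkj
    rw [intervalIntegral.integral_const_mul, integral_sineFun_mul j k (hs j hj), if_neg hkj.symm,
      mul_zero]

/-- A Turán inequality: the coefficients of a sine polynomial with at most `M` terms, whatever its
frequencies, are controlled by its norm on a subinterval. -/
lemma exists_turan (M : ℕ) {a b : ℝ} (ha : 0 < a) (hab : a < b) :
    ∃ C : ℝ, 0 < C ∧ ∀ s : Finset ℕ, s.card ≤ M → (∀ k ∈ s, 1 ≤ k) → ∀ c : ℕ → ℝ,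
      ∑ k ∈ s, c k ^ 2 ≤ C * ∫ x in a..b, (∑ k ∈ s, c k * sineFun k x) ^ 2 := by
  set h : ℝ := (b - a) / (2 * M + 1) with hh
  have hpos : 0 < h := by
    have : 0 < b - a := by linarith
    positivity
  have hM : 2 * M * h ≤ b - a := by
    rw [hh, mul_div_assoc', div_le_iff₀ (by positivity)]
    nlinarith
  set D : ℝ := 1 + (2 * M) * (4 ^ M) ^ 2 * (2 * M) with hD
  have hDpos : 0 < D := by positivity
  -- after `n` steps to the left the interval contains `[-π, 0]`, where the sines are orthogonal
  obtain ⟨n, hn⟩ := exists_nat_ge ((a + Real.pi) / h)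
  rw [div_le_iff₀ hpos] at hn
  refine ⟨D ^ n, by positivity, fun s hs hs1 c => ?_⟩
  set q : ℝ → ℝ := fun x => (∑ k ∈ s, c k * sineFun k x) ^ 2 with hq
  have hqc : Continuous q := by
    have := continuous_sineFun
    simp only [hq]; fun_prop
  have hq0 : ∀ x, 0 ≤ q x := fun x => sq_nonneg _
  have hstep : ∀ n : ℕ, ∫ x in (a - n * h)..b, q x ≤ D ^ n * ∫ x in a..b, q x := by
    intro n
    induction n with
    | zero => simp
    | succ n ih =>
      have h1 := integral_sq_extend_left hs c (a := a - n * h) (b := b) hpos (by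
        have : 0 ≤ n * h := by positivity
        linarith)
      have h2 : a - (n + 1 : ℕ) * h = a - n * h - h := by push_cast; ring
      rw [h2, pow_succ, mul_comm (D ^ n), mul_assoc]
      exact h1.trans (mul_le_mul_of_nonneg_left ih hDpos.le)
  have hodd : ∀ x, q (-x) = q x := by
    intro x
    have : ∑ k ∈ s, c k * sineFun k (-x) = -∑ k ∈ s, c k * sineFun k x := by
      rw [← Finset.sum_neg_distrib]
      refine Finset.sum_congr rfl fun k _ => ?_
      simp [sineFun]
    simp only [hq, this, neg_sq]
  have hfull : ∫ x in (-Real.pi)..0, q x = ∑ k ∈ s, c k ^ 2 := by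
    rw [← integral_sq_full s hs1 c]
    have := intervalIntegral.integral_comp_neg (a := 0) (b := Real.pi) q
    rw [neg_zero] at this
    rw [← this]
    exact intervalIntegral.integral_congr fun x _ => hodd x
  rw [← hfull]
  refine le_trans ?_ (hstep n)
  exact intervalIntegral.integral_mono_interval (by linarith) (by linarith [Real.pi_pos])
    (by linarith) (Filter.Eventually.of_forall hq0) (hqc.intervalIntegrable _ _)

end Turan

/-- A coercive Gram matrix has dual vectors with bounded coefficients. -/
lemma exists_dual_coeff (s : Finset ℕ) (G : ℕ → ℕ → ℝ) {C : ℝ} (hC : 0 < C)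
    (hG : ∀ c : ℕ → ℝ, ∑ k ∈ s, c k ^ 2 ≤ C * ∑ j ∈ s, (∑ k ∈ s, c k * G k j) * c j) {n : ℕ}
    (hn : n ∈ s) :
    ∃ β : ℕ → ℝ, (∀ j ∈ s, ∑ k ∈ s, β k * G k j = if j = n then 1 else 0) ∧
      ∀ k ∈ s, |β k| ≤ C := by
  classical
  set f : (s → ℝ) →ₗ[ℝ] (s → ℝ) :=
    { toFun := fun c j => ∑ k : s, c k * G k j
      map_add' := fun c d => by
        funext j
        simp [add_mul, Finset.sum_add_distrib]
      map_smul' := fun r c => by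
        funext j
        simp [Finset.mul_sum, mul_assoc] } with hf
  have hext : ∀ c : s → ℝ, ∑ k : s, c k ^ 2 ≤ C * ∑ j : s, f c j * c j := by
    intro c
    have h := hG fun k => if hk : k ∈ s then c ⟨k, hk⟩ else 0
    rw [← Finset.sum_coe_sort s, ← Finset.sum_coe_sort s] at h
    simp only [Subtype.coe_eta, Finset.coe_mem, dite_true] at h
    have e : ∀ j : s, ∑ k ∈ s, (if hk : k ∈ s then c ⟨k, hk⟩ else 0) * G k j = f c j := by
      intro j
      rw [← Finset.sum_coe_sort s]
      simp [hf]
    simp only [e] at h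
    exact h
  have hinj : Function.Injective f := by
    rw [← LinearMap.ker_eq_bot, LinearMap.ker_eq_bot']
    intro c hc
    have h := hext c
    rw [hc] at h
    simp only [Pi.zero_apply, zero_mul, Finset.sum_const_zero, mul_zero] at h
    have h0 := (Finset.sum_eq_zero_iff_of_nonneg fun k _ => sq_nonneg (c k)).1
      (le_antisymm h (Finset.sum_nonneg fun k _ => sq_nonneg _))
    funext k
    exact pow_eq_zero_iff (two_ne_zero) |>.1 (h0 k (Finset.mem_univ k))
  obtain ⟨c, hc⟩ := (LinearMap.injective_iff_surjective.1 hinj) fun j => if (j : ℕ) = n then 1 else 0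
  have hval : ∀ j : s, ∑ k : s, c k * G k j = if (j : ℕ) = n then 1 else 0 := fun j => congrFun hc j
  have hsq : ∑ k : s, c k ^ 2 ≤ C * c ⟨n, hn⟩ := by
    have h := hext c
    rw [hc] at h
    have e : ∑ j : s, (if (j : ℕ) = n then (1 : ℝ) else 0) * c j = c ⟨n, hn⟩ := by
      rw [Finset.sum_eq_single ⟨n, hn⟩]
      · simp
      · intro j _ hj
        rw [if_neg fun h => hj (Subtype.ext h), zero_mul]
      · simp
    rwa [e] at h
  have hle : ∀ k : s, c k ^ 2 ≤ C * c ⟨n, hn⟩ := fun k =>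
    (Finset.single_le_sum (f := fun k : s => c k ^ 2) (fun j _ => sq_nonneg (c j))
      (Finset.mem_univ k)).trans hsq
  have hcn : c ⟨n, hn⟩ ≤ C := by
    have h := hle ⟨n, hn⟩
    by_contra hlt
    rw [not_le] at hlt
    nlinarith
  refine ⟨fun k => if hk : k ∈ s then c ⟨k, hk⟩ else 0, fun j hj => ?_, fun k hk => ?_⟩
  · rw [← hval ⟨j, hj⟩, ← Finset.sum_coe_sort s]
    simp
  · simp only [dif_pos hk]
    refine abs_le_of_sq_le_sq ?_ hC.le
    have := hle ⟨k, hk⟩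
    nlinarith

/-- Functions dual to `n` in the span of the few eigenfunctions `s`, with respect to the inner
product of `L²(Ω)`. -/
lemma exists_dual_sines {Ω : Set ℝ} (hΩ : IsOpen Ω) (hne : Ω.Nonempty)
    (hsub : Ω ⊆ Ioo (0 : ℝ) Real.pi) (M : ℕ) :
    ∃ C : ℝ, 0 < C ∧ ∀ s : Finset ℕ, s.card ≤ M → (∀ k ∈ s, 1 ≤ k) → ∀ n ∈ s,
      ∃ β : ℕ → ℝ, (∀ j ∈ s, ∑ k ∈ s, β k * ∫ x in Ω, sineFun k x * sineFun j x
        = if j = n then 1 else 0) ∧ ∀ k ∈ s, |β k| ≤ C := by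
  obtain ⟨x₀, hx₀⟩ := hne
  obtain ⟨ε, hε, hball⟩ := Metric.isOpen_iff.1 hΩ x₀ hx₀
  have hIoo : Ioo (x₀ - ε) (x₀ + ε) ⊆ Ω := by rwa [← Real.ball_eq_Ioo]
  obtain ⟨C, hC, hT⟩ := exists_turan M (a := x₀) (b := x₀ + ε) (hsub hx₀).1 (by linarith)
  refine ⟨C, hC, fun s hs hs1 n hn => exists_dual_coeff s _ hC (fun c => ?_) hn⟩
  have hcs := continuous_sineFun
  have hint : ∀ f : ℝ → ℝ, Continuous f → IntegrableOn f Ω := fun f hf =>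
    (hf.integrableOn_Icc (a := 0) (b := Real.pi)).mono_set (hsub.trans Ioo_subset_Icc_self)
  refine (hT s hs hs1 c).trans (mul_le_mul_of_nonneg_left ?_ hC.le)
  have e : ∑ j ∈ s, (∑ k ∈ s, c k * ∫ x in Ω, sineFun k x * sineFun j x) * c j
      = ∫ x in Ω, (∑ k ∈ s, c k * sineFun k x) ^ 2 := by
    have h1 : ∀ x, (∑ k ∈ s, c k * sineFun k x) ^ 2
        = ∑ j ∈ s, ∑ k ∈ s, c k * c j * (sineFun k x * sineFun j x) := by
      intro x
      rw [sq, Finset.sum_mul_sum]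
      exact Finset.sum_congr rfl fun j _ => Finset.sum_congr rfl fun k _ => by ring
    simp_rw [h1]
    rw [integral_finsetSum _ fun j _ => hint _ (by fun_prop)]
    refine Finset.sum_congr rfl fun j _ => ?_
    rw [integral_finsetSum _ fun k _ => hint _ (by fun_prop), Finset.sum_mul]
    refine Finset.sum_congr rfl fun k _ => ?_
    rw [integral_const_mul]; ring
  rw [e, intervalIntegral.integral_of_le (by linarith), integral_Ioc_eq_integral_Ioo]
  refine setIntegral_mono_set (hint _ (by fun_prop)) (Filter.Eventually.of_forall fun x => sq_nonneg _)
    (Filter.Eventually.of_forall ?_)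
  exact (Ioo_subset_Ioo_left (by linarith)).trans hIoo


/-! ### The sine basis and the Dirichlet Laplacian -/

section SineBasis

variable {𝕜 : Type*} [RCLike 𝕜]

lemma continuous_ofReal_sineFun (n : ℕ) : Continuous fun x => (sineFun n x : 𝕜) :=
  RCLike.continuous_ofReal.comp (continuous_sineFun n)

lemma abs_sineFun_le (n : ℕ) (x : ℝ) : |sineFun n x| ≤ 1 := by
  unfold sineFun
  rw [abs_mul, abs_of_nonneg (Real.sqrt_nonneg _)]
  have h1 : Real.sqrt (2 / Real.pi) ≤ 1 := by
    rw [Real.sqrt_le_one]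
    rw [div_le_one Real.pi_pos]; exact Real.two_le_pi
  exact mul_le_one₀ h1 (abs_nonneg _) (Real.abs_sin_le_one _)

lemma memLp_sineFun (n : ℕ) (s : Set ℝ) (hs : s ⊆ Ioo (0 : ℝ) Real.pi) :
    MemLp (fun x => (sineFun n x : 𝕜)) 2 (volume.restrict s) := by
  have : IsFiniteMeasure (volume.restrict s) := by
    refine ⟨?_⟩
    rw [Measure.restrict_apply_univ]
    exact (measure_mono hs).trans_lt (by simp)
  refine MemLp.of_bound (continuous_ofReal_sineFun n).aestronglyMeasurable 1
    (Filter.Eventually.of_forall fun x => ?_)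
  rw [RCLike.norm_ofReal]
  exact abs_sineFun_le n x

/-- The eigenfunction `√(2/π) sin (n x)` as an element of `L²(0, π)`. -/
def sineVec (𝕜 : Type*) [RCLike 𝕜] (n : ℕ) : BeamL2 𝕜 :=
  (memLp_sineFun (𝕜 := 𝕜) n _ subset_rfl).toLp _

lemma coeFn_sineVec (n : ℕ) :
    sineVec 𝕜 n =ᵐ[volume.restrict (Ioo (0 : ℝ) Real.pi)] fun x => (sineFun n x : 𝕜) :=
  MemLp.coeFn_toLp _

lemma sineCoeff_eq_inner (n : ℕ) (w : BeamL2 𝕜) : sineCoeff n w = inner 𝕜 (sineVec 𝕜 n) w := by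
  rw [L2.inner_def]
  refine integral_congr_ae ?_
  filter_upwards [coeFn_sineVec (𝕜 := 𝕜) n] with x hx
  rw [hx]
  simp [sineFun, RCLike.inner_apply, mul_comm]

lemma inner_sineVec (j k : ℕ) (hj : 1 ≤ j) :
    inner 𝕜 (sineVec 𝕜 j) (sineVec 𝕜 k) = if j = k then (1 : 𝕜) else 0 := by
  rw [L2.inner_def]
  have : ∫ x in Ioo (0 : ℝ) Real.pi, inner 𝕜 (sineVec 𝕜 j x) (sineVec 𝕜 k x)
      = ∫ x in Ioo (0 : ℝ) Real.pi, ((sineFun j x * sineFun k x : ℝ) : 𝕜) := by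
    refine integral_congr_ae ?_
    filter_upwards [coeFn_sineVec (𝕜 := 𝕜) j, coeFn_sineVec (𝕜 := 𝕜) k] with x hx hx'
    rw [hx, hx']
    simp [RCLike.inner_apply, mul_comm]
  rw [this, integral_ofReal, ← integral_Ioc_eq_integral_Ioo,
    ← intervalIntegral.integral_of_le Real.pi_pos.le, integral_sineFun_mul j k hj]
  split_ifs <;> simp

lemma BeamL2.integrable (w : BeamL2 𝕜) :
    Integrable w (volume.restrict (Ioo (0 : ℝ) Real.pi)) :=
  (Lp.memLp w).integrable (by norm_num)

lemma BeamL2.integrable_mul (w : BeamL2 𝕜) {q : ℝ → ℝ} (hq : Continuous q) :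
    Integrable (fun x => (q x : 𝕜) * w x) (volume.restrict (Ioo (0 : ℝ) Real.pi)) := by
  obtain ⟨C, hC⟩ := (isCompact_Icc (a := (0 : ℝ)) (b := Real.pi)).exists_bound_of_continuousOn
    hq.continuousOn
  refine (BeamL2.integrable w).bdd_mul (c := C)
    (RCLike.continuous_ofReal.comp hq).aestronglyMeasurable ?_
  filter_upwards [ae_restrict_mem measurableSet_Ioo] with x hx
  rw [RCLike.norm_ofReal]
  exact hC x (Ioo_subset_Icc_self hx)

lemma integral_cos_pow_mul_sin_eq_zero {w : BeamL2 𝕜} (h : ∀ n, 1 ≤ n → sineCoeff n w = 0)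
    (k : ℕ) : ∀ n : ℕ, ∫ x in Ioo (0 : ℝ) Real.pi,
      ((Real.cos x ^ k * Real.sin (n * x) : ℝ) : 𝕜) * w x = 0 := by
  induction k with
  | zero =>
    intro n
    rcases Nat.eq_zero_or_pos n with rfl | hn
    · simp
    · have h1 := h n hn
      unfold sineCoeff at h1
      have h2 : (Real.sqrt (2 / Real.pi) : 𝕜) ≠ 0 := by
        have : 0 < Real.sqrt (2 / Real.pi) := Real.sqrt_pos.2 (by positivity)
        exact_mod_cast this.ne'
      simp_rw [RCLike.ofReal_mul, mul_assoc] at h1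
      rw [integral_const_mul] at h1
      simpa using (mul_eq_zero.1 h1).resolve_left h2
  | succ k ih =>
    intro n
    rcases Nat.eq_zero_or_pos n with rfl | hn
    · simp
    · obtain ⟨m, rfl⟩ : ∃ m, n = m + 1 := ⟨n - 1, by omega⟩
      have e : ∀ x : ℝ, ((Real.cos x ^ (k + 1) * Real.sin ((m + 1 : ℕ) * x) : ℝ) : 𝕜) * w x
          = (1 / 2 : 𝕜) * (((Real.cos x ^ k * Real.sin ((m + 2 : ℕ) * x) : ℝ) : 𝕜) * w x)
            + (1 / 2 : 𝕜) * (((Real.cos x ^ k * Real.sin (m * x) : ℝ) : 𝕜) * w x) := by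
        intro x
        have h1 : Real.cos x ^ (k + 1) * Real.sin ((m + 1 : ℕ) * x)
            = 1 / 2 * (Real.cos x ^ k * Real.sin ((m + 2 : ℕ) * x))
              + 1 / 2 * (Real.cos x ^ k * Real.sin (m * x)) := by
          have h2 : ((m + 2 : ℕ) : ℝ) * x = (m + 1 : ℕ) * x + x := by push_cast; ring
          have h3 : (m : ℝ) * x = (m + 1 : ℕ) * x - x := by push_cast; ring
          rw [h2, h3, Real.sin_add, Real.sin_sub]; ring
        rw [h1]; push_cast; ring
      simp_rw [e]
      rw [integral_add, integral_const_mul, integral_const_mul, ih, ih]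
      · simp
      · exact (BeamL2.integrable_mul w (by fun_prop)).const_mul _
      · exact (BeamL2.integrable_mul w (by fun_prop)).const_mul _

open Polynomial in
lemma integral_polynomial_cos_mul_sin_eq_zero {w : BeamL2 𝕜}
    (h : ∀ n, 1 ≤ n → sineCoeff n w = 0) (p : ℝ[X]) :
    ∫ x in Ioo (0 : ℝ) Real.pi, ((p.eval (Real.cos x) * Real.sin x : ℝ) : 𝕜) * w x = 0 := by
  induction p using Polynomial.induction_on' with
  | add p q hp hq =>
    simp_rw [eval_add, add_mul, RCLike.ofReal_add, add_mul]
    rw [integral_add, hp, hq, add_zero]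
    · exact BeamL2.integrable_mul w (by fun_prop)
    · exact BeamL2.integrable_mul w (by fun_prop)
  | monomial k a =>
    simp_rw [eval_monomial, mul_assoc a, RCLike.ofReal_mul a, mul_assoc (a : 𝕜)]
    rw [integral_const_mul]
    have := integral_cos_pow_mul_sin_eq_zero h k 1
    simp only [Nat.cast_one, one_mul] at this
    rw [this, mul_zero]

/-- The eigenfunctions are complete: the polynomials in `cos x` times `sin x` lie in their span,
and by Weierstrass' theorem every continuous function on `[0, π]` is a uniform limit of
polynomials in `cos x`. -/
lemma eq_zero_of_sineCoeff {w : BeamL2 𝕜} (h : ∀ n, 1 ≤ n → sineCoeff n w = 0) : w = 0 := by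
  have h1 : ∀ g : ℝ → ℝ, Continuous g →
      ∫ x in Ioo (0 : ℝ) Real.pi, ((g x * Real.sin x : ℝ) : 𝕜) * w x = 0 := by
    intro g hg
    refine norm_eq_zero.1 (le_antisymm ?_ (norm_nonneg _))
    refine le_of_forall_pos_le_add fun ε hε => ?_
    set I := ∫ x in Ioo (0 : ℝ) Real.pi, ‖w x‖ with hI
    have hI0 : 0 ≤ I := integral_nonneg fun _ => norm_nonneg _
    obtain ⟨p, hp⟩ := exists_polynomial_near_of_continuousOn (-1) 1 (fun y => g (Real.arccos y))
      (hg.comp Real.continuous_arccos).continuousOn (ε / (I + 1)) (by positivity)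
    have h2 : ∫ x in Ioo (0 : ℝ) Real.pi, ((g x * Real.sin x : ℝ) : 𝕜) * w x
        = ∫ x in Ioo (0 : ℝ) Real.pi,
          (((g x - p.eval (Real.cos x)) * Real.sin x : ℝ) : 𝕜) * w x := by
      simp_rw [sub_mul, RCLike.ofReal_sub, sub_mul]
      rw [integral_sub, integral_polynomial_cos_mul_sin_eq_zero h, sub_zero]
      · exact BeamL2.integrable_mul w (by fun_prop)
      · exact BeamL2.integrable_mul w (by fun_prop)
    rw [h2, zero_add]
    calc _ ≤ ∫ x in Ioo (0 : ℝ) Real.pi, ε / (I + 1) * ‖w x‖ := by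
          refine norm_integral_le_of_norm_le ((BeamL2.integrable w).norm.const_mul _) ?_
          filter_upwards [ae_restrict_mem measurableSet_Ioo] with x hx
          rw [norm_mul, RCLike.norm_ofReal, abs_mul]
          refine mul_le_mul_of_nonneg_right ?_ (norm_nonneg _)
          have h3 := (hp (Real.cos x) (Real.cos_mem_Icc x)).le
          rw [Real.arccos_cos hx.1.le hx.2.le, abs_sub_comm] at h3
          calc _ ≤ ε / (I + 1) * 1 :=
                mul_le_mul h3 (Real.abs_sin_le_one x) (abs_nonneg _) (by positivity)
            _ = _ := mul_one _
      _ = ε / (I + 1) * I := by rw [integral_const_mul]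
      _ ≤ ε := by
          rw [div_mul_eq_mul_div, div_le_iff₀ (by positivity)]
          nlinarith
  have h2 := ae_eq_zero_of_integral_contDiff_smul_eq_zero
    (BeamL2.integrable_mul w Real.continuous_sin).locallyIntegrable fun g hg _ => by
      rw [← h1 g hg.continuous]
      refine integral_congr_ae (Filter.Eventually.of_forall fun x => ?_)
      simp only [RCLike.real_smul_eq_coe_mul, RCLike.ofReal_mul, mul_assoc]
  rw [Lp.eq_zero_iff_ae_eq_zero]
  filter_upwards [h2, ae_restrict_mem measurableSet_Ioo] with x hx hx'
  have h3 : ((Real.sin x : ℝ) : 𝕜) ≠ 0 := by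
    exact_mod_cast (Real.sin_pos_of_pos_of_lt_pi hx'.1 hx'.2).ne'
  exact (mul_eq_zero.1 hx).resolve_left h3

lemma orthonormal_sineVec : Orthonormal 𝕜 fun i : ℕ => sineVec 𝕜 (i + 1) := by
  rw [orthonormal_iff_ite]
  intro i j
  rw [inner_sineVec _ _ (by omega)]
  simp

lemma span_sineVec_orthogonal :
    (Submodule.span 𝕜 (range fun i : ℕ => sineVec 𝕜 (i + 1)))ᗮ = ⊥ := by
  rw [Submodule.eq_bot_iff]
  intro w hw
  refine eq_zero_of_sineCoeff fun n hn => ?_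
  rw [sineCoeff_eq_inner]
  refine Submodule.inner_right_of_mem_orthogonal (Submodule.subset_span (mem_range.2 ⟨n - 1, ?_⟩)) hw
  simp only [Nat.sub_add_cancel hn]

/-- The orthonormal basis of eigenfunctions, indexed from `0`: the `i`-th vector has frequency
`i + 1`. -/
def sineBasis (𝕜 : Type*) [RCLike 𝕜] : HilbertBasis ℕ 𝕜 (BeamL2 𝕜) :=
  HilbertBasis.mkOfOrthogonalEqBot (orthonormal_sineVec (𝕜 := 𝕜)) span_sineVec_orthogonal

lemma sineBasis_apply (i : ℕ) : sineBasis 𝕜 i = sineVec 𝕜 (i + 1) := by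
  unfold sineBasis
  rw [HilbertBasis.coe_mkOfOrthogonalEqBot]

lemma inner_sineBasis (i : ℕ) (w : BeamL2 𝕜) :
    inner 𝕜 (sineBasis 𝕜 i) w = sineCoeff (i + 1) w := by
  rw [sineBasis_apply, sineCoeff_eq_inner]

lemma ext_sineCoeff {w w' : BeamL2 𝕜} (h : ∀ i, sineCoeff (i + 1) w = sineCoeff (i + 1) w') :
    w = w' := by
  refine (sineBasis 𝕜).repr.injective (lp.ext (funext fun i => ?_))
  rw [HilbertBasis.repr_apply_apply, HilbertBasis.repr_apply_apply, inner_sineBasis,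
    inner_sineBasis, h]

lemma hasSum_sineCoeff_mul (w w' : BeamL2 𝕜) :
    HasSum (fun i => (starRingEnd 𝕜) (sineCoeff (i + 1) w) * sineCoeff (i + 1) w')
      (inner 𝕜 w w') := by
  have h := (sineBasis 𝕜).hasSum_inner_mul_inner w w'
  convert h using 2 with i
  rw [← inner_conj_symm w, inner_sineBasis, inner_sineBasis]

lemma hasSum_norm_sineCoeff_sq (w : BeamL2 𝕜) :
    HasSum (fun i => ‖sineCoeff (i + 1) w‖ ^ 2) (‖w‖ ^ 2) := by
  have h := hasSum_sineCoeff_mul w w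
  have h2 := RCLike.hasSum_re 𝕜 h
  rw [inner_self_eq_norm_sq] at h2
  convert h2 using 2 with i
  rw [RCLike.conj_mul]
  exact_mod_cast RCLike.ofReal_re (K := 𝕜) _

/-- The element of `L²(0, π)` with prescribed square-summable coefficients. -/
lemma exists_of_coeff {c : ℕ → 𝕜} (hc : Summable fun i => ‖c i‖ ^ 2) :
    ∃ w : BeamL2 𝕜, ∀ i, sineCoeff (i + 1) w = c i := by
  have hm : Memℓp c 2 := by
    refine memℓp_gen ?_
    simpa using hc
  refine ⟨(sineBasis 𝕜).repr.symm ⟨c, hm⟩, fun i => ?_⟩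
  rw [← inner_sineBasis, ← HilbertBasis.repr_apply_apply]
  simp

end SineBasis

section Laplacian

variable {𝕜 : Type*} [RCLike 𝕜]

lemma setIntegral_Ioo_eq (q : ℝ → 𝕜) :
    ∫ x in Ioo (0 : ℝ) Real.pi, q x = ∫ x in (0 : ℝ)..Real.pi, q x := by
  rw [← integral_Ioc_eq_integral_Ioo, intervalIntegral.integral_of_le Real.pi_pos.le]

lemma intervalIntegral_ofReal (a b : ℝ) (q : ℝ → ℝ) :
    ∫ x in a..b, (q x : 𝕜) = ((∫ x in a..b, q x : ℝ) : 𝕜) := by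
  simp only [intervalIntegral, integral_ofReal, RCLike.ofReal_sub]

/-- Integration by parts against a primitive, by Fubini's theorem. -/
lemma integral_mul_primitive {φ φ' : ℝ → ℝ} (hφ : ∀ x, HasDerivAt φ (φ' x) x)
    (hφ' : Continuous φ') {g : ℝ → 𝕜}
    (hg : Integrable g (volume.restrict (Ioo (0 : ℝ) Real.pi))) :
    ∫ x in Ioo (0 : ℝ) Real.pi, (φ' x : 𝕜) * ∫ z in (0 : ℝ)..x, g z
      = ∫ z in Ioo (0 : ℝ) Real.pi, ((φ Real.pi - φ z : ℝ) : 𝕜) * g z := by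
  set μ := volume.restrict (Ioo (0 : ℝ) Real.pi) with hμ
  have hφi : Integrable (fun x => (φ' x : 𝕜)) μ := by
    refine Integrable.ofReal ?_
    exact (hφ'.integrableOn_Icc (a := 0) (b := Real.pi)).mono_set Ioo_subset_Icc_self
  set F : ℝ → ℝ → 𝕜 := fun x z => {q : ℝ × ℝ | q.2 ≤ q.1}.indicator
    (fun q => (φ' q.1 : 𝕜) * g q.2) (x, z) with hF
  have hFi : Integrable (Function.uncurry F) (μ.prod μ) := by
    have h1 : Integrable (fun q : ℝ × ℝ => (φ' q.1 : 𝕜) * g q.2) (μ.prod μ) := hφi.mul_prod hg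
    exact h1.indicator (measurableSet_le measurable_snd measurable_fst)
  have h1 := integral_integral_swap hFi
  have e1 : ∫ x, ∫ z, F x z ∂μ ∂μ = ∫ x, (φ' x : 𝕜) * (∫ z in (0 : ℝ)..x, g z) ∂μ := by
    refine integral_congr_ae ?_
    filter_upwards [ae_restrict_mem measurableSet_Ioo] with x hx
    have : ∀ z, F x z = (φ' x : 𝕜) * (Iic x).indicator g z := by
      intro z
      simp only [hF, indicator_apply, mem_ofPred_eq, mem_Iic]
      split_ifs <;> simp
    simp_rw [this]
    rw [integral_const_mul, integral_indicator measurableSet_Iic, hμ,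
      Measure.restrict_restrict measurableSet_Iic, intervalIntegral.integral_of_le hx.1.le]
    congr 3
    ext z
    simp only [mem_inter_iff, mem_Iic, mem_Ioo, mem_Ioc]
    constructor
    · rintro ⟨a, b, c⟩; exact ⟨b, a⟩
    · rintro ⟨a, b⟩; exact ⟨b, a, b.trans_lt hx.2⟩
  have e2 : ∫ z, ∫ x, F x z ∂μ ∂μ = ∫ z, ((φ Real.pi - φ z : ℝ) : 𝕜) * g z ∂μ := by
    refine integral_congr_ae ?_
    filter_upwards [ae_restrict_mem measurableSet_Ioo] with z hz
    have : ∀ x, F x z = (Ici z).indicator (fun x => (φ' x : 𝕜)) x * g z := by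
      intro x
      simp only [hF, indicator_apply, mem_ofPred_eq, mem_Ici]
      split_ifs <;> simp
    simp_rw [this]
    rw [integral_mul_const, integral_indicator measurableSet_Ici, hμ,
      Measure.restrict_restrict measurableSet_Ici]
    have e3 : Ici z ∩ Ioo 0 Real.pi = Ico z Real.pi := by
      ext x
      simp only [mem_inter_iff, mem_Ici, mem_Ioo, mem_Ico]
      constructor
      · rintro ⟨a, b, c⟩; exact ⟨a, c⟩
      · rintro ⟨a, b⟩; exact ⟨a, hz.1.trans_le a, b⟩
    rw [e3, integral_Ico_eq_integral_Ioo, ← integral_Ioc_eq_integral_Ioo,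
      ← intervalIntegral.integral_of_le hz.2.le, intervalIntegral_ofReal,
      intervalIntegral.integral_eq_sub_of_hasDerivAt (fun x _ => hφ x)
        (hφ'.intervalIntegrable _ _)]
  rw [← e1, h1, e2]

lemma IsDirichletLaplacian.coeff_eq {w g : BeamL2 𝕜} (h : IsDirichletLaplacian w g) {n : ℕ}
    (hn : 1 ≤ n) : sineCoeff n g = ((n : ℝ) ^ 2 : ℝ) * sineCoeff n w := by
  obtain ⟨y, p, hwy, hy, hp, hy0, hyπ⟩ := h
  have hn0 : (n : ℝ) ≠ 0 := by exact_mod_cast (by omega : n ≠ 0)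
  have hpi := Real.pi_pos.le
  have hgi := BeamL2.integrable g
  have hgI : IntegrableOn g (uIcc 0 Real.pi) volume := by
    rw [uIcc_of_le hpi, integrableOn_Icc_iff_integrableOn_Ioo]; exact hgi
  have hpc : ContinuousOn p (Icc 0 Real.pi) := by
    have h1 := intervalIntegral.continuousOn_primitive_interval hgI
    rw [uIcc_of_le hpi] at h1
    exact (continuousOn_const.sub h1).congr hp
  have hpi' : IntegrableOn p (Icc 0 Real.pi) := hpc.integrableOn_Icc
  have hyp : ∀ x ∈ Icc (0 : ℝ) Real.pi, ∫ z in (0 : ℝ)..x, p z = y x := by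
    intro x hx
    have hsub : Icc 0 x ⊆ Icc 0 Real.pi := Icc_subset_Icc le_rfl hx.2
    rw [intervalIntegral.integral_eq_sub_of_hasDeriv_right
      (a := 0) (b := x) (f := y) (f' := p), hy0, sub_zero]
    · rw [uIcc_of_le hx.1]
      exact fun z hz => ((hy z (hsub hz)).continuousWithinAt).mono hsub
    · intro z hz
      rw [min_eq_left hx.1, max_eq_right hx.1] at hz
      have h1 := hy z ⟨hz.1.le, hz.2.le.trans hx.2⟩
      exact (h1.hasDerivAt (Icc_mem_nhds hz.1 (hz.2.trans_le hx.2))).hasDerivWithinAt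
    · rw [intervalIntegrable_iff_integrableOn_Icc_of_le hx.1]
      exact hpi'.mono_set hsub
  set a : ℝ := Real.sqrt (2 / Real.pi) with ha
  -- two integrations by parts, with the primitives `-cos (n x) / n` and `sin (n x) / n ^ 2`
  have h1 : ∫ x in Ioo (0 : ℝ) Real.pi, ((Real.sin (n * x) : ℝ) : 𝕜) * w x
      = ∫ x in Ioo (0 : ℝ) Real.pi, ((Real.cos (n * x) / n : ℝ) : 𝕜) * p x := by
    have e1 : ∫ x in Ioo (0 : ℝ) Real.pi, ((Real.sin (n * x) : ℝ) : 𝕜) * w x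
        = ∫ x in Ioo (0 : ℝ) Real.pi, ((Real.sin (n * x) : ℝ) : 𝕜) * ∫ z in (0 : ℝ)..x, p z := by
      refine integral_congr_ae ?_
      filter_upwards [hwy, ae_restrict_mem measurableSet_Ioo] with x hx hx'
      rw [hx, hyp x (Ioo_subset_Icc_self hx')]
    have hd : ∀ x : ℝ, HasDerivAt (fun x : ℝ => -(Real.cos (n * x) / n)) (Real.sin (n * x)) x := by
      intro x
      have := (((hasDerivAt_id x).const_mul (n : ℝ)).cos.div_const (n : ℝ)).neg
      refine this.congr_deriv ?_
      simp only [id, mul_one]; field_simp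
    rw [e1, integral_mul_primitive hd (by fun_prop) (hpi'.mono_set Ioo_subset_Icc_self)]
    have e2 : ∀ z : ℝ, ((-(Real.cos (n * Real.pi) / n) - -(Real.cos (n * z) / n) : ℝ) : 𝕜) * p z
        = -((Real.cos (n * Real.pi) / n : ℝ) : 𝕜) * p z
          + ((Real.cos (n * z) / n : ℝ) : 𝕜) * p z := by
      intro z
      simp only [RCLike.ofReal_sub, RCLike.ofReal_neg]; ring
    simp_rw [e2]
    have hpI := hpi'.mono_set (Ioo_subset_Icc_self (a := (0 : ℝ)) (b := Real.pi))
    rw [integral_add (hpI.const_mul _), integral_const_mul, setIntegral_Ioo_eq p,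
      hyp Real.pi ⟨hpi, le_rfl⟩, hyπ, mul_zero, zero_add]
    have : IntegrableOn (fun x => ((Real.cos (n * x) / n : ℝ) : 𝕜) * p x) (Icc 0 Real.pi) := by
      refine ContinuousOn.integrableOn_Icc (ContinuousOn.mul ?_ hpc)
      exact (RCLike.continuous_ofReal.comp (by fun_prop)).continuousOn
    exact this.mono_set Ioo_subset_Icc_self
  have h2 : ∫ x in Ioo (0 : ℝ) Real.pi, ((Real.cos (n * x) / n : ℝ) : 𝕜) * p x
      = ∫ x in Ioo (0 : ℝ) Real.pi, ((Real.sin (n * x) / n ^ 2 : ℝ) : 𝕜) * g x := by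
    have hd : ∀ x : ℝ, HasDerivAt (fun x : ℝ => Real.sin (n * x) / n ^ 2)
        (Real.cos (n * x) / n) x := by
      intro x
      have := ((hasDerivAt_id x).const_mul (n : ℝ)).sin.div_const ((n : ℝ) ^ 2)
      refine this.congr_deriv ?_
      simp only [id, mul_one]; field_simp
    have e1 : ∫ x in Ioo (0 : ℝ) Real.pi, ((Real.cos (n * x) / n : ℝ) : 𝕜) * p x
        = ∫ x in Ioo (0 : ℝ) Real.pi, (((Real.cos (n * x) / n : ℝ) : 𝕜) * p 0
          - ((Real.cos (n * x) / n : ℝ) : 𝕜) * ∫ z in (0 : ℝ)..x, g z) := by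
      refine setIntegral_congr_fun measurableSet_Ioo fun x hx => ?_
      rw [hp x (Ioo_subset_Icc_self hx), mul_sub]
    have hcc : Continuous fun x : ℝ => ((Real.cos (n * x) / n : ℝ) : 𝕜) :=
      RCLike.continuous_ofReal.comp (by fun_prop)
    have i1 : IntegrableOn (fun x : ℝ => ((Real.cos (n * x) / n : ℝ) : 𝕜) * p 0)
        (Ioo 0 Real.pi) :=
      ((hcc.mul continuous_const).integrableOn_Icc).mono_set Ioo_subset_Icc_self
    have i2 : IntegrableOn (fun x : ℝ => ((Real.cos (n * x) / n : ℝ) : 𝕜)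
        * ∫ z in (0 : ℝ)..x, g z) (Ioo 0 Real.pi) := by
      have h1 := intervalIntegral.continuousOn_primitive_interval hgI
      rw [uIcc_of_le hpi] at h1
      exact (hcc.continuousOn.mul h1).integrableOn_Icc.mono_set Ioo_subset_Icc_self
    rw [e1, integral_sub i1 i2, integral_mul_primitive hd (by fun_prop) hgi, integral_mul_const]
    have e3 : ∫ x in Ioo (0 : ℝ) Real.pi, ((Real.cos (n * x) / n : ℝ) : 𝕜) = 0 := by
      rw [setIntegral_Ioo_eq, intervalIntegral_ofReal,
        intervalIntegral.integral_eq_sub_of_hasDerivAt (fun x _ => hd x)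
          ((by fun_prop : Continuous _).intervalIntegrable _ _)]
      simp [Real.sin_nat_mul_pi]
    rw [e3, zero_mul, zero_sub, ← integral_neg]
    refine integral_congr_ae (Filter.Eventually.of_forall fun x => ?_)
    simp [Real.sin_nat_mul_pi]
  have hl : ∀ q : BeamL2 𝕜, sineCoeff n q
      = (a : 𝕜) * ∫ x in Ioo (0 : ℝ) Real.pi, ((Real.sin (n * x) : ℝ) : 𝕜) * q x := by
    intro q
    unfold sineCoeff
    simp_rw [RCLike.ofReal_mul, mul_assoc]
    rw [integral_const_mul]
  rw [hl, hl, h1, h2]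
  have e4 : ∀ x, ((Real.sin (n * x) / n ^ 2 : ℝ) : 𝕜) * g x
      = ((1 / (n : ℝ) ^ 2 : ℝ) : 𝕜) * (((Real.sin (n * x) : ℝ) : 𝕜) * g x) := by
    intro x
    rw [← mul_assoc, ← RCLike.ofReal_mul]; congr 2; ring
  simp_rw [e4]
  rw [integral_const_mul]
  have e5 : (((n : ℝ) ^ 2 : ℝ) : 𝕜) * ((1 / (n : ℝ) ^ 2 : ℝ) : 𝕜) = 1 := by
    rw [← RCLike.ofReal_mul, mul_one_div_cancel (pow_ne_zero 2 hn0), RCLike.ofReal_one]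
  rw [show ∀ A B C D : 𝕜, A * (B * (C * D)) = A * C * (B * D) by intros; ring, e5, one_mul]

/-- The domain of the Dirichlet Laplacian is described by the coefficients. -/
lemma isDirichletLaplacian_of_sineCoeff {w g : BeamL2 𝕜}
    (h : ∀ i : ℕ, sineCoeff (i + 1) g = (((i + 1 : ℕ) : ℝ) ^ 2 : ℝ) * sineCoeff (i + 1) w) :
    IsDirichletLaplacian w g := by
  have hpi := Real.pi_pos.le
  have hgI : IntegrableOn g (uIcc 0 Real.pi) volume := by
    rw [uIcc_of_le hpi, integrableOn_Icc_iff_integrableOn_Ioo]; exact BeamL2.integrable g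
  have hP := intervalIntegral.continuousOn_primitive_interval hgI
  rw [uIcc_of_le hpi] at hP
  set P : ℝ → 𝕜 := fun x => ∫ z in (0 : ℝ)..(projIcc 0 Real.pi hpi x : ℝ), g z with hPdef
  have hPc : Continuous P :=
    hP.comp_continuous (continuous_subtype_val.comp continuous_projIcc) fun x => Subtype.mem _
  have hPe : ∀ x ∈ Icc (0 : ℝ) Real.pi, P x = ∫ z in (0 : ℝ)..x, g z := by
    intro x hx
    simp only [hPdef, projIcc_of_mem hpi hx]
  set c : 𝕜 := (∫ x in (0 : ℝ)..Real.pi, P x) / (Real.pi : 𝕜) with hc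
  set y : ℝ → 𝕜 := fun x => (x : 𝕜) * c - ∫ z in (0 : ℝ)..x, P z with hy
  have hyd : ∀ x, HasDerivAt y (c - P x) x := by
    intro x
    have h1 : HasDerivAt (fun x : ℝ => (x : 𝕜)) 1 x := by
      simpa using (RCLike.ofRealCLM (K := 𝕜)).hasDerivAt (x := x)
    have h2 := (h1.mul_const c).sub (hPc.integral_hasStrictDerivAt 0 x).hasDerivAt
    rwa [one_mul] at h2
  have hyc : Continuous y := continuous_iff_continuousAt.2 fun x => (hyd x).continuousAt
  have hmem : MemLp y 2 (volume.restrict (Ioo (0 : ℝ) Real.pi)) := by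
    obtain ⟨C, hC⟩ := (isCompact_Icc (a := (0 : ℝ)) (b := Real.pi)).exists_bound_of_continuousOn
      hyc.continuousOn
    refine MemLp.of_bound hyc.aestronglyMeasurable C ?_
    filter_upwards [ae_restrict_mem measurableSet_Ioo] with x hx
    exact hC x (Ioo_subset_Icc_self hx)
  have hP0 : P 0 = 0 := by rw [hPe 0 ⟨le_rfl, hpi⟩]; simp
  have hπ : (Real.pi : 𝕜) ≠ 0 := by exact_mod_cast Real.pi_ne_zero
  have key : ∀ u : BeamL2 𝕜, (∀ᵐ x ∂(volume.restrict (Ioo (0 : ℝ) Real.pi)), u x = y x) →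
      IsDirichletLaplacian u g := fun u hu =>
    ⟨y, fun x => c - P x, hu, fun x _ => (hyd x).hasDerivWithinAt,
      fun x hx => by simp only [hP0, sub_zero]; rw [hPe x hx], by simp [hy],
      by simp only [hy, hc]; field_simp; ring⟩
  have h1 := key (hmem.toLp y) (MemLp.coeFn_toLp _)
  have h2 : hmem.toLp y = w := by
    refine ext_sineCoeff fun i => ?_
    have h3 := h1.coeff_eq (n := i + 1) (by omega)
    rw [h i] at h3
    refine (mul_left_cancel₀ ?_ h3).symm
    have : (((i + 1 : ℕ) : ℝ) ^ 2) ≠ 0 := by positivity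
    exact_mod_cast this
  rwa [h2] at h1

end Laplacian


/-! ### Forced oscillators -/

section Oscillator

variable {𝕜 : Type*} [RCLike 𝕜]

/-- The energy estimate for `y'' + b y' + c y = F`, in the squared form that can be summed over
the modes. -/
lemma oscillator_energy_le {b c T : ℝ} (hb : 0 ≤ b) (hc : 0 ≤ c) {y v F : ℝ → 𝕜}
    (hF : Continuous F)
    (hy : ∀ t ∈ Icc (0 : ℝ) T, HasDerivWithinAt y (v t) (Icc (0 : ℝ) T) t)
    (hv : ∀ t ∈ Icc (0 : ℝ) T, HasDerivWithinAt v (F t - (b : 𝕜) * v t - (c : 𝕜) * y t)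
      (Icc (0 : ℝ) T) t) {t : ℝ} (ht : t ∈ Icc (0 : ℝ) T) :
    c * ‖y t‖ ^ 2 + ‖v t‖ ^ 2
      ≤ Real.exp T * (c * ‖y 0‖ ^ 2 + ‖v 0‖ ^ 2 + ∫ s in (0 : ℝ)..T, ‖F s‖ ^ 2) := by
  set E : ℝ → ℝ := fun t => c * ‖y t‖ ^ 2 + ‖v t‖ ^ 2 with hE
  set E' : ℝ → ℝ := fun t => c * (2 * inner ℝ (y t) (v t))
    + 2 * inner ℝ (v t) (F t - (b : 𝕜) * v t - (c : 𝕜) * y t) with hE'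
  have hF2 : Continuous fun s => ‖F s‖ ^ 2 := by fun_prop
  have hd : ∀ t ∈ Icc (0 : ℝ) T, HasDerivWithinAt E (E' t) (Icc (0 : ℝ) T) t := fun t ht =>
    ((hy t ht).norm_sq.const_mul c).add (hv t ht).norm_sq
  have hle : ∀ t, E' t ≤ E t + ‖F t‖ ^ 2 := by
    intro t
    have h1 : E' t = 2 * inner ℝ (v t) (F t) - 2 * b * ‖v t‖ ^ 2 := by
      simp only [hE', ← RCLike.real_smul_eq_coe_mul, inner_sub_right, inner_smul_right]
      rw [real_inner_self_eq_norm_sq, real_inner_comm (v t) (y t)]; ring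
    have h2 : inner ℝ (v t) (F t) ≤ ‖v t‖ * ‖F t‖ := real_inner_le_norm _ _
    have h3 : 0 ≤ b * ‖v t‖ ^ 2 := by positivity
    have h4 : 0 ≤ c * ‖y t‖ ^ 2 := by positivity
    rw [h1]; simp only [hE]
    nlinarith [sq_nonneg (‖v t‖ - ‖F t‖)]
  set Φ : ℝ → ℝ := fun t => Real.exp (-t) * E t - ∫ s in (0 : ℝ)..t, ‖F s‖ ^ 2 with hΦ
  have hΦd : ∀ t ∈ Icc (0 : ℝ) T, HasDerivWithinAt Φ
      (-Real.exp (-t) * E t + Real.exp (-t) * E' t - ‖F t‖ ^ 2) (Icc (0 : ℝ) T) t := by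
    intro t ht
    have h1 : HasDerivAt (fun t : ℝ => Real.exp (-t)) (-Real.exp (-t)) t := by
      simpa using (hasDerivAt_id t).neg.exp
    exact (h1.hasDerivWithinAt.mul (hd t ht)).sub
      (hF2.integral_hasStrictDerivAt 0 t).hasDerivAt.hasDerivWithinAt
  have hanti : AntitoneOn Φ (Icc 0 T) := by
    refine antitoneOn_of_hasDerivWithinAt_nonpos (convex_Icc _ _)
      (fun t ht => (hΦd t ht).continuousWithinAt)
      (fun t ht => (hΦd t (interior_subset ht)).mono interior_subset) fun t ht => ?_
    have ht' := interior_subset ht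
    have h1 : Real.exp (-t) ≤ 1 := Real.exp_le_one_iff.2 (by linarith [ht'.1])
    have h2 := mul_le_mul_of_nonneg_left (hle t) (Real.exp_pos (-t)).le
    have h3 := mul_le_mul_of_nonneg_right h1 (sq_nonneg ‖F t‖)
    nlinarith
  have h1 := hanti ⟨le_rfl, ht.1.trans ht.2⟩ ht ht.1
  simp only [hΦ, neg_zero, Real.exp_zero, one_mul, intervalIntegral.integral_same, sub_zero] at h1
  have h2 : ∫ s in (0 : ℝ)..t, ‖F s‖ ^ 2 ≤ ∫ s in (0 : ℝ)..T, ‖F s‖ ^ 2 :=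
    intervalIntegral.integral_mono_interval le_rfl ht.1 ht.2
      (Filter.Eventually.of_forall fun s => sq_nonneg _) (hF2.intervalIntegrable _ _)
  have hI0 : 0 ≤ ∫ s in (0 : ℝ)..T, ‖F s‖ ^ 2 :=
    intervalIntegral.integral_nonneg (ht.1.trans ht.2) fun s _ => sq_nonneg _
  have hE0 : 0 ≤ E 0 := by simp only [hE]; positivity
  have h3 : E t = Real.exp t * (Real.exp (-t) * E t) := by
    rw [← mul_assoc, ← Real.exp_add]; simp
  change E t ≤ Real.exp T * (E 0 + _)
  rw [h3]
  calc _ ≤ Real.exp t * (E 0 + ∫ s in (0 : ℝ)..T, ‖F s‖ ^ 2) :=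
        mul_le_mul_of_nonneg_left (by linarith) (Real.exp_pos _).le
    _ ≤ _ := mul_le_mul_of_nonneg_right (Real.exp_le_exp.2 ht.2) (by positivity)

/-- Variation of constants. -/
lemma exists_hasDerivAt_linear {E : Type*} [NormedAddCommGroup E] [NormedSpace ℝ E]
    [CompleteSpace E] (A : E →L[ℝ] E) {φ : ℝ → E} (hφ : Continuous φ) (x₀ : E) :
    ∃ x : ℝ → E, x 0 = x₀ ∧ ∀ t, HasDerivAt x (A (x t) + φ t) t := by
  set S : ℝ → (E →L[ℝ] E) := fun t => NormedSpace.exp (t • A) with hS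
  have hSd : ∀ t, HasDerivAt S (A * S t) t := fun t => hasDerivAt_exp_smul_const' (𝕂 := ℝ) A t
  have hSc : Continuous S := continuous_iff_continuousAt.2 fun t => (hSd t).continuousAt
  have hinv : ∀ t, S t * S (-t) = 1 := by
    intro t
    let : NormedAlgebra ℚ (E →L[ℝ] E) := NormedAlgebra.restrictScalars ℚ ℝ _
    simp only [hS]
    rw [← NormedSpace.exp_add_of_commute]
    · simp
    · exact ((Commute.refl A).smul_left t).smul_right (-t)
  have hf : Continuous fun s => S (-s) (φ s) := (hSc.comp continuous_neg).clm_apply hφ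
  set z : ℝ → E := fun t => x₀ + ∫ s in (0 : ℝ)..t, S (-s) (φ s) with hz
  have hzd : ∀ t, HasDerivAt z (S (-t) (φ t)) t := fun t =>
    (hf.integral_hasStrictDerivAt 0 t).hasDerivAt.const_add _
  refine ⟨fun t => S t (z t), by simp [hz, hS], fun t => ?_⟩
  refine ((hSd t).clm_apply (hzd t)).congr_deriv ?_
  rw [← mul_apply_eq_comp (S t), hinv]
  rfl

lemma exists_oscillator (b c : ℝ) {F : ℝ → 𝕜} (hF : Continuous F) (y₀ y₁ : 𝕜) :
    ∃ y v : ℝ → 𝕜, y 0 = y₀ ∧ v 0 = y₁ ∧ (∀ t, HasDerivAt y (v t) t) ∧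
      ∀ t, HasDerivAt v (F t - (b : 𝕜) * v t - (c : 𝕜) * y t) t := by
  obtain ⟨x, hx0, hxd⟩ := exists_hasDerivAt_linear
    ((ContinuousLinearMap.snd ℝ 𝕜 𝕜).prod
      (-(b • ContinuousLinearMap.snd ℝ 𝕜 𝕜) - c • ContinuousLinearMap.fst ℝ 𝕜 𝕜))
    (continuous_const.prodMk hF : Continuous fun t => ((0 : 𝕜), F t)) (y₀, y₁)
  refine ⟨fun t => (x t).1, fun t => (x t).2, by simp only [hx0], by simp only [hx0],
    fun t => ?_, fun t => ?_⟩
  · refine ((hasFDerivAt_fst (𝕜 := ℝ)).comp_hasDerivAt t (hxd t)).congr_deriv ?_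
    simp
  · refine ((hasFDerivAt_snd (𝕜 := ℝ)).comp_hasDerivAt t (hxd t)).congr_deriv ?_
    simp [RCLike.real_smul_eq_coe_mul]; ring

end Oscillator

/-! ### The damped beam with a continuous forcing -/

section Evolution

variable {𝕜 : Type*} [RCLike 𝕜]

lemma sineCoeff_add (n : ℕ) (w w' : BeamL2 𝕜) :
    sineCoeff n (w + w') = sineCoeff n w + sineCoeff n w' := by
  simp only [sineCoeff_eq_inner, inner_add_right]

lemma sineCoeff_sub (n : ℕ) (w w' : BeamL2 𝕜) :
    sineCoeff n (w - w') = sineCoeff n w - sineCoeff n w' := by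
  simp only [sineCoeff_eq_inner, inner_sub_right]

lemma sineCoeff_smul (n : ℕ) (a : 𝕜) (w : BeamL2 𝕜) :
    sineCoeff n (a • w) = a * sineCoeff n w := by
  simp only [sineCoeff_eq_inner, inner_smul_right]

lemma sineCoeff_sum {ι : Type*} (n : ℕ) (s : Finset ι) (w : ι → BeamL2 𝕜) :
    sineCoeff n (∑ i ∈ s, w i) = ∑ i ∈ s, sineCoeff n (w i) := by
  simp only [sineCoeff_eq_inner, inner_sum]

lemma sineCoeff_sineVec (m n : ℕ) (hm : 1 ≤ m) :
    sineCoeff m (sineVec 𝕜 n) = if m = n then 1 else 0 := by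
  rw [sineCoeff_eq_inner, inner_sineVec m n hm]

lemma ContinuousOn.sineCoeff {w : ℝ → BeamL2 𝕜} {s : Set ℝ} (hw : ContinuousOn w s) (n : ℕ) :
    ContinuousOn (fun t => sineCoeff n (w t)) s := by
  simp only [sineCoeff_eq_inner]
  exact continuousOn_const.inner hw

lemma inner_intervalIntegral (ψ : BeamL2 𝕜) {w : ℝ → BeamL2 𝕜} {a b : ℝ}
    (hw : IntervalIntegrable w volume a b) :
    inner 𝕜 ψ (∫ s in a..b, w s) = ∫ s in a..b, inner 𝕜 ψ (w s) :=
  ((innerSL 𝕜 ψ).intervalIntegral_comp_comm hw).symm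

lemma sineCoeff_intervalIntegral (n : ℕ) {w : ℝ → BeamL2 𝕜} {a b : ℝ}
    (hw : IntervalIntegrable w volume a b) :
    sineCoeff n (∫ s in a..b, w s) = ∫ s in a..b, sineCoeff n (w s) := by
  simp only [sineCoeff_eq_inner]
  exact inner_intervalIntegral _ hw

lemma hasSum_ite_lt {D : ℕ → ℝ} (hD : Summable D) (N : ℕ) :
    HasSum (fun i => if i < N then 0 else D i) ((∑' i, D i) - ∑ i ∈ Finset.range N, D i) := by
  have h3 : HasSum (fun i => if i ∈ Finset.range N then D i else 0)
      (∑ i ∈ Finset.range N, (if i ∈ Finset.range N then D i else 0)) :=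
    hasSum_sum_of_ne_finset_zero fun i hi => if_neg hi
  rw [Finset.sum_ite_mem, Finset.inter_self] at h3
  have e : (fun i => if i < N then 0 else D i)
      = fun i => D i - if i ∈ Finset.range N then D i else 0 := by
    funext i
    by_cases h : i < N <;> simp [h]
  rw [e]
  exact hD.hasSum.sub h3

/-- Continuous coefficients with a summable square bound define a continuous curve. -/
lemma exists_continuousOn_of_coeff {S : Set ℝ} {c : ℕ → ℝ → 𝕜} {D : ℕ → ℝ}
    (hc : ∀ i, ContinuousOn (c i) S) (hD : Summable D) (hcD : ∀ i, ∀ t ∈ S, ‖c i t‖ ^ 2 ≤ D i) :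
    ∃ w : ℝ → BeamL2 𝕜, ContinuousOn w S ∧ ∀ t ∈ S, ∀ i, sineCoeff (i + 1) (w t) = c i t := by
  have hex : ∀ t, ∃ w : BeamL2 𝕜, t ∈ S → ∀ i, sineCoeff (i + 1) w = c i t := by
    intro t
    by_cases ht : t ∈ S
    · obtain ⟨w, hw⟩ := exists_of_coeff
        (Summable.of_nonneg_of_le (fun i => sq_nonneg _) (fun i => hcD i t ht) hD)
      exact ⟨w, fun _ => hw⟩
    · exact ⟨0, fun h => absurd h ht⟩
  choose w hw using hex
  refine ⟨w, ?_, hw⟩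
  set p : ℕ → ℝ → BeamL2 𝕜 := fun N t => ∑ i ∈ Finset.range N, c i t • sineVec 𝕜 (i + 1) with hp
  have hpc : ∀ N, ContinuousOn (p N) S := fun N =>
    continuousOn_finsetSum _ fun i _ => (hc i).smul continuousOn_const
  have hD0 : ∀ t ∈ S, ∀ i, 0 ≤ D i := fun t ht i => (sq_nonneg _).trans (hcD i t ht)
  have hcoef : ∀ N, ∀ t ∈ S, ∀ i, sineCoeff (i + 1) (w t - p N t)
      = if i < N then 0 else c i t := by
    intro N t ht i
    rw [sineCoeff_sub, hw t ht, hp, sineCoeff_sum]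
    have : ∀ j, sineCoeff (i + 1) (c j t • sineVec 𝕜 (j + 1)) = if i = j then c j t else 0 := by
      intro j
      rw [sineCoeff_smul, sineCoeff_sineVec _ _ (by omega)]
      by_cases h : i = j <;> simp [h]
    simp_rw [this]
    rw [Finset.sum_ite_eq]
    by_cases h : i < N <;> simp [h]
  have hbound : ∀ N, ∀ t ∈ S, ‖w t - p N t‖ ^ 2 ≤ (∑' i, D i) - ∑ i ∈ Finset.range N, D i := by
    intro N t ht
    have h1 := hasSum_norm_sineCoeff_sq (w t - p N t)
    have h2 := hasSum_ite_lt hD N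
    refine hasSum_le (fun i => ?_) h1 h2
    rw [hcoef N t ht]
    by_cases h : i < N
    · simp [h]
    · simpa [h] using hcD i t ht
  have hunif : TendstoUniformlyOn p w Filter.atTop S := by
    rw [Metric.tendstoUniformlyOn_iff]
    intro ε hε
    have h1 : Filter.Tendsto (fun N => (∑' i, D i) - ∑ i ∈ Finset.range N, D i) Filter.atTop
        (nhds 0) := by
      simpa using (tendsto_const_nhds (x := ∑' i, D i)).sub hD.hasSum.tendsto_sum_nat
    filter_upwards [h1.eventually_lt_const (show 0 < ε ^ 2 by positivity)] with N hN t ht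
    rw [dist_eq_norm]
    exact lt_of_pow_lt_pow_left₀ 2 hε.le ((hbound N t ht).trans_lt hN)
  exact hunif.continuousOn (Filter.Frequently.of_forall hpc)

end Evolution


section Evolution

variable {𝕜 : Type*} [RCLike 𝕜]

lemma summable_integral_norm_sineCoeff_sq {F : ℝ → BeamL2 𝕜} (hF : Continuous F) {T : ℝ}
    (hT : 0 ≤ T) :
    Summable fun i => ∫ s in (0 : ℝ)..T, ‖sineCoeff (i + 1) (F s)‖ ^ 2 := by
  have hc : ∀ n, Continuous fun s => ‖sineCoeff n (F s)‖ ^ 2 := by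
    intro n
    simp only [sineCoeff_eq_inner]
    exact ((continuous_const.inner hF).norm).pow 2
  refine summable_of_sum_le (c := ∫ s in (0 : ℝ)..T, ‖F s‖ ^ 2)
    (fun i => intervalIntegral.integral_nonneg hT fun s _ => sq_nonneg _) fun s => ?_
  rw [← intervalIntegral.integral_finsetSum fun i _ => (hc (i + 1)).intervalIntegrable _ _]
  refine intervalIntegral.integral_mono_on hT
    ((continuous_finsetSum _ fun i _ => hc (i + 1)).intervalIntegrable _ _)
    ((by fun_prop : Continuous fun s => ‖F s‖ ^ 2).intervalIntegrable _ _) fun t _ => ?_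
  have h := hasSum_norm_sineCoeff_sq (F t)
  exact sum_le_hasSum s (fun i _ => sq_nonneg _) h

lemma hasDerivWithinAt_of_eq_integral {E : Type*} [NormedAddCommGroup E] [NormedSpace ℝ E]
    [CompleteSpace E] {x q : ℝ → E} {T : ℝ} (hq : ContinuousOn q (Icc (0 : ℝ) T))
    (h : ∀ t ∈ Icc (0 : ℝ) T, x t = x 0 + ∫ s in (0 : ℝ)..t, q s) {t : ℝ}
    (ht : t ∈ Icc (0 : ℝ) T) : HasDerivWithinAt x (q t) (Icc (0 : ℝ) T) t := by
  have hT : (0 : ℝ) ≤ T := ht.1.trans ht.2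
  set q' : ℝ → E := fun s => q (projIcc 0 T hT s) with hq'
  have hqc : Continuous q' :=
    hq.comp_continuous (continuous_subtype_val.comp continuous_projIcc) fun x => Subtype.mem _
  have hqv : ∀ s ∈ Icc (0 : ℝ) T, q' s = q s := fun s hs => by
    simp only [hq', projIcc_of_mem hT hs]
  have hu : ∀ s ∈ Icc (0 : ℝ) T, x s = x 0 + ∫ z in (0 : ℝ)..s, q' z := by
    intro s hs
    rw [h s hs]
    congr 1
    refine intervalIntegral.integral_congr fun z hz => ?_
    rw [uIcc_of_le hs.1] at hz
    simp only [hqv z ⟨hz.1, hz.2.trans hs.2⟩]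
  have hd : HasDerivAt (fun s => x 0 + ∫ z in (0 : ℝ)..s, q' z) (q' t) t :=
    (hqc.integral_hasStrictDerivAt 0 t).hasDerivAt.const_add _
  rw [← hqv t ht]
  exact hd.hasDerivWithinAt.congr hu (hu t ht)

/-- The structurally damped beam with a forcing in `C([0, T]; X⁰)` has a weak solution, given by
the series of its modes. -/
lemma exists_evolution {α ρ T : ℝ} (hρ : 0 ≤ ρ) (hT : 0 < T) {F : ℝ → BeamL2 𝕜}
    (hF : Continuous F) {u₀ Δu₀ u₁ : BeamL2 𝕜} (hu₀ : IsDirichletLaplacian u₀ Δu₀) :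
    ∃ u v w : ℝ → BeamL2 𝕜, u 0 = u₀ ∧ v 0 = u₁ ∧
      (∀ t ∈ Icc (0 : ℝ) T, HasDerivWithinAt u (v t) (Icc (0 : ℝ) T) t) ∧
      ContinuousOn v (Icc (0 : ℝ) T) ∧ ContinuousOn w (Icc (0 : ℝ) T) ∧
      (∀ t ∈ Icc (0 : ℝ) T, IsDirichletLaplacian (u t) (w t)) ∧
      ∀ ψ ψΔ ψα : BeamL2 𝕜, IsDirichletLaplacian ψ ψΔ → IsLaplacianPower α ψ ψα →
        ∀ t ∈ Icc (0 : ℝ) T,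
          inner 𝕜 ψ (v t) - inner 𝕜 ψ u₁
            + ∫ s in (0 : ℝ)..t, (inner 𝕜 ψΔ (w s) + (ρ : 𝕜) * inner 𝕜 ψα (v s))
          = inner 𝕜 ψ (∫ s in (0 : ℝ)..t, F s) := by
  set b : ℕ → ℝ := fun i => modeDamping α ρ (i + 1) with hb
  set c : ℕ → ℝ := fun i => ((i + 1 : ℕ) : ℝ) ^ 4 with hc
  have hc1 : ∀ i, 1 ≤ c i := fun i => one_le_pow₀ (by push_cast; linarith [Nat.cast_nonneg (α := ℝ) i])
  have hb0 : ∀ i, 0 ≤ b i := fun i => mul_nonneg hρ (Real.rpow_nonneg (Nat.cast_nonneg _) _)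
  have hFc : ∀ i, Continuous fun s => sineCoeff (i + 1) (F s) := by
    intro i
    simp only [sineCoeff_eq_inner]
    exact continuous_const.inner hF
  have hex := fun i => exists_oscillator (b i) (c i) (hFc i) (sineCoeff (i + 1) u₀)
    (sineCoeff (i + 1) u₁)
  choose Y V hY0 hV0 hY hV using hex
  set D : ℕ → ℝ := fun i => Real.exp T * (c i * ‖sineCoeff (i + 1) u₀‖ ^ 2
    + ‖sineCoeff (i + 1) u₁‖ ^ 2 + ∫ s in (0 : ℝ)..T, ‖sineCoeff (i + 1) (F s)‖ ^ 2) with hD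
  have hcs : ∀ i (z : 𝕜), ‖((((i + 1 : ℕ) : ℝ) ^ 2 : ℝ) : 𝕜) * z‖ ^ 2 = c i * ‖z‖ ^ 2 := by
    intro i z
    rw [norm_mul, RCLike.norm_ofReal, abs_of_nonneg (by positivity), mul_pow, ← pow_mul]
  have hDs : Summable D := by
    refine Summable.mul_left _ ((Summable.add ?_ (hasSum_norm_sineCoeff_sq u₁).summable).add
      (summable_integral_norm_sineCoeff_sq hF hT.le))
    refine (hasSum_norm_sineCoeff_sq Δu₀).summable.congr fun i => ?_
    rw [hu₀.coeff_eq (by omega : 1 ≤ i + 1), hcs]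
  have hen : ∀ i, ∀ t ∈ Icc (0 : ℝ) T, c i * ‖Y i t‖ ^ 2 + ‖V i t‖ ^ 2 ≤ D i := by
    intro i t ht
    have := oscillator_energy_le (hb0 i) (zero_le_one.trans (hc1 i)) (hFc i)
      (fun t _ => (hY i t).hasDerivWithinAt) (fun t _ => (hV i t).hasDerivWithinAt) ht
    rwa [hY0, hV0] at this
  have hYc : ∀ i, Continuous (Y i) := fun i =>
    continuous_iff_continuousAt.2 fun t => (hY i t).continuousAt
  have hVc : ∀ i, Continuous (V i) := fun i =>
    continuous_iff_continuousAt.2 fun t => (hV i t).continuousAt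
  obtain ⟨u, huc, hu⟩ := exists_continuousOn_of_coeff (S := Icc (0 : ℝ) T)
    (fun i => (hYc i).continuousOn) hDs fun i t ht => by
      have h1 := hen i t ht
      have h2 := mul_le_mul_of_nonneg_right (hc1 i) (sq_nonneg ‖Y i t‖)
      nlinarith [sq_nonneg ‖V i t‖]
  obtain ⟨v, hvc, hv⟩ := exists_continuousOn_of_coeff (S := Icc (0 : ℝ) T)
    (fun i => (hVc i).continuousOn) hDs fun i t ht => by
      have h1 := hen i t ht
      have h2 : 0 ≤ c i * ‖Y i t‖ ^ 2 := by positivity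
      linarith
  obtain ⟨w, hwc, hw⟩ := exists_continuousOn_of_coeff (S := Icc (0 : ℝ) T)
    (c := fun i t => ((((i + 1 : ℕ) : ℝ) ^ 2 : ℝ) : 𝕜) * Y i t)
    (fun i => (continuous_const.mul (hYc i)).continuousOn) hDs fun i t ht => by
      rw [hcs]
      linarith [hen i t ht, sq_nonneg ‖V i t‖]
  have h0 : (0 : ℝ) ∈ Icc (0 : ℝ) T := ⟨le_rfl, hT.le⟩
  refine ⟨u, v, w, ext_sineCoeff fun i => by rw [hu 0 h0, hY0],
    ext_sineCoeff fun i => by rw [hv 0 h0, hV0], ?_, hvc, hwc, ?_, ?_⟩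
  · intro t ht
    refine hasDerivWithinAt_of_eq_integral hvc (fun t ht => ext_sineCoeff fun i => ?_) ht
    have hvi : IntervalIntegrable v volume 0 t := by
      refine ContinuousOn.intervalIntegrable (hvc.mono ?_)
      rw [uIcc_of_le ht.1]; exact Icc_subset_Icc le_rfl ht.2
    have e : ∫ s in (0 : ℝ)..t, sineCoeff (i + 1) (v s) = ∫ s in (0 : ℝ)..t, V i s := by
      refine intervalIntegral.integral_congr fun z hz => ?_
      rw [uIcc_of_le ht.1] at hz
      exact hv z ⟨hz.1, hz.2.trans ht.2⟩ i
    rw [sineCoeff_add, sineCoeff_intervalIntegral _ hvi, hu t ht, hu 0 h0, e,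
      intervalIntegral.integral_eq_sub_of_hasDerivAt (fun x _ => hY i x)
      ((hVc i).intervalIntegrable _ _)]
    ring
  · intro t ht
    refine isDirichletLaplacian_of_sineCoeff fun i => ?_
    rw [hw t ht, hu t ht]
  · intro ψ ψΔ ψα hψΔ hψα t ht
    have hsub : uIcc 0 t ⊆ Icc 0 T := by
      rw [uIcc_of_le ht.1]; exact Icc_subset_Icc le_rfl ht.2
    have hwi : IntervalIntegrable w volume 0 t := (hwc.mono hsub).intervalIntegrable
    have hvi : IntervalIntegrable v volume 0 t := (hvc.mono hsub).intervalIntegrable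
    have hiw : IntervalIntegrable (fun s => inner 𝕜 ψΔ (w s)) volume 0 t :=
      (continuousOn_const.inner (hwc.mono hsub)).intervalIntegrable
    have hiv : IntervalIntegrable (fun s => inner 𝕜 ψα (v s)) volume 0 t :=
      (continuousOn_const.inner (hvc.mono hsub)).intervalIntegrable
    rw [intervalIntegral.integral_add hiw (hiv.const_mul _),
      intervalIntegral.integral_const_mul, ← inner_intervalIntegral _ hwi,
      ← inner_intervalIntegral _ hvi]
    have hsum := (((hasSum_sineCoeff_mul ψ (v t)).sub (hasSum_sineCoeff_mul ψ u₁)).add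
      ((hasSum_sineCoeff_mul ψΔ (∫ s in (0 : ℝ)..t, w s)).add
        ((hasSum_sineCoeff_mul ψα (∫ s in (0 : ℝ)..t, v s)).mul_left (ρ : 𝕜))))
    have hint : ∀ i, V i t - V i 0 = (∫ s in (0 : ℝ)..t, sineCoeff (i + 1) (F s))
        - (b i : 𝕜) * (∫ s in (0 : ℝ)..t, V i s) - (c i : 𝕜) * ∫ s in (0 : ℝ)..t, Y i s := by
      intro i
      have i1 := (hFc i).intervalIntegrable (μ := volume) 0 t
      have i2 : IntervalIntegrable (fun s => (b i : 𝕜) * V i s) volume 0 t :=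
        (continuous_const.mul (hVc i)).intervalIntegrable _ _
      have i3 : IntervalIntegrable (fun s => (c i : 𝕜) * Y i s) volume 0 t :=
        (continuous_const.mul (hYc i)).intervalIntegrable _ _
      rw [← intervalIntegral.integral_eq_sub_of_hasDerivAt (fun x _ => hV i x)
        ((i1.sub i2).sub i3), intervalIntegral.integral_sub (i1.sub i2) i3,
        intervalIntegral.integral_sub i1 i2, intervalIntegral.integral_const_mul,
        intervalIntegral.integral_const_mul]
    have hterm : ∀ i, (starRingEnd 𝕜) (sineCoeff (i + 1) ψ) * sineCoeff (i + 1) (v t) -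
        (starRingEnd 𝕜) (sineCoeff (i + 1) ψ) * sineCoeff (i + 1) u₁ +
      ((starRingEnd 𝕜) (sineCoeff (i + 1) ψΔ) * sineCoeff (i + 1) (∫ s in (0 : ℝ)..t, w s) +
        (ρ : 𝕜) * ((starRingEnd 𝕜) (sineCoeff (i + 1) ψα)
          * sineCoeff (i + 1) (∫ s in (0 : ℝ)..t, v s))) =
      (starRingEnd 𝕜) (sineCoeff (i + 1) ψ) * sineCoeff (i + 1) (∫ s in (0 : ℝ)..t, F s) := by
      intro i
      have ew : ∫ s in (0 : ℝ)..t, sineCoeff (i + 1) (w s)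
          = ((((i + 1 : ℕ) : ℝ) ^ 2 : ℝ) : 𝕜) * ∫ s in (0 : ℝ)..t, Y i s := by
        rw [← intervalIntegral.integral_const_mul]
        refine intervalIntegral.integral_congr fun z hz => ?_
        exact hw z (hsub hz) i
      have ev : ∫ s in (0 : ℝ)..t, sineCoeff (i + 1) (v s) = ∫ s in (0 : ℝ)..t, V i s :=
        intervalIntegral.integral_congr fun z hz => hv z (hsub hz) i
      rw [sineCoeff_intervalIntegral _ hwi, sineCoeff_intervalIntegral _ hvi,
        sineCoeff_intervalIntegral _ (hF.intervalIntegrable _ _), ew, ev, hv t ht, ← hV0,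
        hψΔ.coeff_eq (by omega : 1 ≤ i + 1), hψα (i + 1) (by omega), map_mul, map_mul,
        RCLike.conj_ofReal, RCLike.conj_ofReal]
      have e1 : (b i : 𝕜) = (ρ : 𝕜) * ((((i + 1 : ℕ) : ℝ) ^ (2 * α) : ℝ) : 𝕜) := by
        rw [← RCLike.ofReal_mul]; rfl
      have e2 : (c i : 𝕜) = ((((i + 1 : ℕ) : ℝ) ^ 2 : ℝ) : 𝕜) * ((((i + 1 : ℕ) : ℝ) ^ 2 : ℝ) : 𝕜) := by
        rw [← RCLike.ofReal_mul]; congr 1; simp only [hc]; ring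
      have h3 := hint i
      rw [e1, e2] at h3
      linear_combination (starRingEnd 𝕜) (sineCoeff (i + 1) ψ) * h3
    rw [funext hterm] at hsum
    exact hsum.unique (hasSum_sineCoeff_mul ψ (∫ s in (0 : ℝ)..t, F s))

/-- Each mode of a weak solution is a forced oscillator. -/
lemma IsBeamSolution.mode {α ρ T : ℝ} {Ω : Set ℝ} {f : ControlL2 𝕜 Ω T} {u₀ u₁ : BeamL2 𝕜}
    {u v : ℝ → BeamL2 𝕜} (h : IsBeamSolution α ρ Ω T f u₀ u₁ u v) {F : ℝ → BeamL2 𝕜}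
    (hF : Continuous F)
    (hfF : ∀ (ψ : BeamL2 𝕜), ∀ t ∈ Icc (0 : ℝ) T,
      ∫ z in Ω ×ˢ Ioo (0 : ℝ) t, (starRingEnd 𝕜) (ψ z.1) * f z
        = inner 𝕜 ψ (∫ s in (0 : ℝ)..t, F s))
    {m : ℕ} (hm : 1 ≤ m) {t : ℝ} (ht : t ∈ Icc (0 : ℝ) T) :
    HasDerivWithinAt (fun t => sineCoeff m (u t)) (sineCoeff m (v t)) (Icc (0 : ℝ) T) t ∧
      HasDerivWithinAt (fun t => sineCoeff m (v t))
        (sineCoeff m (F t) - (modeDamping α ρ m : 𝕜) * sineCoeff m (v t)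
          - (((m : ℝ) ^ 4 : ℝ) : 𝕜) * sineCoeff m (u t)) (Icc (0 : ℝ) T) t := by
  have hT : (0 : ℝ) ≤ T := ht.1.trans ht.2
  obtain ⟨w, hwc, hw, hweak⟩ := h.weak_form
  have huc : ContinuousOn u (Icc (0 : ℝ) T) := fun t ht => (h.hasDeriv t ht).continuousWithinAt
  refine ⟨?_, ?_⟩
  · simp only [sineCoeff_eq_inner]
    exact (innerSL 𝕜 (sineVec 𝕜 m)).restrictScalars ℝ |>.hasFDerivAt.comp_hasDerivWithinAt t
      (h.hasDeriv t ht)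
  have hΔ : IsDirichletLaplacian (sineVec 𝕜 m) ((((m : ℝ) ^ 2 : ℝ) : 𝕜) • sineVec 𝕜 m) := by
    refine isDirichletLaplacian_of_sineCoeff fun i => ?_
    rw [sineCoeff_smul, sineCoeff_sineVec _ _ (by omega)]
    by_cases h : i + 1 = m
    · rw [if_pos h, h]
    · rw [if_neg h, mul_zero, mul_zero]
  have hα : IsLaplacianPower α (sineVec 𝕜 m)
      ((((m : ℝ) ^ (2 * α) : ℝ) : 𝕜) • sineVec 𝕜 m) := by
    intro n hn
    rw [sineCoeff_smul, sineCoeff_sineVec _ _ hn]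
    by_cases h : n = m
    · rw [if_pos h, h]
    · rw [if_neg h, mul_zero, mul_zero]
  have hFm : ContinuousOn (fun s => sineCoeff m (F s)) (Icc (0 : ℝ) T) := hF.continuousOn.sineCoeff m
  have hqc : ContinuousOn (fun t => sineCoeff m (F t) - (modeDamping α ρ m : 𝕜) * sineCoeff m (v t)
      - (((m : ℝ) ^ 4 : ℝ) : 𝕜) * sineCoeff m (u t)) (Icc (0 : ℝ) T) :=
    (hFm.sub (continuousOn_const.mul (h.cont_vel.sineCoeff m))).sub
      (continuousOn_const.mul (huc.sineCoeff m))
  refine hasDerivWithinAt_of_eq_integral hqc (fun t ht => ?_) ht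
  have hsub : uIcc 0 t ⊆ Icc 0 T := by
    rw [uIcc_of_le ht.1]; exact Icc_subset_Icc le_rfl ht.2
  have hwt := hweak _ _ _ hΔ hα t ht
  rw [hfF _ t ht, ← sineCoeff_eq_inner, ← sineCoeff_eq_inner, ← sineCoeff_eq_inner,
    sineCoeff_intervalIntegral _ (hF.intervalIntegrable _ _)] at hwt
  set q : ℝ → 𝕜 := fun s => (modeDamping α ρ m : 𝕜) * sineCoeff m (v s)
    + (((m : ℝ) ^ 4 : ℝ) : 𝕜) * sineCoeff m (u s) with hq
  have e1 : ∫ s in (0 : ℝ)..t, (inner 𝕜 ((((m : ℝ) ^ 2 : ℝ) : 𝕜) • sineVec 𝕜 m) (w s)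
      + (ρ : 𝕜) * inner 𝕜 ((((m : ℝ) ^ (2 * α) : ℝ) : 𝕜) • sineVec 𝕜 m) (v s))
      = ∫ s in (0 : ℝ)..t, q s := by
    refine intervalIntegral.integral_congr fun z hz => ?_
    simp only [hq]
    rw [inner_smul_left, inner_smul_left, RCLike.conj_ofReal, RCLike.conj_ofReal,
      ← sineCoeff_eq_inner, ← sineCoeff_eq_inner, (hw z (hsub hz)).coeff_eq hm]
    unfold modeDamping
    push_cast
    ring
  have e2 : ∫ s in (0 : ℝ)..t, (sineCoeff m (F s) - (modeDamping α ρ m : 𝕜) * sineCoeff m (v s)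
      - (((m : ℝ) ^ 4 : ℝ) : 𝕜) * sineCoeff m (u s))
      = (∫ s in (0 : ℝ)..t, sineCoeff m (F s)) - ∫ s in (0 : ℝ)..t, q s := by
    rw [← intervalIntegral.integral_sub]
    · refine intervalIntegral.integral_congr fun z hz => ?_
      simp only [hq]; ring
    · exact (hFm.mono hsub).intervalIntegrable
    · refine ContinuousOn.intervalIntegrable (ContinuousOn.mono ?_ hsub)
      exact (continuousOn_const.mul (h.cont_vel.sineCoeff m)).add
        (continuousOn_const.mul (huc.sineCoeff m))
  rw [e1] at hwt
  rw [e2, h.init_vel]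
  linear_combination hwt

end Evolution


/-! ### Controls supported in the region -/

section Region

variable {𝕜 : Type*} [RCLike 𝕜]

/-- Multiplication by the characteristic function of `Ω`, written as `R† R` with `R` the
restriction `L²(0, π) → L²(Ω)`. -/
def regionOp (𝕜 : Type*) [RCLike 𝕜] (Ω : Set ℝ) : BeamL2 𝕜 →L[𝕜] BeamL2 𝕜 :=
  (ContinuousLinearMap.adjoint
    (LpToLpRestrictCLM ℝ 𝕜 𝕜 (volume.restrict (Ioo (0 : ℝ) Real.pi)) 2 Ω)).comp
    (LpToLpRestrictCLM ℝ 𝕜 𝕜 (volume.restrict (Ioo (0 : ℝ) Real.pi)) 2 Ω)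

lemma inner_regionOp {Ω : Set ℝ} (hΩ : MeasurableSet Ω) (hsub : Ω ⊆ Ioo (0 : ℝ) Real.pi)
    (ψ φ : BeamL2 𝕜) :
    inner 𝕜 ψ (regionOp 𝕜 Ω φ) = ∫ x in Ω, (starRingEnd 𝕜) (ψ x) * φ x := by
  unfold regionOp
  rw [ContinuousLinearMap.comp_apply, ContinuousLinearMap.adjoint_inner_right, L2.inner_def]
  have hμ : (volume.restrict (Ioo (0 : ℝ) Real.pi)).restrict Ω = volume.restrict Ω := by
    rw [Measure.restrict_restrict hΩ, inter_eq_left.2 hsub]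
  rw [← hμ]
  refine integral_congr_ae ?_
  filter_upwards [LpToLpRestrictCLM_coeFn 𝕜 Ω ψ, LpToLpRestrictCLM_coeFn 𝕜 Ω φ] with x h1 h2
  rw [h1, h2, RCLike.inner_apply, mul_comm]

lemma inner_regionOp_left (Ω : Set ℝ) (ψ φ : BeamL2 𝕜) :
    inner 𝕜 (regionOp 𝕜 Ω ψ) φ = inner 𝕜 ψ (regionOp 𝕜 Ω φ) := by
  unfold regionOp
  rw [ContinuousLinearMap.comp_apply, ContinuousLinearMap.comp_apply,
    ContinuousLinearMap.adjoint_inner_right, ContinuousLinearMap.adjoint_inner_left]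

lemma inner_regionOp_sineVec {Ω : Set ℝ} (hΩ : MeasurableSet Ω)
    (hsub : Ω ⊆ Ioo (0 : ℝ) Real.pi) (j k : ℕ) :
    inner 𝕜 (sineVec 𝕜 j) (regionOp 𝕜 Ω (sineVec 𝕜 k))
      = ((∫ x in Ω, sineFun k x * sineFun j x : ℝ) : 𝕜) := by
  rw [inner_regionOp hΩ hsub, ← integral_ofReal]
  refine integral_congr_ae ?_
  filter_upwards [ae_restrict_of_ae_restrict_of_subset hsub (coeFn_sineVec (𝕜 := 𝕜) j),
    ae_restrict_of_ae_restrict_of_subset hsub (coeFn_sineVec (𝕜 := 𝕜) k)] with x h1 h2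
  rw [h1, h2, RCLike.conj_ofReal, ← RCLike.ofReal_mul, mul_comm]

lemma memLp_tensor {a b : ℝ → 𝕜} (ha : MemLp a 2 volume) (hb : MemLp b 2 volume) :
    MemLp (fun z : ℝ × ℝ => a z.1 * b z.2) 2 volume := by
  have hm : AEStronglyMeasurable (fun z : ℝ × ℝ => a z.1 * b z.2) volume := by
    rw [Measure.volume_eq_prod]
    exact ha.1.comp_fst.mul hb.1.comp_snd
  rw [memLp_two_iff_integrable_sq_norm hm]
  have h1 := (memLp_two_iff_integrable_sq_norm ha.1).1 ha
  have h2 := (memLp_two_iff_integrable_sq_norm hb.1).1 hb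
  have h3 := h1.mul_prod h2
  simp_rw [norm_mul, mul_pow]
  exact h3

lemma inner_tensor {a b a' b' : ℝ → 𝕜} (ha : MemLp a 2 volume) (hb : MemLp b 2 volume)
    (ha' : MemLp a' 2 volume) (hb' : MemLp b' 2 volume) :
    inner 𝕜 ((memLp_tensor ha hb).toLp _) ((memLp_tensor ha' hb').toLp _)
      = (∫ x, (starRingEnd 𝕜) (a x) * a' x) * ∫ t, (starRingEnd 𝕜) (b t) * b' t := by
  rw [L2.inner_def, ← integral_prod_mul]
  refine integral_congr_ae ?_
  filter_upwards [(memLp_tensor ha hb).coeFn_toLp, (memLp_tensor ha' hb').coeFn_toLp] with z h1 h2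
  rw [h1, h2, RCLike.inner_apply, map_mul]
  ring

/-- Orthogonal series with square-summable terms converge. -/
lemma exists_hasSum_of_orthogonal {H : Type*} [NormedAddCommGroup H] [InnerProductSpace 𝕜 H]
    [CompleteSpace H] {h : ℕ → H} (ho : ∀ i j, i ≠ j → inner 𝕜 (h i) (h j) = 0) {E : ℕ → ℝ}
    (hE : Summable E) (hhE : ∀ i, ‖h i‖ ^ 2 ≤ E i) :
    ∃ F : H, HasSum h F ∧ ‖F‖ ^ 2 ≤ ∑' i, E i := by
  have hpyth : ∀ s : Finset ℕ, ‖∑ i ∈ s, h i‖ ^ 2 = ∑ i ∈ s, ‖h i‖ ^ 2 := by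
    intro s
    rw [← inner_self_eq_norm_sq (𝕜 := 𝕜), sum_inner, map_sum]
    refine Finset.sum_congr rfl fun i hi => ?_
    rw [inner_sum, Finset.sum_eq_single i (fun j _ hj => ho i j hj.symm) fun h => absurd hi h,
      inner_self_eq_norm_sq]
  have hE0 : ∀ i, 0 ≤ E i := fun i => (sq_nonneg _).trans (hhE i)
  have hle : ∀ s : Finset ℕ, ‖∑ i ∈ s, h i‖ ^ 2 ≤ ∑ i ∈ s, E i := fun s => by
    rw [hpyth]; exact Finset.sum_le_sum fun i _ => hhE i
  have hs : Summable h := by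
    rw [summable_iff_vanishing_norm]
    intro ε hε
    obtain ⟨s, hs⟩ := summable_iff_vanishing_norm.1 hE (ε ^ 2) (by positivity)
    refine ⟨s, fun t ht => lt_of_pow_lt_pow_left₀ 2 hε.le ?_⟩
    exact (hle t).trans_lt ((le_abs_self _).trans_lt (hs t ht))
  refine ⟨∑' i, h i, hs.hasSum, ?_⟩
  have hlim := (hs.hasSum.norm).pow 2
  exact le_of_tendsto hlim (Filter.Eventually.of_forall fun s =>
    (hle s).trans (hE.sum_le_tsum s fun i _ => hE0 i))

/-- From square-summable time-dependent coefficients, the control with these coefficients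
restricted to `Ω`, and the forcing of the beam that it produces. -/
lemma exists_control {Ω : Set ℝ} (hΩ : MeasurableSet Ω) (hsub : Ω ⊆ Ioo (0 : ℝ) Real.pi) {T : ℝ}
    {c : ℕ → ℝ → 𝕜} {D : ℕ → ℝ} (hc : ∀ i, Continuous (c i))
    (hc1 : ∀ i t, 1 ≤ t → c i t = 0) (hcD : ∀ i t, ‖c i t‖ ^ 2 ≤ D i) (hD : Summable D) :
    ∃ (f : ControlL2 𝕜 Ω T) (G : ℝ → BeamL2 𝕜), ‖f‖ ^ 2 ≤ ∑' i, D i ∧ Continuous G ∧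
      (∀ i t, sineCoeff (i + 1) (G t) = c i t) ∧
      ∀ (ψ : BeamL2 𝕜), ∀ t ∈ Icc (0 : ℝ) T,
        ∫ z in Ω ×ˢ Ioo (0 : ℝ) t, (starRingEnd 𝕜) (ψ z.1) * f z
          = inner 𝕜 ψ (∫ s in (0 : ℝ)..t, regionOp 𝕜 Ω (G s)) := by
  obtain ⟨G, hGc, hG⟩ := exists_continuousOn_of_coeff (S := univ)
    (fun i => (hc i).continuousOn) hD fun i t _ => hcD i t
  rw [continuousOn_univ] at hGc
  have ha : ∀ i : ℕ, MemLp ((Ioo (0 : ℝ) Real.pi).indicator fun x => (sineFun (i + 1) x : 𝕜)) 2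
      volume := fun i =>
    (memLp_indicator_iff_restrict measurableSet_Ioo).2 (memLp_sineFun (i + 1) _ subset_rfl)
  have hb : ∀ i : ℕ, MemLp ((Ioo (0 : ℝ) T).indicator (c i)) 2 volume := fun i => by
    refine (memLp_indicator_iff_restrict measurableSet_Ioo).2 ?_
    have : IsFiniteMeasure (volume.restrict (Ioo (0 : ℝ) T)) := ⟨by simp⟩
    refine MemLp.of_bound (hc i).aestronglyMeasurable (Real.sqrt (D i))
      (Filter.Eventually.of_forall fun t => ?_)
    exact Real.le_sqrt_of_sq_le (hcD i t)
  set h : ℕ → Lp 𝕜 2 (volume : Measure (ℝ × ℝ)) := fun i =>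
    (memLp_tensor (ha i) (hb i)).toLp _ with hh
  have hprod : ∀ i j, ∫ x, (starRingEnd 𝕜) ((Ioo (0 : ℝ) Real.pi).indicator
      (fun x => (sineFun (i + 1) x : 𝕜)) x) * (Ioo (0 : ℝ) Real.pi).indicator
      (fun x => (sineFun (j + 1) x : 𝕜)) x = if i = j then 1 else 0 := by
    intro i j
    have e : ∀ x, (starRingEnd 𝕜) ((Ioo (0 : ℝ) Real.pi).indicator
        (fun x => (sineFun (i + 1) x : 𝕜)) x) * (Ioo (0 : ℝ) Real.pi).indicator
        (fun x => (sineFun (j + 1) x : 𝕜)) x = (Ioo (0 : ℝ) Real.pi).indicator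
        (fun x => ((sineFun (i + 1) x * sineFun (j + 1) x : ℝ) : 𝕜)) x := by
      intro x
      by_cases hx : x ∈ Ioo (0 : ℝ) Real.pi
      · simp [indicator_of_mem hx]
      · simp [indicator_of_notMem hx]
    simp_rw [e]
    rw [integral_indicator measurableSet_Ioo, integral_ofReal, ← integral_Ioc_eq_integral_Ioo,
      ← intervalIntegral.integral_of_le Real.pi_pos.le, integral_sineFun_mul _ _ (by omega)]
    by_cases hij : i = j <;> simp [hij]
  have ho : ∀ i j, i ≠ j → inner 𝕜 (h i) (h j) = 0 := by
    intro i j hij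
    rw [hh, inner_tensor (ha i) (hb i) (ha j) (hb j), hprod, if_neg hij, zero_mul]
  have hn : ∀ i, ‖h i‖ ^ 2 ≤ D i := by
    intro i
    rw [← inner_self_eq_norm_sq (𝕜 := 𝕜), hh, inner_tensor (ha i) (hb i) (ha i) (hb i), hprod,
      if_pos rfl, one_mul]
    have e : ∀ t, (starRingEnd 𝕜) ((Ioo (0 : ℝ) T).indicator (c i) t)
        * (Ioo (0 : ℝ) T).indicator (c i) t
        = (((Ioo (0 : ℝ) T).indicator (fun t => ‖c i t‖ ^ 2) t : ℝ) : 𝕜) := by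
      intro t
      by_cases ht : t ∈ Ioo (0 : ℝ) T
      · simp [indicator_of_mem ht, RCLike.conj_mul]
      · simp [indicator_of_notMem ht]
    simp_rw [e]
    rw [integral_ofReal, RCLike.ofReal_re]
    calc _ ≤ ∫ t, (Ioc (0 : ℝ) 1).indicator (fun _ => D i) t := by
          refine integral_mono_of_nonneg (Filter.Eventually.of_forall fun t =>
            indicator_nonneg (fun t _ => sq_nonneg _) t) ?_
            (Filter.Eventually.of_forall fun t => ?_)
          · exact (integrable_indicator_iff measurableSet_Ioc).2 (by simp)
          · by_cases ht : t ∈ Ioo (0 : ℝ) T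
            · simp only [indicator_of_mem ht]
              by_cases ht1 : t ≤ 1
              · rw [indicator_of_mem (show t ∈ Ioc (0 : ℝ) 1 from ⟨ht.1, ht1⟩)]
                exact hcD i t
              · rw [hc1 i t (not_le.1 ht1).le, indicator_of_notMem fun h => ht1 h.2]; simp
            · simp only [indicator_of_notMem ht]
              exact indicator_nonneg (fun _ _ => (sq_nonneg _).trans (hcD i t)) t
      _ = D i := by
          rw [integral_indicator measurableSet_Ioc]; simp
  obtain ⟨F, hF, hFn⟩ := exists_hasSum_of_orthogonal ho hD hn
  set f : ControlL2 𝕜 Ω T := LpToLpRestrictCLM (ℝ × ℝ) 𝕜 𝕜 volume 2 (Ω ×ˢ Ioo (0 : ℝ) T) F with hf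
  refine ⟨f, G, ?_, hGc, fun i t => hG t (mem_univ t) i, ?_⟩
  · have h1 : ‖f‖ ≤ ‖F‖ := norm_Lp_toLp_restrict_le _ F
    exact (pow_le_pow_left₀ (norm_nonneg _) h1 2).trans hFn
  intro ψ t ht
  have hψ : MemLp (Ω.indicator ψ) 2 volume :=
    (memLp_indicator_iff_restrict hΩ).2 ((Lp.memLp ψ).mono_measure (Measure.restrict_mono_set _ hsub))
  have h1 : MemLp ((Ioo (0 : ℝ) t).indicator fun _ => (1 : 𝕜)) 2 volume := by
    refine (memLp_indicator_iff_restrict measurableSet_Ioo).2 ?_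
    have : IsFiniteMeasure (volume.restrict (Ioo (0 : ℝ) t)) := ⟨by simp⟩
    exact memLp_const _
  have hsum := (hF.mapL (innerSL 𝕜 ((memLp_tensor hψ h1).toLp _)))
  have hleft : ∫ z in Ω ×ˢ Ioo (0 : ℝ) t, (starRingEnd 𝕜) (ψ z.1) * f z
      = inner 𝕜 ((memLp_tensor hψ h1).toLp _) F := by
    rw [L2.inner_def]
    have hms : MeasurableSet (Ω ×ˢ Ioo (0 : ℝ) t) := hΩ.prod measurableSet_Ioo
    have hss : Ω ×ˢ Ioo (0 : ℝ) t ⊆ Ω ×ˢ Ioo (0 : ℝ) T :=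
      prod_mono subset_rfl (Ioo_subset_Ioo le_rfl ht.2)
    have e1 : ∫ z in Ω ×ˢ Ioo (0 : ℝ) t, (starRingEnd 𝕜) (ψ z.1) * f z
        = ∫ z in Ω ×ˢ Ioo (0 : ℝ) t, (starRingEnd 𝕜) (ψ z.1) * F z := by
      refine integral_congr_ae ?_
      filter_upwards [ae_restrict_of_ae_restrict_of_subset hss
        (LpToLpRestrictCLM_coeFn 𝕜 (Ω ×ˢ Ioo (0 : ℝ) T) F)] with z hz
      rw [hz]
    rw [e1, ← integral_indicator hms]
    refine integral_congr_ae ?_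
    filter_upwards [(memLp_tensor hψ h1).coeFn_toLp] with z hz
    rw [hz, RCLike.inner_apply]
    by_cases hz1 : z.1 ∈ Ω
    · by_cases hz2 : z.2 ∈ Ioo (0 : ℝ) t
      · rw [indicator_of_mem (show z ∈ Ω ×ˢ Ioo (0 : ℝ) t from ⟨hz1, hz2⟩), indicator_of_mem hz1,
          indicator_of_mem hz2, mul_one, mul_comm]
      · rw [indicator_of_notMem fun h => hz2 h.2, indicator_of_notMem hz2]; simp
    · rw [indicator_of_notMem fun h => hz1 h.1, indicator_of_notMem hz1]; simp
  have hterm : ∀ i, innerSL 𝕜 ((memLp_tensor hψ h1).toLp _) (h i)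
      = (starRingEnd 𝕜) (sineCoeff (i + 1) (regionOp 𝕜 Ω ψ))
        * sineCoeff (i + 1) (∫ s in (0 : ℝ)..t, G s) := by
    intro i
    rw [innerSL_apply_apply, hh, inner_tensor hψ h1 (ha i) (hb i),
      sineCoeff_intervalIntegral _ (hGc.intervalIntegrable _ _), sineCoeff_eq_inner (i + 1),
      inner_conj_symm, inner_regionOp_left, inner_regionOp hΩ hsub]
    congr 1
    · rw [← integral_indicator hΩ]
      have h2 := (ae_restrict_iff' measurableSet_Ioo).1 (coeFn_sineVec (𝕜 := 𝕜) (i + 1))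
      refine integral_congr_ae ?_
      filter_upwards [h2] with x hx
      by_cases hxΩ : x ∈ Ω
      · rw [indicator_of_mem hxΩ, indicator_of_mem hxΩ, indicator_of_mem (hsub hxΩ),
          hx (hsub hxΩ)]
      · rw [indicator_of_notMem hxΩ, indicator_of_notMem hxΩ]; simp
    · rw [intervalIntegral.integral_of_le ht.1, integral_Ioc_eq_integral_Ioo,
        ← integral_indicator measurableSet_Ioo]
      refine integral_congr_ae (Filter.Eventually.of_forall fun s => ?_)
      by_cases hs : s ∈ Ioo (0 : ℝ) t
      · simp only [indicator_of_mem hs,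
          indicator_of_mem (show s ∈ Ioo (0 : ℝ) T from ⟨hs.1, hs.2.trans_le ht.2⟩), map_one,
          one_mul, hG s (mem_univ s)]
      · simp only [indicator_of_notMem hs, map_zero, zero_mul]
  rw [(regionOp 𝕜 Ω).intervalIntegral_comp_comm (hGc.intervalIntegrable _ _),
    ← inner_regionOp_left, hleft]
  refine hsum.unique ?_
  rw [funext hterm]
  exact hasSum_sineCoeff_mul _ _

end Region


/-! ### Superposition of the mode controls -/

/-- Schur's test for a symmetric neighbourhood relation of bounded degree. -/
lemma summable_sq_sum_neighbours {N : ℕ → Finset ℕ} (hsym : ∀ n k, k ∈ N n ↔ n ∈ N k) {M : ℕ}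
    (hcard : ∀ n, (N n).card ≤ M) {D : ℕ → ℝ} (hD : Summable fun n => D n ^ 2) :
    (Summable fun k => (∑ n ∈ N k, D n) ^ 2) ∧
      ∑' k, (∑ n ∈ N k, D n) ^ 2 ≤ (M : ℝ) ^ 2 * ∑' n, D n ^ 2 := by
  have hle : ∀ s : Finset ℕ, ∑ k ∈ s, (∑ n ∈ N k, D n) ^ 2 ≤ (M : ℝ) ^ 2 * ∑' n, D n ^ 2 := by
    intro s
    calc _ ≤ ∑ k ∈ s, (M : ℝ) * ∑ n ∈ N k, D n ^ 2 := by
          refine Finset.sum_le_sum fun k _ => sq_sum_le_card_mul_sum_sq.trans ?_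
          exact mul_le_mul_of_nonneg_right (by exact_mod_cast hcard k)
            (Finset.sum_nonneg fun _ _ => sq_nonneg _)
      _ = (M : ℝ) * ∑ n ∈ s.biUnion N, ∑ k ∈ s.filter (fun k => k ∈ N n), D n ^ 2 := by
          rw [← Finset.mul_sum, Finset.sum_comm']
          intro k n
          rw [Finset.mem_biUnion, Finset.mem_filter, hsym n k]
          exact ⟨fun h => ⟨h, k, h⟩, fun h => h.1⟩
      _ ≤ (M : ℝ) * ∑ n ∈ s.biUnion N, (M : ℝ) * D n ^ 2 := by
          refine mul_le_mul_of_nonneg_left (Finset.sum_le_sum fun n _ => ?_) (Nat.cast_nonneg _)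
          rw [Finset.sum_const, nsmul_eq_mul]
          refine mul_le_mul_of_nonneg_right ?_ (sq_nonneg _)
          have : (s.filter fun k => k ∈ N n).card ≤ M :=
            (Finset.card_le_card fun k hk => (Finset.mem_filter.1 hk).2).trans (hcard n)
          exact_mod_cast this
      _ = (M : ℝ) ^ 2 * ∑ n ∈ s.biUnion N, D n ^ 2 := by rw [← Finset.mul_sum]; ring
      _ ≤ _ := mul_le_mul_of_nonneg_left (hD.sum_le_tsum _ fun n _ => sq_nonneg _) (sq_nonneg _)
  have hs := summable_of_sum_le (fun k => sq_nonneg (∑ n ∈ N k, D n)) hle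
  exact ⟨hs, hs.tsum_le_of_sum_le hle⟩

section Superposition

variable {𝕜 : Type*} [RCLike 𝕜]

/-- The controls of `exists_mode_controls`, for data in `𝕜`. -/
lemma exists_mode_controls_rclike (𝕜 : Type*) [RCLike 𝕜] {α ρ : ℝ} (hρ : 0 < ρ)
    (hα : α < 3 / 2) :
    ∃ κ C : ℝ, ∃ M : ℕ, ∃ near : ℕ → Finset ℕ, 0 < κ ∧ 0 < C ∧
      (∀ n k, k ∈ near n ↔ n ∈ near k) ∧ (∀ n, n ∉ near n) ∧ (∀ n, (near n).card ≤ M) ∧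
      (∀ n, 0 ∉ near n) ∧ ∀ T : ℝ, 0 < T → T ≤ 1 → ∀ n : ℕ, 1 ≤ n → ∀ y₀ y₁ : 𝕜, ∃ g : ℝ → 𝕜,
        Continuous g ∧ (∀ t, T ≤ t → g t = 0) ∧
        (∀ t, ‖g t‖ ≤ C * Real.exp (κ / T ^ (1 / (rootExponent α - 1)))
          * ((n : ℝ) ^ 2 * ‖y₀‖ + ‖y₁‖)) ∧
        ∀ k : ℕ, 1 ≤ k → k ∉ near n → Steers (modeDamping α ρ k) ((k : ℝ) ^ 4) T g
          (if k = n then y₀ else 0) (if k = n then y₁ else 0) := by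
  obtain ⟨κ, C, M, near, hκ, hC, hsym, hself, hcard, hzero, h⟩ := exists_mode_controls hρ hα
  refine ⟨κ, C, M, near, hκ, hC, hsym, hself, hcard, hzero, fun T hT hT1 n hn y₀ y₁ => ?_⟩
  obtain ⟨g₀, hg₀, hg₀T, hg₀b, hg₀s⟩ := h T hT hT1 n hn 1 0
  obtain ⟨g₁, hg₁, hg₁T, hg₁b, hg₁s⟩ := h T hT hT1 n hn 0 1
  simp only [abs_one, abs_zero, add_zero, mul_one, mul_zero, zero_add] at hg₀b hg₁b
  set E := C * Real.exp (κ / T ^ (1 / (rootExponent α - 1))) with hE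
  refine ⟨fun t => y₀ * (g₀ t : 𝕜) + y₁ * (g₁ t : 𝕜), ?_, fun t ht => ?_, fun t => ?_,
    fun k hk hkn => ?_⟩
  · exact (continuous_const.mul (RCLike.continuous_ofReal.comp hg₀)).add
      (continuous_const.mul (RCLike.continuous_ofReal.comp hg₁))
  · simp only [hg₀T t ht, hg₁T t ht, RCLike.ofReal_zero, mul_zero, add_zero]
  · refine (norm_add_le _ _).trans ?_
    rw [norm_mul, norm_mul, RCLike.norm_ofReal, RCLike.norm_ofReal]
    have h0 := mul_le_mul_of_nonneg_left (hg₀b t) (norm_nonneg y₀)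
    have h1 := mul_le_mul_of_nonneg_left (hg₁b t) (norm_nonneg y₁)
    linarith
  · refine ((((hg₀s k hk hkn).ofReal (𝕜 := 𝕜)).const_mul y₀).add
      (((hg₁s k hk hkn).ofReal (𝕜 := 𝕜)).const_mul y₁)).congr (fun t => rfl) ?_ ?_
    · by_cases hkn : k = n <;> simp [hkn]
    · by_cases hkn : k = n <;> simp [hkn]

/-- The superposition `∑ n, g n t ψ_n` of time-dependent amplitudes and of functions
`ψ_n = ∑ k ∈ N n, β n k φ_k` acts on the `m`-th mode through `Ω` like the numerical series
`∑ n, (∫_Ω ψ_n φ_m) g n t`; the error of the truncated series is uniform in time. -/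
lemma norm_sineCoeff_regionOp_sub_le {Ω : Set ℝ} (hΩ : MeasurableSet Ω)
    (hsub : Ω ⊆ Ioo (0 : ℝ) Real.pi) {N : ℕ → Finset ℕ} (hsym : ∀ n k, k ∈ N n ↔ n ∈ N k) {M : ℕ}
    (hcard : ∀ n, (N n).card ≤ M) {β : ℕ → ℕ → ℝ} {B : ℝ} (hB : 0 ≤ B)
    (hβ : ∀ n, ∀ k ∈ N n, 1 ≤ k → |β n k| ≤ B) {g : ℕ → ℝ → 𝕜} {D : ℕ → ℝ}
    (hgD : ∀ n t, ‖g n t‖ ≤ D n) (hD : Summable fun n => D n ^ 2) {G : ℝ → BeamL2 𝕜}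
    (hG : ∀ i t, sineCoeff (i + 1) (G t) = ∑ n ∈ N (i + 1), (β n (i + 1) : 𝕜) * g n t)
    (m P : ℕ) (t : ℝ) :
    ‖sineCoeff m (regionOp 𝕜 Ω (G t)) - ∑ n ∈ Finset.range P,
        ((∑ k ∈ N n, β n k * ∫ x in Ω, sineFun k x * sineFun m x : ℝ) : 𝕜) * g n t‖ ^ 2
      ≤ ‖regionOp 𝕜 Ω (sineVec 𝕜 m)‖ ^ 2 * (B ^ 2 * ((M : ℝ) ^ 2
        * ((∑' n, D n ^ 2) - ∑ n ∈ Finset.range P, D n ^ 2))) := by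
  set D' : ℕ → ℝ := fun n => if n < P then 0 else D n with hD'
  have hD's : HasSum (fun n => D' n ^ 2) ((∑' n, D n ^ 2) - ∑ n ∈ Finset.range P, D n ^ 2) := by
    have e : (fun n => D' n ^ 2) = fun n => if n < P then 0 else D n ^ 2 := by
      funext n
      by_cases h : n < P <;> simp [hD', h]
    rw [e]
    exact hasSum_ite_lt hD P
  set Ψ : ℕ → BeamL2 𝕜 := fun n => ∑ k ∈ N n, (β n k : 𝕜) • sineVec 𝕜 k with hΨ
  set R : BeamL2 𝕜 := G t - ∑ n ∈ Finset.range P, g n t • Ψ n with hR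
  have hRc : ∀ i, sineCoeff (i + 1) R
      = ∑ n ∈ N (i + 1), if n < P then 0 else (β n (i + 1) : 𝕜) * g n t := by
    intro i
    have h1 : ∀ n, sineCoeff (i + 1) (g n t • Ψ n)
        = if i + 1 ∈ N n then (β n (i + 1) : 𝕜) * g n t else 0 := by
      intro n
      rw [sineCoeff_smul, hΨ, sineCoeff_sum]
      simp only [sineCoeff_smul, sineCoeff_sineVec _ _ (Nat.succ_pos i), mul_ite, mul_one, mul_zero]
      rw [Finset.sum_ite_eq]
      split_ifs
      · ring
      · simp
    rw [hR, sineCoeff_sub, hG, sineCoeff_sum, Finset.sum_congr rfl fun n _ => h1 n,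
      ← Finset.sum_filter]
    have e : (Finset.range P).filter (fun n => i + 1 ∈ N n)
        = (N (i + 1)).filter (fun n => n < P) := by
      ext n
      rw [Finset.mem_filter, Finset.mem_filter, Finset.mem_range, hsym n (i + 1), and_comm]
    rw [e, Finset.sum_filter, ← Finset.sum_sub_distrib]
    refine Finset.sum_congr rfl fun n _ => ?_
    split_ifs <;> simp
  have hRb : ∀ i, ‖sineCoeff (i + 1) R‖ ^ 2 ≤ B ^ 2 * (∑ n ∈ N (i + 1), D' n) ^ 2 := by
    intro i
    rw [hRc, ← mul_pow, Finset.mul_sum]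
    refine pow_le_pow_left₀ (norm_nonneg _) (norm_sum_le_of_le _ fun n hn => ?_) 2
    by_cases h : n < P
    · simp [hD', h]
    · simp only [hD', if_neg h, norm_mul, RCLike.norm_ofReal]
      exact mul_le_mul (hβ n (i + 1) ((hsym n _).2 hn) (Nat.succ_pos i)) (hgD n t)
        (norm_nonneg _) hB
  obtain ⟨hs, hsle⟩ := summable_sq_sum_neighbours hsym hcard hD's.summable
  have hRn : ‖R‖ ^ 2 ≤ B ^ 2 * ((M : ℝ) ^ 2
        * ((∑' n, D n ^ 2) - ∑ n ∈ Finset.range P, D n ^ 2)) := by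
    have h1 : Summable fun i => (∑ n ∈ N (i + 1), D' n) ^ 2 :=
      (summable_nat_add_iff (f := fun k => (∑ n ∈ N k, D' n) ^ 2) 1).2 hs
    have h2 := hasSum_le hRb (hasSum_norm_sineCoeff_sq R) (h1.hasSum.mul_left (B ^ 2))
    refine h2.trans (mul_le_mul_of_nonneg_left ?_ (sq_nonneg _))
    rw [← hD's.tsum_eq]
    refine le_trans ?_ hsle
    rw [hs.tsum_eq_zero_add]
    linarith [sq_nonneg (∑ n ∈ N 0, D' n)]
  have hΨm : ∀ n, sineCoeff m (regionOp 𝕜 Ω (Ψ n))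
      = ((∑ k ∈ N n, β n k * ∫ x in Ω, sineFun k x * sineFun m x : ℝ) : 𝕜) := by
    intro n
    rw [hΨ, map_sum, sineCoeff_sum, RCLike.ofReal_sum]
    refine Finset.sum_congr rfl fun k _ => ?_
    rw [map_smul, sineCoeff_smul, sineCoeff_eq_inner, inner_regionOp_sineVec hΩ hsub,
      RCLike.ofReal_mul]
  have hdiff : sineCoeff m (regionOp 𝕜 Ω (G t)) - ∑ n ∈ Finset.range P,
      ((∑ k ∈ N n, β n k * ∫ x in Ω, sineFun k x * sineFun m x : ℝ) : 𝕜) * g n t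
      = inner 𝕜 (regionOp 𝕜 Ω (sineVec 𝕜 m)) R := by
    rw [inner_regionOp_left, ← sineCoeff_eq_inner, hR, map_sub, sineCoeff_sub, map_sum,
      sineCoeff_sum]
    congr 1
    refine Finset.sum_congr rfl fun n _ => ?_
    rw [map_smul, sineCoeff_smul, hΨm, mul_comm]
  rw [hdiff]
  calc _ ≤ (‖regionOp 𝕜 Ω (sineVec 𝕜 m)‖ * ‖R‖) ^ 2 :=
        pow_le_pow_left₀ (norm_nonneg _) (norm_inner_le_norm _ _) 2
    _ = ‖regionOp 𝕜 Ω (sineVec 𝕜 m)‖ ^ 2 * ‖R‖ ^ 2 := mul_pow _ _ _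
    _ ≤ _ := mul_le_mul_of_nonneg_left hRn (sq_nonneg _)

/-- A mode whose forcing is a uniform limit of forcings that bring it to rest is brought to rest. -/
lemma eq_zero_of_steers {b c T : ℝ} (hb : 0 ≤ b) (hc : 0 < c) (hT : 0 ≤ T) {y v F : ℝ → 𝕜}
    (hF : Continuous F)
    (hy : ∀ t ∈ Icc (0 : ℝ) T, HasDerivWithinAt y (v t) (Icc (0 : ℝ) T) t)
    (hv : ∀ t ∈ Icc (0 : ℝ) T, HasDerivWithinAt v (F t - (b : 𝕜) * v t - (c : 𝕜) * y t)
      (Icc (0 : ℝ) T) t) {g : ℕ → ℝ → 𝕜} (hg : ∀ P, Continuous (g P))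
    (hst : ∀ᶠ P in Filter.atTop, Steers b c T (g P) (y 0) (v 0)) {ε : ℕ → ℝ}
    (hgF : ∀ P t, ‖F t - g P t‖ ^ 2 ≤ ε P) (hε : Filter.Tendsto ε Filter.atTop (nhds 0)) :
    y T = 0 ∧ v T = 0 := by
  have hle : ∀ᶠ P in Filter.atTop, c * ‖y T‖ ^ 2 + ‖v T‖ ^ 2 ≤ Real.exp T * (T * ε P) := by
    filter_upwards [hst] with P hP
    obtain ⟨r, s, hr, hs, hr0, hs0, hend⟩ := hP
    have h := oscillator_energy_le (y := fun t => y t - r t) (v := fun t => v t - s t) hb hc.le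
      (hF.sub (hg P)) (fun t ht => (hy t ht).sub (hr t).hasDerivWithinAt)
      (fun t ht => ((hv t ht).sub (hs t).hasDerivWithinAt).congr_deriv (by
        simp only [Pi.sub_apply]; ring)) (⟨hT, le_rfl⟩ : T ∈ Icc (0 : ℝ) T)
    simp only [hr0, hs0, (hend T le_rfl).1, (hend T le_rfl).2, sub_zero, sub_self, norm_zero] at h
    refine h.trans (mul_le_mul_of_nonneg_left ?_ (Real.exp_pos _).le)
    have h1 : ∫ t in (0 : ℝ)..T, ‖(F - g P) t‖ ^ 2 ≤ ∫ _ in (0 : ℝ)..T, ε P := by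
      refine intervalIntegral.integral_mono_on hT ?_ (by simp) fun t _ => hgF P t
      exact (((hF.sub (hg P)).norm).pow 2).intervalIntegrable _ _
    rw [intervalIntegral.integral_const, sub_zero, smul_eq_mul] at h1
    simpa using h1
  have hlim : Filter.Tendsto (fun P => Real.exp T * (T * ε P)) Filter.atTop (nhds 0) := by
    simpa using (hε.const_mul T).const_mul (Real.exp T)
  have h0 := ge_of_tendsto hlim hle
  have h1 : 0 ≤ c * ‖y T‖ ^ 2 := by positivity
  have h2 : ‖v T‖ ^ 2 = 0 := le_antisymm (by linarith) (sq_nonneg _)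
  have h3 : c * ‖y T‖ ^ 2 = 0 := le_antisymm (by linarith [sq_nonneg ‖v T‖]) h1
  have h4 : ‖y T‖ ^ 2 = 0 := (mul_eq_zero.1 h3).resolve_left hc.ne'
  exact ⟨by simpa using h4, by simpa using h2⟩

end Superposition

lemma div_rpow_min_le_costExponent {α κ T : ℝ} (hκ : 0 < κ) (hT : 0 < T) :
    κ / (min T 1) ^ (1 / (rootExponent α - 1)) ≤ κ + costExponent α κ T := by
  have hcost : costExponent α κ T = κ / T ^ (1 / (rootExponent α - 1)) := by
    unfold costExponent rootExponent
    split_ifs with h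
    · norm_num
    · congr 3; ring
  have h0 : 0 ≤ costExponent α κ T := by rw [hcost]; positivity
  rcases le_total T 1 with h | h
  · rw [min_eq_left h, ← hcost]; linarith
  · rw [min_eq_right h, Real.one_rpow, div_one]; linarith


lemma Steers.mono {𝕜 : Type*} [RCLike 𝕜] {b c T T' : ℝ} {g : ℝ → 𝕜} {y₀ y₁ : 𝕜}
    (h : Steers b c T g y₀ y₁) (hT : T ≤ T') : Steers b c T' g y₀ y₁ := by
  obtain ⟨r, v, h1, h2, h3, h4, h5⟩ := h
  exact ⟨r, v, h1, h2, h3, h4, fun t ht => h5 t (hT.trans ht)⟩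

lemma sineCoeff_zero {𝕜 : Type*} [RCLike 𝕜] (w : BeamL2 𝕜) : sineCoeff 0 w = 0 := by
  simp [sineCoeff]

lemma hasSum_norm_sineCoeff_sq_nat {𝕜 : Type*} [RCLike 𝕜] (w : BeamL2 𝕜) :
    HasSum (fun n => ‖sineCoeff n w‖ ^ 2) (‖w‖ ^ 2) := by
  have h := (hasSum_nat_add_iff (f := fun n => ‖sineCoeff n w‖ ^ 2) 1).1
    (hasSum_norm_sineCoeff_sq w)
  simpa [sineCoeff_zero] using h

/-- A truncated superposition of mode controls, acting on the mode `m` with the weights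
`∫_Ω ψ_n φ_m`, steers that mode to rest as soon as it contains the control of `m` itself: the
control of `n` steers every mode outside `near n`, and its weight on the modes of `near n`
vanishes. -/
lemma steers_truncated_sum {𝕜 : Type*} [RCLike 𝕜] {α ρ T : ℝ} {near : ℕ → Finset ℕ}
    (hself : ∀ n, n ∉ near n) {γ : ℕ → ℝ} {g : ℕ → ℝ → 𝕜} {y₀ y₁ : ℕ → 𝕜} {m : ℕ} (hm : 1 ≤ m)
    (hg0 : ∀ t, g 0 t = 0) (hγ : ∀ n, 1 ≤ n → m ∈ insert n (near n) → γ n = if m = n then 1 else 0)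
    (hg : ∀ n, 1 ≤ n → m ∉ near n → Steers (modeDamping α ρ m) ((m : ℝ) ^ 4) T (g n)
      (if m = n then y₀ n else 0) (if m = n then y₁ n else 0)) {P : ℕ} (hP : m < P) :
    Steers (modeDamping α ρ m) ((m : ℝ) ^ 4) T
      (fun t => ∑ n ∈ Finset.range P, (γ n : 𝕜) * g n t) (y₀ m) (y₁ m) := by
  have h := Steers.sum (b := modeDamping α ρ m) (c := (m : ℝ) ^ 4) (T := T) (Finset.range P)
    (g := fun n t => (γ n : 𝕜) * g n t) (y₀ := fun n => if m = n then y₀ n else 0)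
    (y₁ := fun n => if m = n then y₁ n else 0) fun n _ => ?_
  · have e : ∀ y : ℕ → 𝕜, y m = ∑ n ∈ Finset.range P, if m = n then y n else 0 := by
      intro y
      rw [Finset.sum_ite_eq, if_pos (Finset.mem_range.2 hP)]
    exact h.congr (fun _ => rfl) (e y₀) (e y₁)
  rcases Nat.eq_zero_or_pos n with rfl | hn
  · have hm0 : m ≠ 0 := by omega
    simp only [hg0, mul_zero, if_neg hm0]
    exact Steers.zero
  by_cases hmn : m ∈ near n
  · have hne : m ≠ n := fun h => hself n (h ▸ hmn)
    have h0 : γ n = 0 := by rw [hγ n hn (Finset.mem_insert_of_mem hmn), if_neg hne]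
    simp only [h0, RCLike.ofReal_zero, zero_mul, if_neg hne]
    exact Steers.zero
  · refine ((hg n hn hmn).const_mul (γ n : 𝕜)).congr (fun _ => rfl) ?_ ?_
    all_goals
      by_cases h : m = n
      · have h1 : γ n = 1 := by rw [hγ n hn (h ▸ Finset.mem_insert_self _ _), if_pos h]
        simp [h, h1]
      · simp [h]

end

theorem theorem2 {𝕜 : Type*} [RCLike 𝕜] (α ρ : ℝ) (hα0 : 0 ≤ α) (hα : α < 3 / 2) (hρ : 0 < ρ) :
    ∃ K : ℝ, 0 < K ∧
      ∀ Ω : Set ℝ, IsOpen Ω → Ω.Nonempty → Ω ⊆ Set.Ioo (0 : ℝ) Real.pi →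
        ∃ C : ℝ, 0 < C ∧
          ∀ T : ℝ, 0 < T →
            ∀ u₀ Δu₀ u₁ : BeamL2 𝕜, IsDirichletLaplacian u₀ Δu₀ →
              ∃ f : ControlL2 𝕜 Ω T,
                (∃ u v : ℝ → BeamL2 𝕜, IsBeamSolution α ρ Ω T f u₀ u₁ u v) ∧
                (∀ u v : ℝ → BeamL2 𝕜, IsBeamSolution α ρ Ω T f u₀ u₁ u v →
                  u T = 0 ∧ v T = 0) ∧
                ‖f‖ ≤ C * Real.exp (costExponent α K T) * (‖Δu₀‖ + ‖u₁‖) := by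
  obtain ⟨κ, C₁, M, near, hκ, hC₁, hsym, hself, hcard, hzero, hctrl⟩ :=
    exists_mode_controls_rclike 𝕜 hρ hα
  refine ⟨κ, hκ, fun Ω hΩ hne hsub => ?_⟩
  have hΩm := hΩ.measurableSet
  obtain ⟨B, hB, hdual⟩ := exists_dual_sines hΩ hne hsub (M + 1)
  set N : ℕ → Finset ℕ := fun n => insert n (near n) with hN
  have hNsym : ∀ n k, k ∈ N n ↔ n ∈ N k := by
    intro n k
    simp only [hN, Finset.mem_insert, hsym n k, eq_comm (a := k)]
  have hNcard : ∀ n, (N n).card ≤ M + 1 := fun n =>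
    (Finset.card_insert_le _ _).trans (Nat.succ_le_succ (hcard n))
  have hNpos : ∀ n, 1 ≤ n → ∀ k ∈ N n, 1 ≤ k := by
    intro n hn k hk
    rcases Finset.mem_insert.1 hk with rfl | hk
    · exact hn
    · exact Nat.pos_of_ne_zero fun h => hzero n (h ▸ hk)
  have hdual' : ∀ n, ∃ β : ℕ → ℝ, 1 ≤ n →
      (∀ j ∈ N n, ∑ k ∈ N n, β k * ∫ x in Ω, sineFun k x * sineFun j x
        = if j = n then 1 else 0) ∧ ∀ k ∈ N n, |β k| ≤ B := by
    intro n
    by_cases hn : 1 ≤ n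
    · obtain ⟨β, hβ⟩ := hdual (N n) (hNcard n) (hNpos n hn) n (Finset.mem_insert_self _ _)
      exact ⟨β, fun _ => hβ⟩
    · exact ⟨0, fun h => absurd h hn⟩
  choose β hβ using hdual'
  refine ⟨2 * B * (M + 1) * C₁ * Real.exp κ, by positivity, fun T hT u₀ Δu₀ u₁ hu₀ => ?_⟩
  -- for `T > 1` the control acts on `[0, 1]` only
  set τ : ℝ := min T 1 with hτ
  have hτ0 : 0 < τ := lt_min hT one_pos
  set E : ℝ := C₁ * Real.exp (κ / τ ^ (1 / (rootExponent α - 1))) with hE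
  have hE0 : 0 < E := by positivity
  have hex : ∀ n, ∃ g : ℝ → 𝕜, Continuous g ∧ (∀ t, τ ≤ t → g t = 0) ∧ (n = 0 → ∀ t, g t = 0) ∧
      (∀ t, ‖g t‖ ≤ E * (‖sineCoeff n Δu₀‖ + ‖sineCoeff n u₁‖)) ∧
      (1 ≤ n → ∀ k, 1 ≤ k → k ∉ near n → Steers (modeDamping α ρ k) ((k : ℝ) ^ 4) τ g
        (if k = n then sineCoeff n u₀ else 0) (if k = n then sineCoeff n u₁ else 0)) := by
    intro n
    rcases Nat.eq_zero_or_pos n with rfl | hn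
    · exact ⟨fun _ => 0, continuous_const, fun _ _ => rfl, fun _ _ => rfl,
        fun t => by rw [norm_zero]; positivity, fun h => absurd h (by omega)⟩
    · obtain ⟨g, h1, h2, h3, h4⟩ := hctrl τ hτ0 (min_le_right _ _) n hn (sineCoeff n u₀)
        (sineCoeff n u₁)
      refine ⟨g, h1, h2, fun h => absurd h (by omega), fun t => (h3 t).trans (le_of_eq ?_),
        fun _ => h4⟩
      rw [hu₀.coeff_eq hn, norm_mul, RCLike.norm_ofReal, abs_of_nonneg (sq_nonneg _)]
  choose g hgc hgτ hg0 hgD hgs using hex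
  set D : ℕ → ℝ := fun n => E * (‖sineCoeff n Δu₀‖ + ‖sineCoeff n u₁‖) with hD
  obtain ⟨hDs, hDle⟩ : (Summable fun n => D n ^ 2) ∧
      ∑' n, D n ^ 2 ≤ (2 * E * (‖Δu₀‖ + ‖u₁‖)) ^ 2 := by
    have h1 := ((hasSum_norm_sineCoeff_sq_nat Δu₀).add
      (hasSum_norm_sineCoeff_sq_nat u₁)).mul_left (2 * E ^ 2)
    have h2 : ∀ n, D n ^ 2 ≤ 2 * E ^ 2 * (‖sineCoeff n Δu₀‖ ^ 2 + ‖sineCoeff n u₁‖ ^ 2) := by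
      intro n
      simp only [hD]
      nlinarith [mul_nonneg (sq_nonneg E) (sq_nonneg (‖sineCoeff n Δu₀‖ - ‖sineCoeff n u₁‖))]
    have h3 : Summable fun n => D n ^ 2 :=
      Summable.of_nonneg_of_le (fun n => sq_nonneg _) h2 h1.summable
    refine ⟨h3, (hasSum_le h2 h3.hasSum h1).trans ?_⟩
    have h4 : 0 ≤ E ^ 2 * (‖Δu₀‖ * ‖u₁‖) := by positivity
    have h5 : 0 ≤ E ^ 2 * ‖Δu₀‖ ^ 2 := by positivity
    have h6 : 0 ≤ E ^ 2 * ‖u₁‖ ^ 2 := by positivity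
    nlinarith
  obtain ⟨hSs, hSle⟩ := summable_sq_sum_neighbours hNsym hNcard hDs
  set c : ℕ → ℝ → 𝕜 := fun i t => ∑ n ∈ N (i + 1), (β n (i + 1) : 𝕜) * g n t with hc
  have hβB : ∀ n, ∀ k ∈ N n, 1 ≤ k → |β n k| ≤ B := fun n k hk hk1 =>
    (hβ n (hNpos k hk1 n ((hNsym n k).1 hk))).2 k hk
  have hcD : ∀ i t, ‖c i t‖ ^ 2 ≤ B ^ 2 * (∑ n ∈ N (i + 1), D n) ^ 2 := by
    intro i t
    rw [← mul_pow, Finset.mul_sum]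
    refine pow_le_pow_left₀ (norm_nonneg _) (norm_sum_le_of_le _ fun n hn => ?_) 2
    rw [norm_mul, RCLike.norm_ofReal]
    exact mul_le_mul (hβB n (i + 1) ((hNsym n _).2 hn) (Nat.succ_pos i)) (hgD n t)
      (norm_nonneg _) hB.le
  have hs1 : Summable fun i => (∑ n ∈ N (i + 1), D n) ^ 2 :=
    (summable_nat_add_iff (f := fun k => (∑ n ∈ N k, D n) ^ 2) 1).2 hSs
  obtain ⟨f, G, hfn, hGc, hGcoef, hfG⟩ := exists_control (T := T) hΩm hsub (c := c)
    (fun i => continuous_finsetSum _ fun n _ => continuous_const.mul (hgc n))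
    (fun i t ht => Finset.sum_eq_zero fun n _ => by
      rw [hgτ n t ((min_le_right _ _).trans ht), mul_zero]) hcD (hs1.mul_left _)
  have hFc : Continuous fun s => regionOp 𝕜 Ω (G s) := (regionOp 𝕜 Ω).continuous.comp hGc
  refine ⟨f, ?_, fun u v huv => ?_, ?_⟩
  · obtain ⟨u, v, w, h1, h2, h3, h4, h5, h6, h7⟩ := exists_evolution (α := α) hρ.le hT hFc hu₀
      (u₁ := u₁)
    exact ⟨u, v, h1, h2, h3, h4, w, h5, h6, fun ψ ψΔ ψα hψΔ hψα t ht => by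
      rw [h7 ψ ψΔ ψα hψΔ hψα t ht, hfG ψ t ht]⟩
  · have hmode : ∀ i : ℕ, sineCoeff (i + 1) (u T) = 0 ∧ sineCoeff (i + 1) (v T) = 0 := by
      intro i
      set m : ℕ := i + 1 with hm
      have hm1 : 1 ≤ m := Nat.succ_pos i
      have hmode := fun t (ht : t ∈ Icc (0 : ℝ) T) => huv.mode hFc hfG hm1 ht
      set γ : ℕ → ℝ := fun n => ∑ k ∈ N n, β n k * ∫ x in Ω, sineFun k x * sineFun m x with hγ
      refine eq_zero_of_steers (b := modeDamping α ρ m) (c := (m : ℝ) ^ 4)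
        (modeDamping_nonneg hρ _)
        (by positivity) hT.le (F := fun t => sineCoeff m (regionOp 𝕜 Ω (G t)))
        (by simp only [sineCoeff_eq_inner]; exact continuous_const.inner hFc)
        (fun t ht => (hmode t ht).1) (fun t ht => (hmode t ht).2)
        (g := fun P t => ∑ n ∈ Finset.range P, (γ n : 𝕜) * g n t)
        (fun P => continuous_finsetSum _ fun n _ => continuous_const.mul (hgc n)) ?_
        (fun P t => norm_sineCoeff_regionOp_sub_le hΩm hsub hNsym hNcard hB.le hβB hgD hDs
          hGcoef m P t) ?_
      · filter_upwards [Filter.eventually_gt_atTop m] with P hP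
        have h := steers_truncated_sum (α := α) (ρ := ρ) (T := τ) hself (γ := γ) (g := g)
          (y₀ := fun n => sineCoeff n u₀) (y₁ := fun n => sineCoeff n u₁) hm1 (hg0 0 rfl)
          (fun n hn hmn => (hβ n hn).1 m hmn) (fun n hn hmn => hgs n hn m hm1 hmn) hP
        rw [huv.init_pos, huv.init_vel]
        exact h.mono (min_le_left _ _)
      · have h1 : Filter.Tendsto
            (fun P => (∑' n, D n ^ 2) - ∑ n ∈ Finset.range P, D n ^ 2) Filter.atTop (nhds 0) := by
          have h2 := (tendsto_const_nhds (x := ∑' n, D n ^ 2)).sub hDs.hasSum.tendsto_sum_nat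
          rwa [sub_self] at h2
        simpa using ((h1.const_mul (((M + 1 : ℕ) : ℝ) ^ 2)).const_mul (B ^ 2)).const_mul
          (‖regionOp 𝕜 Ω (sineVec 𝕜 m)‖ ^ 2)
    have h0 : ∀ i, sineCoeff (i + 1) (0 : BeamL2 𝕜) = 0 := fun i => by
      rw [sineCoeff_eq_inner, inner_zero_right]
    exact ⟨ext_sineCoeff fun i => by rw [(hmode i).1, h0],
      ext_sineCoeff fun i => by rw [(hmode i).2, h0]⟩
  · have h1 : ‖f‖ ^ 2 ≤ (B * (M + 1) * (2 * E * (‖Δu₀‖ + ‖u₁‖))) ^ 2 := by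
      refine hfn.trans ?_
      rw [tsum_mul_left, mul_pow _ (2 * E * _), mul_pow B, mul_assoc]
      refine mul_le_mul_of_nonneg_left ?_ (sq_nonneg _)
      have h2 : ∑' i, (∑ n ∈ N (i + 1), D n) ^ 2 ≤ ∑' k, (∑ n ∈ N k, D n) ^ 2 := by
        rw [hSs.tsum_eq_zero_add]
        linarith [sq_nonneg (∑ n ∈ N 0, D n)]
      refine h2.trans (hSle.trans ?_)
      push_cast
      exact mul_le_mul_of_nonneg_left hDle (sq_nonneg _)
    have h2 := le_of_sq_le_sq h1 (by positivity)
    refine h2.trans ?_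
    have h3 : E ≤ C₁ * (Real.exp κ * Real.exp (costExponent α κ T)) := by
      rw [hE, ← Real.exp_add]
      exact mul_le_mul_of_nonneg_left
        (Real.exp_le_exp.2 (div_rpow_min_le_costExponent hκ hT)) hC₁.le
    calc _ = 2 * B * (M + 1) * (‖Δu₀‖ + ‖u₁‖) * E := by ring
      _ ≤ 2 * B * (M + 1) * (‖Δu₀‖ + ‖u₁‖) * (C₁ * (Real.exp κ * Real.exp (costExponent α κ T))) :=
          mul_le_mul_of_nonneg_left h3 (by positivity)
      _ = _ := by ring
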